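/- Let $T>0$ and let $\{B_t\}_{0\le t\le T}$ be a one-dimensional Brownian motion on a probability space $(\Omega,\mathcal F,\mathcal P)$. For $h\in L^2([0,T]^n)$ let $I_n(h)\in L^2(\Omega)$ be the $n$-fold multiple Itô integral of $h$ with respect to $B$ ($I_0$ is the identity on constants). For $\lambda\ge 1$ let $\mathcal G_\lambda$ be the set of all $X\in L^2(\Omega)$ that have a chaos expansion $X=\sum_{n\ge0}I_n(h_n)$, with $h_n\in L^2([0,T]^n)$ symmetric (such $h_n$ are unique), for which $\sum_{n\ge0}n!\,\lambda^{2n}|h_n|^2_{L^2([0,T]^n)}<\infty$, and let $\mathcal G=\bigcap_{\lambda\ge1}\mathcal G_\lambda$. For $X=\sum_n I_n(h_n)\in\mathcal G$, $k\ge0$ and almost every $t=(t_1,\dots,t_k)\in[0,T]^k$, the $k$-th order Hida–Malliavin derivative is $$D^k_tX=\sum_{n\ge k}n(n-1)\cdots(n-k+1)\,I_{n-k}(h_n(\cdot,t_1,\dots,t_k))$$ (so $D^0X=X$). For $X=\sum_n I_n(h_n)$ and $Y=\sum_n I_n(g_n)$ in $\mathcal G$, the Wick product is $X\diamond Y=\sum_{n\ge0}I_n\big(\sum_{k+l=n}h_k\hat\otimes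 g_l\big)$, where $\hat\otimes$ is the symmetric tensor product, and the anti-Wick product is $$X\circ Y=\sum_{n\ge0}\frac1{n!}\int_{[0,T]^n}D^n_tX\cdot D^n_tY\,dt ,$$ where the integrals are Bochner integrals in $L^1(\Omega)$ and the series converges in $L^1(\Omega)$. **Proposition 5.1.** Let $X,Y\in\mathcal G$. The integrals and the series that define $X\circ Y$ exist. Moreover, for every $n\ge0$, $D^n_tX$ and $D^n_tY$ belong to $\mathcal G$ for almost every $t\in[0,T]^n$, and the map $t\mapsto D^n_tX\diamond D^n_tY$ is Bochner integrable on $[0,T]^n$ with values in $L^2(\Omega)$. Finally, $$X\circ Y=\sum_{n\ge0}\frac{2^n}{n!}\int_{[0,T]^n}D^n_tX\diamond D^n_tY\,dt\qquad\text{almost surely},$$ where the series on the right converges in $L^2(\Omega)$. -/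

import Mathlib

open MeasureTheory ProbabilityTheory Filter Topology

noncomputable section

/-- One-dimensional Brownian motion on the time interval `[0, T]`; only the random variables
`B t` with `t ∈ [0, T]` matter. -/
structure IsBrownianOn {Ω : Type*} [MeasurableSpace Ω] (P : Measure Ω) (T : ℝ)
    (B : ℝ → Ω → ℝ) : Prop where
  measurable : ∀ t ∈ Set.Icc 0 T, Measurable (B t)
  start_zero : ∀ᵐ ω ∂P, B 0 ω = 0
  indep_increments : HasIndepIncrements (fun t : Set.Icc (0 : ℝ) T => B t) P
  gaussian_increments : ∀ s t : ℝ, 0 ≤ s → s ≤ t → t ≤ T →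
    P.map (fun ω => B t ω - B s ω) = gaussianReal 0 (t - s).toNNReal
  continuous_paths : ∀ᵐ ω ∂P, ContinuousOn (fun t => B t ω) (Set.Icc 0 T)

/-- Lebesgue measure on the cube `[0, T]ⁿ`. For `n = 0` it is the unit mass at a single point. -/
def cubeMeasure (T : ℝ) (n : ℕ) : Measure (Fin n → ℝ) :=
  Measure.pi fun _ => volume.restrict (Set.Icc 0 T)

instance (T : ℝ) (n : ℕ) : IsFiniteMeasure (cubeMeasure T n) := by
  unfold cubeMeasure; infer_instance

/-- Deterministic kernels: the space `L²([0, T]ⁿ)`. -/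
abbrev Kern (T : ℝ) (n : ℕ) : Type := Lp ℝ 2 (cubeMeasure T n)

open Classical in
/-- The class in `L²` of a square integrable function (and `0` for any other function). -/
def toL2 {α : Type*} [MeasurableSpace α] (μ : Measure α) (f : α → ℝ) : Lp ℝ 2 μ :=
  if hf : MemLp f 2 μ then hf.toLp f else 0

/-- Symmetric kernels. -/
def IsSymmKern {T : ℝ} {n : ℕ} (h : Kern T n) : Prop :=
  ∀ σ : Equiv.Perm (Fin n), (fun t => h (fun i => t (σ i))) =ᵐ[cubeMeasure T n] h

/-- The symmetric tensor product, as a function of `k + l` variables. -/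
def symmTensor {k l : ℕ} (f : (Fin k → ℝ) → ℝ) (g : (Fin l → ℝ) → ℝ) :
    (Fin (k + l) → ℝ) → ℝ := fun t =>
  (1 / ((k + l).factorial : ℝ)) * ∑ σ : Equiv.Perm (Fin (k + l)),
    f (fun i => t (σ (Fin.castAdd l i))) * g (fun j => t (σ (Fin.natAdd k j)))

section Chaos

variable {Ω : Type*} [MeasurableSpace Ω] (P : Measure Ω) [IsProbabilityMeasure P]
  (T : ℝ) (B : ℝ → Ω → ℝ)

/-- The elementary values of the `n`-fold Itô integral: the kernel is the indicator of a box
`(a₁, b₁] × ⋯ × (aₙ, bₙ]` in `[0, T]ⁿ` with pairwise disjoint sides (so that the box does not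
meet the diagonals) and its integral is `∏ᵢ (B (bᵢ) - B (aᵢ))`. -/
def elementaryIto (n : ℕ) : Set (Kern T n × Lp ℝ 2 P) :=
  {p | ∃ a b : Fin n → ℝ, (∀ i, 0 ≤ a i ∧ a i ≤ b i ∧ b i ≤ T) ∧
    (∀ i j, i ≠ j → Disjoint (Set.Ioc (a i) (b i)) (Set.Ioc (a j) (b j))) ∧
    (p.1 : (Fin n → ℝ) → ℝ) =ᵐ[cubeMeasure T n]
      (Set.univ.pi fun i => Set.Ioc (a i) (b i)).indicator (fun _ => (1 : ℝ)) ∧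
    (p.2 : Ω → ℝ) =ᵐ[P] fun ω => ∏ i, (B (b i) ω - B (a i) ω)}

/-- The graph of the `n`-fold Itô integral: extend the elementary values linearly to step functions
vanishing near the diagonals, then by `L²`-continuity. -/
def itoGraph (n : ℕ) : Submodule ℝ (Kern T n × Lp ℝ 2 P) :=
  (Submodule.span ℝ (elementaryIto P T B n)).topologicalClosure

open Classical in
/-- The multiple Itô integral `Iₙ(h)` of `h ∈ L²([0, T]ⁿ)`, the unique random variable that the
graph assigns to `h`. For `n = 0` it is the constant `h`. -/
def multIto (n : ℕ) (h : Kern T n) : Lp ℝ 2 P :=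
  if hX : ∃ X, (h, X) ∈ itoGraph P T B n then hX.choose else 0

/-- `X = ∑ₙ Iₙ(hₙ)` in `L²(Ω)`, with symmetric kernels `hₙ`. -/
def IsChaosExpansion (X : Lp ℝ 2 P) (h : (n : ℕ) → Kern T n) : Prop :=
  (∀ n, IsSymmKern (h n)) ∧ HasSum (fun n => multIto P T B n (h n)) X

open Classical in
/-- The (unique) sequence of symmetric chaos kernels of `X`. -/
def chaosKernel (X : Lp ℝ 2 P) : (n : ℕ) → Kern T n :=
  if hX : ∃ h, IsChaosExpansion P T B X h then hX.choose else 0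

/-- The space `𝒢_lam` of the random variables `X = ∑ₙ Iₙ(hₙ) ∈ L²(Ω)` with
`∑ₙ n! lam²ⁿ |hₙ|² < ∞`. -/
def GSpace (lam : ℝ) : Set (Lp ℝ 2 P) :=
  {X | ∃ h : (n : ℕ) → Kern T n, IsChaosExpansion P T B X h ∧
    Summable fun n => (n.factorial : ℝ) * lam ^ (2 * n) * ‖h n‖ ^ 2}

/-- The space `𝒢`, the intersection of all `𝒢_lam`, `lam ≥ 1`. -/
def GSmooth : Set (Lp ℝ 2 P) := {X | ∀ lam : ℝ, 1 ≤ lam → X ∈ GSpace P T B lam}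

/-- The Hida-Malliavin derivative of order `k` at `t = (t₁, …, t_k)`,
`∑_{n ≥ k} n (n - 1) ⋯ (n - k + 1) I_{n-k}(hₙ(·, t₁, …, t_k))`, summed over `m = n - k`.
For `k = 0` it is `X`. -/
def hidaD (k : ℕ) (X : Lp ℝ 2 P) (t : Fin k → ℝ) : Lp ℝ 2 P :=
  ∑' m : ℕ, ((m + k).descFactorial k : ℝ) •
    multIto P T B m
      (toL2 (cubeMeasure T m) fun s => chaosKernel P T B X (m + k) (Fin.append s t))

/-- The Wick product, `∑ₙ Iₙ(∑_{k+l=n} h_k ⊗̂ g_l)` for `X = ∑ I_k(h_k)` and `Y = ∑ I_l(g_l)`,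
where `⊗̂` is the symmetric tensor product. -/
def wick (X Y : Lp ℝ 2 P) : Lp ℝ 2 P :=
  ∑' n : ℕ, ∑ p ∈ Finset.HasAntidiagonal.antidiagonal n, multIto P T B (p.1 + p.2)
    (toL2 (cubeMeasure T (p.1 + p.2))
      (symmTensor (chaosKernel P T B X p.1) (chaosKernel P T B Y p.2)))

/-- The pointwise product of two elements of `L²(Ω)`, in `L¹(Ω)`. -/
def mulL1 (X Y : Lp ℝ 2 P) : Lp ℝ 1 P :=
  ((Lp.memLp X).integrable_mul (Lp.memLp Y)).toL1 (fun ω => X ω * Y ω)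

/-- The anti-Wick product `∑ₙ (1/n!) ∫_{[0,T]ⁿ} DⁿₜX · DⁿₜY dt`, a series of Bochner integrals
in `L¹(Ω)`. -/
def antiWick (X Y : Lp ℝ 2 P) : Lp ℝ 1 P :=
  ∑' n : ℕ, (1 / (n.factorial : ℝ)) •
    ∫ t, mulL1 P (hidaD P T B n X t) (hidaD P T B n Y t) ∂(cubeMeasure T n)

end Chaos

end

/-! For powers the identity is algebra. Let φ, ψ be bounded measurable functions, c = ⟨φ, ψ⟩ in
L²([0,T]), and v(p,q) = I_{p+q}(φ^{⊗p} ⊗ ψ^{⊗q}) / (p! q!). Multiplication by the Wiener integral of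
ψ gives a Hermite type recursion for v, and from it the product formula v(p,0) v(0,q) = Σ_r c^r/r! ·
v(p-r,q-r) (`HermiteRec.mul_eq_sum_lowered`). If L lowers both indices by one, the product is thus
e^{cL} applied to the Wick product. Integrating D^k of one power against D^k of the other produces a
factor c^k and lowers both degrees by k, so that the anti-Wick product is again e^{cL}, now applied
to the product. Hence the anti-Wick product is e^{cL} e^{cL} = e^{2cL} applied to the Wick product,
which is the claim and the origin of 2^n (`HermiteRec.sum_mul_eq`, `sum_prodB_pow`).

The recursion rests on the formula I_n(g) I_1(φ) = I_{n+1}(g ⊗ φ) + (sum of the contractions),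
`mulL_itoL_itoL_one`. Both sides are bounded and bilinear, so cells of a grid suffice. A new cell
gives an elementary integral. A repeated cell needs the quadratic variation: the double integral
over the square (u,v]² is (B_v - B_u)² - (v - u) (`inclL_itoL_double`), because on subdividing into
K cells everything off the diagonal cancels and the diagonal terms have norm of order K^{-1/2}.

The integral itself is given by the closure of its graph on off-diagonal boxes. Independence of
increments yields the isometry, the isometry makes the graph that of a bounded operator, and the
density of the step functions makes the operator defined everywhere
(`span_boxes_topologicalClosure`, `inner_snd_of_mem_itoGraph`, `exists_mem_itoGraph`).

Polarization carries the identity from powers to arbitrary symmetric kernels (`sum_prodB_eq`). For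
general X and Y the kernels decay faster than every geometric rate in the norm √n!‖h_n‖, which
dominates the triple series over the order k and the degrees p, q of the remaining integrals
(`summable_weight`). Integration and summation may then be exchanged, and grouping the terms by the
degrees p + k and q + k of the original kernels reduces the claim to pairs of chaoses
(`inclL_tsum_eq`). Products live in L¹(Ω) only, so identities that involve them are stated there,
through the inclusion `inclL` of L². -/

noncomputable section

set_option linter.unusedSectionVars false

/-! ### Square integrable functions and their classes -/

section ToL2

variable {α : Type*} [MeasurableSpace α] {μ : Measure α}

theorem toL2_of_memLp {f : α → ℝ} (hf : MemLp f 2 μ) : toL2 μ f = hf.toLp f := dif_pos hf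

theorem coeFn_toL2 {f : α → ℝ} (hf : MemLp f 2 μ) : toL2 μ f =ᵐ[μ] f := by
  rw [toL2_of_memLp hf]; exact hf.coeFn_toLp

theorem toL2_congr {f g : α → ℝ} (h : f =ᵐ[μ] g) : toL2 μ f = toL2 μ g := by
  by_cases hf : MemLp f 2 μ
  · rw [toL2_of_memLp hf, toL2_of_memLp (hf.ae_eq h)]
    exact (MemLp.toLp_eq_toLp_iff _ _).2 h
  · have hg : ¬ MemLp g 2 μ := fun hg => hf (hg.ae_eq h.symm)
    simp [toL2, hf, hg]

theorem toL2_coeFn (f : Lp ℝ 2 μ) : toL2 μ f = f := by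
  rw [toL2_of_memLp (Lp.memLp f)]; exact Lp.toLp_coeFn f _

theorem eq_toL2 {f : Lp ℝ 2 μ} {g : α → ℝ} (h : f =ᵐ[μ] g) : f = toL2 μ g := by
  rw [← toL2_congr h, toL2_coeFn]

theorem toL2_add {f g : α → ℝ} (hf : MemLp f 2 μ) (hg : MemLp g 2 μ) :
    toL2 μ (fun x => f x + g x) = toL2 μ f + toL2 μ g := by
  symm; apply eq_toL2
  filter_upwards [Lp.coeFn_add (toL2 μ f) (toL2 μ g), coeFn_toL2 hf, coeFn_toL2 hg] with x h1 h2 h3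
  rw [h1, Pi.add_apply, h2, h3]

theorem toL2_smul {f : α → ℝ} (hf : MemLp f 2 μ) (c : ℝ) :
    toL2 μ (fun x => c * f x) = c • toL2 μ f := by
  symm; apply eq_toL2
  filter_upwards [Lp.coeFn_smul c (toL2 μ f), coeFn_toL2 hf] with x h1 h2
  simp [h1, h2]

theorem toL2_zero : toL2 μ (fun _ => 0) = 0 := by
  symm; apply eq_toL2; exact Lp.coeFn_zero _ _ _

theorem toL2_sum {ι : Type*} (s : Finset ι) {f : ι → α → ℝ} (hf : ∀ i ∈ s, MemLp (f i) 2 μ) :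
    toL2 μ (fun x => ∑ i ∈ s, f i x) = ∑ i ∈ s, toL2 μ (f i) := by
  classical
  induction s using Finset.induction_on with
  | empty => simp [toL2_zero]
  | insert a s ha ih =>
    simp only [Finset.sum_insert ha]
    rw [toL2_add (hf a (by simp)) (memLp_finsetSum s fun i hi => hf i (by simp [hi])),
      ih fun i hi => hf i (by simp [hi])]

theorem inner_eq_integral_mul (f g : Lp ℝ 2 μ) : inner ℝ f g = ∫ x, f x * g x ∂μ := by
  rw [L2.inner_def]
  refine integral_congr_ae (Eventually.of_forall fun x => ?_)
  simp [mul_comm]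

theorem inner_toL2 {f g : α → ℝ} (hf : MemLp f 2 μ) (hg : MemLp g 2 μ) :
    inner ℝ (toL2 μ f) (toL2 μ g) = ∫ x, f x * g x ∂μ := by
  rw [inner_eq_integral_mul]
  refine integral_congr_ae ?_
  filter_upwards [coeFn_toL2 hf, coeFn_toL2 hg] with x h1 h2
  rw [h1, h2]

end ToL2

/-! ### Tensor products of bounded functions of one variable -/

/-- Lebesgue measure on `[0, T]`. -/
abbrev itvMeasure (T : ℝ) : Measure ℝ := volume.restrict (Set.Icc 0 T)

/-- Bounded measurable functions. -/
def BddMeas {α : Type*} [MeasurableSpace α] (f : α → ℝ) : Prop :=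
  Measurable f ∧ ∃ C, ∀ x, |f x| ≤ C

namespace BddMeas

variable {α : Type*} [MeasurableSpace α] {f g : α → ℝ}

theorem memLp (hf : BddMeas f) (μ : Measure α) [IsFiniteMeasure μ] (p : ENNReal) : MemLp f p μ := by
  obtain ⟨h, C, hC⟩ := hf
  exact MemLp.of_bound h.aestronglyMeasurable C (Eventually.of_forall hC)

theorem mul (hf : BddMeas f) (hg : BddMeas g) : BddMeas fun x => f x * g x := by
  obtain ⟨h, C, hC⟩ := hf
  obtain ⟨h', C', hC'⟩ := hg
  refine ⟨h.mul h', C * C', fun x => ?_⟩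
  rw [abs_mul]
  exact mul_le_mul (hC x) (hC' x) (abs_nonneg _) ((abs_nonneg _).trans (hC x))

theorem const (c : ℝ) : BddMeas fun _ : α => c := ⟨measurable_const, |c|, fun _ => le_rfl⟩

theorem prod {ι : Type*} (s : Finset ι) {f : ι → α → ℝ} (hf : ∀ i ∈ s, BddMeas (f i)) :
    BddMeas fun x => ∏ i ∈ s, f i x := by
  classical
  induction s using Finset.induction_on with
  | empty => simpa using const 1
  | insert a s ha ih =>
    simp only [Finset.prod_insert ha]
    exact (hf a (by simp)).mul (ih fun i hi => hf i (by simp [hi]))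

theorem add (hf : BddMeas f) (hg : BddMeas g) : BddMeas fun x => f x + g x := by
  obtain ⟨h, C, hC⟩ := hf
  obtain ⟨h', C', hC'⟩ := hg
  exact ⟨h.add h', C + C', fun x => (abs_add_le _ _).trans (add_le_add (hC x) (hC' x))⟩

theorem sum {ι : Type*} (s : Finset ι) {f : ι → α → ℝ} (hf : ∀ i ∈ s, BddMeas (f i)) :
    BddMeas fun x => ∑ i ∈ s, f i x := by
  classical
  induction s using Finset.induction_on with
  | empty => simpa using const 0
  | insert a s ha ih =>
    simp only [Finset.sum_insert ha]
    exact (hf a (by simp)).add (ih fun i hi => hf i (by simp [hi]))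

theorem comp {β : Type*} [MeasurableSpace β] (hf : BddMeas f) {u : β → α} (hu : Measurable u) :
    BddMeas fun x => f (u x) := ⟨hf.1.comp hu, hf.2.imp fun _ h x => h (u x)⟩

theorem prod_eval {n : ℕ} {f : Fin n → ℝ → ℝ} (hf : ∀ i, BddMeas (f i)) :
    BddMeas fun t : Fin n → ℝ => ∏ i, f i (t i) :=
  prod _ fun i _ => (hf i).comp (measurable_pi_apply i)

end BddMeas

/-- The indicator of the interval `(a, b]`. -/
def ivl (a b : ℝ) : ℝ → ℝ := (Set.Ioc a b).indicator fun _ => 1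

theorem bddMeas_ivl (a b : ℝ) : BddMeas (ivl a b) := by
  refine ⟨measurable_const.indicator measurableSet_Ioc, 1, fun x => ?_⟩
  unfold ivl
  by_cases h : x ∈ Set.Ioc a b <;> simp [h]

theorem prod_ivl {n : ℕ} (a b : Fin n → ℝ) :
    (fun t : Fin n → ℝ => ∏ i, ivl (a i) (b i) (t i)) =
      (Set.univ.pi fun i => Set.Ioc (a i) (b i)).indicator fun _ => (1 : ℝ) := by
  ext t
  by_cases h : t ∈ Set.univ.pi fun i => Set.Ioc (a i) (b i)
  · rw [Set.indicator_of_mem h]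
    exact Finset.prod_eq_one fun i _ => Set.indicator_of_mem (h i trivial) _
  · rw [Set.indicator_of_notMem h]
    simp only [Set.mem_pi, Set.mem_univ, true_imp_iff, not_forall] at h
    obtain ⟨i, hi⟩ := h
    exact Finset.prod_eq_zero (Finset.mem_univ i) (Set.indicator_of_notMem hi _)

section Tens

variable {T : ℝ} {n : ℕ}

/-- The tensor product `f₁ ⊗ ⋯ ⊗ fₙ`. -/
def tens (T : ℝ) {n : ℕ} (f : Fin n → ℝ → ℝ) : Kern T n :=
  toL2 (cubeMeasure T n) fun t => ∏ i, f i (t i)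

theorem coeFn_tens {f : Fin n → ℝ → ℝ} (hf : ∀ i, BddMeas (f i)) :
    tens T f =ᵐ[cubeMeasure T n] fun t => ∏ i, f i (t i) :=
  coeFn_toL2 ((BddMeas.prod_eval hf).memLp _ _)

theorem inner_tens {f g : Fin n → ℝ → ℝ} (hf : ∀ i, BddMeas (f i)) (hg : ∀ i, BddMeas (g i)) :
    inner ℝ (tens T f) (tens T g) = ∏ i, ∫ x, f i x * g i x ∂(itvMeasure T) := by
  unfold tens
  rw [inner_toL2 ((BddMeas.prod_eval hf).memLp _ _) ((BddMeas.prod_eval hg).memLp _ _)]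
  simp_rw [← Finset.prod_mul_distrib]
  exact integral_fintype_prod_eq_prod (μ := fun _ => itvMeasure T) fun i x => f i x * g i x

theorem tens_sum {κ : Type*} (s : Fin n → Finset κ) {f : Fin n → κ → ℝ → ℝ}
    (hf : ∀ i j, BddMeas (f i j)) :
    tens T (fun i x => ∑ j ∈ s i, f i j x) =
      ∑ c ∈ Fintype.piFinset s, tens T fun i => f i (c i) := by
  classical
  unfold tens
  rw [← toL2_sum _ fun c _ => (BddMeas.prod_eval fun i => hf i (c i)).memLp _ _]
  simp_rw [Finset.prod_univ_sum]

theorem measurePreserving_perm (σ : Equiv.Perm (Fin n)) :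
    MeasurePreserving (fun (t : Fin n → ℝ) i => t (σ i)) (cubeMeasure T n) (cubeMeasure T n) := by
  refine ⟨by fun_prop, ?_⟩
  symm
  apply Measure.pi_eq
  intro s hs
  rw [Measure.map_apply (by fun_prop) (MeasurableSet.univ_pi hs)]
  have : (fun (t : Fin n → ℝ) i => t (σ i)) ⁻¹' Set.univ.pi s
      = Set.univ.pi fun i => s (σ.symm i) := by
    ext t
    simp only [Set.mem_preimage, Set.mem_pi, Set.mem_univ, true_imp_iff]
    exact ⟨fun h i => by simpa using h (σ.symm i), fun h i => by simpa using h (σ i)⟩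
  rw [this, cubeMeasure, Measure.pi_pi]
  exact Equiv.prod_comp σ.symm fun i => (itvMeasure T) (s i)

/-- Permutation of the variables of a kernel. -/
def permK (σ : Equiv.Perm (Fin n)) : Kern T n →ₗᵢ[ℝ] Kern T n :=
  Lp.compMeasurePreservingₗᵢ ℝ _ (measurePreserving_perm σ)

theorem coeFn_permK (σ : Equiv.Perm (Fin n)) (h : Kern T n) :
    permK σ h =ᵐ[cubeMeasure T n] fun t => h fun i => t (σ i) :=
  Lp.coeFn_compMeasurePreserving h (measurePreserving_perm σ)

theorem permK_tens (σ : Equiv.Perm (Fin n)) {f : Fin n → ℝ → ℝ} (hf : ∀ i, BddMeas (f i)) :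
    permK σ (tens T f) = tens T fun i => f (σ.symm i) := by
  apply eq_toL2
  filter_upwards [coeFn_permK σ (tens T f),
    (measurePreserving_perm σ).quasiMeasurePreserving.ae_eq_comp (coeFn_tens (T := T) hf)]
    with t h1 h2
  simp only [Function.comp] at h2
  rw [h1, h2]
  exact (Equiv.prod_comp σ.symm fun i => f i (t (σ i))).symm.trans (by simp)

theorem permK_mul (σ τ : Equiv.Perm (Fin n)) (h : Kern T n) :
    permK σ (permK τ h) = permK (σ * τ) h := by
  apply Lp.ext
  filter_upwards [coeFn_permK σ (permK τ h), coeFn_permK (σ * τ) h,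
    (measurePreserving_perm σ).quasiMeasurePreserving.ae_eq_comp (coeFn_permK τ h)] with t h1 h2 h3
  simp only [Function.comp] at h3
  rw [h1, h2, h3]
  simp

theorem permK_one (h : Kern T n) : permK 1 h = h := by
  apply Lp.ext
  filter_upwards [coeFn_permK 1 h] with t h1
  rw [h1]; simp

theorem isSymmKern_iff {h : Kern T n} : IsSymmKern h ↔ ∀ σ, permK σ h = h := by
  refine forall_congr' fun σ => ⟨fun H => Lp.ext ((coeFn_permK σ h).trans H), fun H => ?_⟩
  exact (coeFn_permK σ h).symm.trans (by rw [H])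

theorem inner_permK (σ : Equiv.Perm (Fin n)) (h g : Kern T n) :
    inner ℝ (permK σ h) g = inner ℝ h (permK σ⁻¹ g) := by
  rw [← (permK σ).inner_map_map h, permK_mul, mul_inv_cancel, permK_one]

end Tens

/-! ### Density of the boxes off the diagonals -/

section Density

variable {T : ℝ} {n : ℕ}

/-- The end points `a`, `b` of a box in `[0, T]ⁿ` that does not meet the diagonals. -/
def OffDiag (T : ℝ) {n : ℕ} (a b : Fin n → ℝ) : Prop :=
  (∀ i, 0 ≤ a i ∧ a i ≤ b i ∧ b i ≤ T) ∧
    ∀ i j, i ≠ j → Disjoint (Set.Ioc (a i) (b i)) (Set.Ioc (a j) (b j))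

theorem cubeMeasure_absolutelyContinuous : cubeMeasure T n ≪ volume := by
  unfold cubeMeasure
  rw [← Measure.restrict_pi_pi]
  exact Measure.restrict_le_self.absolutelyContinuous

/-- The diagonals are proper linear subspaces, hence Lebesgue null. Almost every point therefore
lies in some off-diagonal box. -/
theorem ae_injective_cube : ∀ᵐ t ∂(cubeMeasure T n), Function.Injective t := by
  have key : ∀ i j : Fin n, i ≠ j → ∀ᵐ t ∂(cubeMeasure T n), t i ≠ t j := by
    intro i j hij
    apply cubeMeasure_absolutelyContinuous.ae_le
    change volume {t : Fin n → ℝ | ¬ t i ≠ t j} = 0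
    let S : Submodule ℝ (Fin n → ℝ) :=
      LinearMap.ker (LinearMap.proj (R := ℝ) (φ := fun _ : Fin n => ℝ) i - LinearMap.proj j)
    have : {t : Fin n → ℝ | ¬ t i ≠ t j} = S := by
      ext t; simp [S, sub_eq_zero]
    rw [this]
    apply Measure.addHaar_submodule
    intro h
    have : Pi.single i (1 : ℝ) ∈ S := by rw [h]; trivial
    simp [S, hij] at this
  have : ∀ᵐ t ∂(cubeMeasure T n), ∀ i j : Fin n, i ≠ j → t i ≠ t j := by
    simp only [ae_all_iff]
    exact fun i j h => key i j h
  filter_upwards [this] with t ht i j h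
  by_contra hne
  exact ht i j hne h

theorem ae_mem_Ioc_cube : ∀ᵐ t ∂(cubeMeasure T n), ∀ i, t i ∈ Set.Ioc 0 T := by
  rw [ae_all_iff]
  intro i
  have h : ∀ᵐ x ∂(itvMeasure T), x ∈ Set.Ioc 0 T := by
    have : itvMeasure T = volume.restrict (Set.Ioc 0 T) := restrict_Ioc_eq_restrict_Icc.symm
    rw [this]
    exact ae_restrict_mem measurableSet_Ioc
  exact (Measure.tendsto_eval_ae_ae (μ := fun _ : Fin n => itvMeasure T)).eventually h

/-- Boxes inside a fixed off-diagonal box Q are again off-diagonal, and the intersections of Q with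
all boxes come from a π-system generating the Borel sets. Restricting to Q is what makes the
complement step work, since the integral over Q itself vanishes. -/
theorem setIntegral_eq_zero_of_boxes {a b : Fin n → ℝ} (hab : OffDiag T a b) {h : Kern T n}
    (H : ∀ a b : Fin n → ℝ, OffDiag T a b →
      inner ℝ (tens T fun i => ivl (a i) (b i)) h = 0)
    {A : Set (Fin n → ℝ)} (hA : MeasurableSet A) :
    ∫ t in A, h t ∂((cubeMeasure T n).restrict (Set.univ.pi fun i => Set.Ioc (a i) (b i))) = 0 := by
  set Q : Set (Fin n → ℝ) := Set.univ.pi fun i => Set.Ioc (a i) (b i) with hQ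
  have hQm : MeasurableSet Q := MeasurableSet.univ_pi fun i => measurableSet_Ioc
  have hint : Integrable h (cubeMeasure T n) := (Lp.memLp h).integrable (by norm_num)
  have hbox : ∀ a' b' : Fin n → ℝ, OffDiag T a' b' →
      ∫ t in Set.univ.pi fun i => Set.Ioc (a' i) (b' i), h t ∂(cubeMeasure T n) = 0 := by
    intro a' b' hab'
    rw [← H a' b' hab', inner_eq_integral_mul,
      ← integral_indicator (MeasurableSet.univ_pi fun i => measurableSet_Ioc)]
    refine integral_congr_ae ?_
    filter_upwards [coeFn_tens (T := T) fun i => bddMeas_ivl (a' i) (b' i)] with t ht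
    rw [ht, congrFun (prod_ivl a' b') t]
    by_cases h : t ∈ Set.univ.pi fun i => Set.Ioc (a' i) (b' i) <;> simp [h]
  have hspan : IsCountablySpanning {S : Set ℝ | ∃ l u : ℝ, l < u ∧ Set.Ioc l u = S} := by
    refine ⟨fun k : ℕ => Set.Ioc (-(k : ℝ) - 1) k, fun k => ⟨_, _, by
      have : (0 : ℝ) ≤ k := k.cast_nonneg
      linarith, rfl⟩, ?_⟩
    refine Set.eq_univ_of_forall fun x => ?_
    obtain ⟨k, hk⟩ := exists_nat_ge |x|
    refine Set.mem_iUnion.2 ⟨k, ?_, ?_⟩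
    · have := neg_abs_le x; linarith
    · exact (le_abs_self x).trans hk
  have hgen : (MeasurableSpace.pi : MeasurableSpace (Fin n → ℝ)) = MeasurableSpace.generateFrom
      (Set.univ.pi '' Set.univ.pi fun _ => {S : Set ℝ | ∃ l u : ℝ, l < u ∧ Set.Ioc l u = S}) := by
    rw [← generateFrom_pi_eq fun _ => hspan]
    congr 1
    funext i
    rw [← borel_eq_generateFrom_Ioc]
    exact BorelSpace.measurable_eq
  induction A, hA using MeasurableSpace.induction_on_inter hgen
    (IsPiSystem.pi fun _ => isPiSystem_Ioc id id) with
  | empty => simp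
  | basic t ht =>
    obtain ⟨s, hs, rfl⟩ := ht
    choose l u hlu hs' using fun i => hs i trivial
    rw [Measure.restrict_restrict (MeasurableSet.univ_pi fun i => by
      rw [← hs' i]; exact measurableSet_Ioc)]
    rw [hQ, ← Set.pi_inter_distrib]
    -- The end points are clamped so that they stay ordered and inside the side of Q even when the
    -- intersection is empty.
    have hI : ∀ i, s i ∩ Set.Ioc (a i) (b i) = Set.Ioc (max (l i) (a i) ⊓ b i)
        (max (max (l i) (a i) ⊓ b i) (min (u i) (b i))) := by
      intro i
      rw [← hs' i, Set.Ioc_inter_Ioc]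
      ext x
      simp only [Set.mem_Ioc]
      grind
    simp_rw [hI]
    apply hbox
    refine ⟨fun i => ?_, fun i j hij => ?_⟩
    · obtain ⟨h1, h2, h3⟩ := hab.1 i
      refine ⟨?_, le_max_left _ _, ?_⟩ <;> grind
    · rw [← hI, ← hI]
      exact (hab.2 i j hij).mono Set.inter_subset_right Set.inter_subset_right
  | compl t htm ih =>
    have h1 := integral_add_compl htm (hint.restrict (s := Q))
    rw [ih, zero_add] at h1
    rw [h1]
    exact hbox a b hab
  | iUnion f hd hm ih =>
    rw [integral_iUnion hm hd hint.restrict.integrableOn]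
    simp [ih]

/-- A mesh `T / N` finer than all gaps |t i - t j| puts the coordinates into distinct cells. Only
countably many boxes arise in this way, so their exceptional null sets can be united. -/
theorem exists_offDiag_mem (hT : 0 < T) {t : Fin n → ℝ} (hinj : Function.Injective t)
    (ht : ∀ i, t i ∈ Set.Ioc 0 T) :
    ∃ N : ℕ, ∃ c : Fin n → ℕ,
      OffDiag T (fun i => c i * (T / N)) (fun i => (c i + 1) * (T / N)) ∧
      t ∈ Set.univ.pi fun i => Set.Ioc ((c i : ℝ) * (T / N)) ((c i + 1) * (T / N)) := by
  have hN : ∀ᶠ N : ℕ in atTop, 0 < N ∧ ∀ i j, i ≠ j → T / N < |t i - t j| := by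
    refine (eventually_gt_atTop 0).and ?_
    simp only [eventually_all]
    intro i j hij
    have : 0 < |t i - t j| := abs_pos.2 (sub_ne_zero.2 fun h' => hij (hinj h'))
    exact (tendsto_const_div_atTop_nhds_zero_nat T).eventually_lt_const this
  obtain ⟨N, hN0, hsep⟩ := hN.exists
  have hN' : (0 : ℝ) < N := Nat.cast_pos.2 hN0
  have hδ : 0 < T / N := div_pos hT hN'
  set δ := T / N with hδdef
  have hδT : N * δ = T := by rw [hδdef]; field_simp
  have hc : ∀ i, ∃ c : ℕ, c + 1 ≤ N ∧ t i ∈ Set.Ioc (c * δ) ((c + 1) * δ) := by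
    intro i
    have hpos : 0 < t i / δ := div_pos (ht i).1 hδ
    have h1 : 0 < ⌈t i / δ⌉₊ := Nat.ceil_pos.2 hpos
    -- Cells are open on the left and closed on the right, hence the ceiling minus one rather than
    -- the floor.
    refine ⟨⌈t i / δ⌉₊ - 1, ?_, ?_, ?_⟩
    · rw [Nat.sub_add_cancel h1, Nat.ceil_le, div_le_iff₀ hδ, hδT]
      exact (ht i).2
    · rw [← lt_div_iff₀ hδ]
      have := Nat.ceil_lt_add_one hpos.le
      rw [Nat.cast_sub h1]; push_cast; linarith
    · rw [← div_le_iff₀ hδ, Nat.cast_sub h1]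
      have := Nat.le_ceil (t i / δ)
      push_cast; linarith
  choose c hcN hct using hc
  refine ⟨N, c, ⟨fun i => ⟨by positivity, by nlinarith, ?_⟩, fun i j hij => ?_⟩, fun i _ => hct i⟩
  · have : ((c i : ℝ) + 1) ≤ N := by exact_mod_cast hcN i
    exact (mul_le_mul_of_nonneg_right this hδ.le).trans_eq hδT
  · have hne : c i ≠ c j := by
      intro h
      have h1 := hct i
      have h2 := hct j
      rw [h] at h1
      have := hsep i j hij
      rw [lt_abs] at this
      rcases this with h' | h' <;> linarith [h1.1, h1.2, h2.1, h2.2]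
    rw [Set.disjoint_left]
    intro x hx hx'
    rcases Nat.lt_or_gt_of_ne hne with h | h
    · have h3 : (c i : ℝ) + 1 ≤ c j := by exact_mod_cast h
      have h4 := mul_le_mul_of_nonneg_right h3 hδ.le
      linarith [hx.2, hx'.1]
    · have h3 : (c j : ℝ) + 1 ≤ c i := by exact_mod_cast h
      have h4 := mul_le_mul_of_nonneg_right h3 hδ.le
      linarith [hx.1, hx'.2]

/-- The step functions vanishing near the diagonals are dense. -/
theorem span_boxes_topologicalClosure (hT : 0 < T) :
    (Submodule.span ℝ {h : Kern T n | ∃ a b : Fin n → ℝ, OffDiag T a b ∧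
      h = tens T fun i => ivl (a i) (b i)}).topologicalClosure = ⊤ := by
  rw [Submodule.topologicalClosure_eq_top_iff, Submodule.eq_bot_iff]
  intro h hh
  have H : ∀ a b : Fin n → ℝ, OffDiag T a b →
      inner ℝ (tens T fun i => ivl (a i) (b i)) h = 0 := fun a b hab =>
    (Submodule.mem_orthogonal _ _).1 hh _ (Submodule.subset_span ⟨a, b, hab, rfl⟩)
  have hint : Integrable h (cubeMeasure T n) := (Lp.memLp h).integrable (by norm_num)
  have hbox : ∀ a b : Fin n → ℝ, OffDiag T a b → ∀ᵐ t ∂(cubeMeasure T n),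
      t ∈ (Set.univ.pi fun i => Set.Ioc (a i) (b i)) → h t = 0 := by
    intro a b hab
    rw [← ae_restrict_iff' (MeasurableSet.univ_pi fun i => measurableSet_Ioc)]
    exact hint.restrict.ae_eq_zero_of_forall_setIntegral_eq_zero fun A hA _ =>
      setIntegral_eq_zero_of_boxes hab H hA
  have hall : ∀ᵐ t ∂(cubeMeasure T n), ∀ (N : ℕ) (c : Fin n → ℕ),
      OffDiag T (fun i => c i * (T / N)) (fun i => (c i + 1) * (T / N)) →
      t ∈ (Set.univ.pi fun i => Set.Ioc ((c i : ℝ) * (T / N)) ((c i + 1) * (T / N))) →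
      h t = 0 := by
    rw [ae_all_iff]; intro N
    rw [ae_all_iff]; intro c
    by_cases hc : OffDiag T (fun i => (c i : ℝ) * (T / N)) (fun i => (c i + 1) * (T / N))
    · filter_upwards [hbox _ _ hc] with t ht _ using ht
    · exact Eventually.of_forall fun t h' => absurd h' hc
  apply Lp.ext
  filter_upwards [hall, ae_injective_cube, ae_mem_Ioc_cube,
    Lp.coeFn_zero ℝ 2 (cubeMeasure T n)] with t h1 h2 h3 h4
  obtain ⟨N, c, hc, hct⟩ := exists_offDiag_mem hT h2 h3
  rw [h1 N c hc hct, h4]; rfl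

end Density

/-! ### Tensor products and slices of kernels -/

section Tensor

variable {T : ℝ} {m k : ℕ}

/-- Concatenation of two groups of variables, the last group first. -/
def appendEquiv (m k : ℕ) : (Fin k → ℝ) × (Fin m → ℝ) ≃ᵐ (Fin (m + k) → ℝ) where
  toFun p := Fin.append p.2 p.1
  invFun t := (fun j => t (Fin.natAdd m j), fun i => t (Fin.castAdd k i))
  left_inv p := by ext i <;> simp
  right_inv t := by
    ext i
    refine Fin.addCases (fun i => ?_) (fun i => ?_) i <;> simp
  measurable_toFun := by
    refine measurable_pi_iff.2 fun i => ?_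
    refine Fin.addCases (fun i => ?_) (fun i => ?_) i
    · simpa [Function.comp_def] using (measurable_pi_apply i).comp measurable_snd
    · simpa [Function.comp_def] using (measurable_pi_apply i).comp measurable_fst
  measurable_invFun := by
    simp only [Equiv.coe_fn_symm_mk]
    fun_prop

@[simp] theorem appendEquiv_apply (t : Fin k → ℝ) (s : Fin m → ℝ) :
    appendEquiv m k (t, s) = Fin.append s t := rfl

theorem measurePreserving_appendEquiv (T : ℝ) (m k : ℕ) :
    MeasurePreserving (appendEquiv m k) ((cubeMeasure T k).prod (cubeMeasure T m))
      (cubeMeasure T (m + k)) := by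
  refine ⟨(appendEquiv m k).measurable, ?_⟩
  symm
  apply Measure.pi_eq
  intro s hs
  rw [Measure.map_apply (appendEquiv m k).measurable (MeasurableSet.univ_pi hs)]
  have : appendEquiv m k ⁻¹' Set.univ.pi s =
      (Set.univ.pi fun j => s (Fin.natAdd m j)) ×ˢ (Set.univ.pi fun i => s (Fin.castAdd k i)) := by
    ext ⟨t, u⟩
    simp only [Set.mem_preimage, Set.mem_pi, Set.mem_univ, true_imp_iff, Set.mem_prod,
      appendEquiv_apply]
    refine ⟨fun h => ⟨fun j => by simpa using h (Fin.natAdd m j),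
      fun i => by simpa using h (Fin.castAdd k i)⟩, fun h i => ?_⟩
    refine Fin.addCases (fun i => ?_) (fun i => ?_) i
    · simpa using h.2 i
    · simpa using h.1 i
  rw [this, Measure.prod_prod, cubeMeasure, cubeMeasure, Measure.pi_pi, Measure.pi_pi,
    Fin.prod_univ_add, mul_comm]

theorem ae_append {p : (Fin (m + k) → ℝ) → Prop} (h : ∀ᵐ t ∂(cubeMeasure T (m + k)), p t) :
    ∀ᵐ t ∂(cubeMeasure T k), ∀ᵐ s ∂(cubeMeasure T m), p (Fin.append s t) :=
  Measure.ae_ae_of_ae_prod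
    ((measurePreserving_appendEquiv T m k).quasiMeasurePreserving.ae h)

theorem ae_split {p : (Fin m → ℝ) → Prop} {q : (Fin k → ℝ) → Prop}
    (hp : ∀ᵐ t ∂(cubeMeasure T m), p t) (hq : ∀ᵐ t ∂(cubeMeasure T k), q t) :
    ∀ᵐ t ∂(cubeMeasure T (m + k)), p (fun i => t (Fin.castAdd k i)) ∧
      q (fun j => t (Fin.natAdd m j)) := by
  have h := (measurePreserving_appendEquiv T m k).symm.quasiMeasurePreserving
  filter_upwards [h.ae (Measure.quasiMeasurePreserving_snd.ae hp),
    h.ae (Measure.quasiMeasurePreserving_fst.ae hq)] with t h1 h2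
  exact ⟨h1, h2⟩

/-- The function of `m + k` variables `f(t₁, …, t_m) g(t_{m+1}, …, t_{m+k})`. -/
def tensorFun (f : (Fin m → ℝ) → ℝ) (g : (Fin k → ℝ) → ℝ) : (Fin (m + k) → ℝ) → ℝ := fun t =>
  f (fun i => t (Fin.castAdd k i)) * g (fun j => t (Fin.natAdd m j))

theorem integral_tensorFun (f : (Fin m → ℝ) → ℝ) (g : (Fin k → ℝ) → ℝ) :
    ∫ t, tensorFun f g t ∂(cubeMeasure T (m + k)) =
      (∫ s, f s ∂(cubeMeasure T m)) * ∫ t, g t ∂(cubeMeasure T k) := by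
  rw [← (measurePreserving_appendEquiv T m k).integral_comp' (tensorFun f g), mul_comm,
    ← integral_prod_mul]
  refine integral_congr_ae (Eventually.of_forall fun ⟨t, s⟩ => ?_)
  simp [tensorFun, mul_comm]

theorem memLp_tensorFun {f : (Fin m → ℝ) → ℝ} {g : (Fin k → ℝ) → ℝ}
    (hf : MemLp f 2 (cubeMeasure T m)) (hg : MemLp g 2 (cubeMeasure T k)) :
    MemLp (tensorFun f g) 2 (cubeMeasure T (m + k)) := by
  have hA := measurePreserving_appendEquiv T m k
  have hm : AEStronglyMeasurable (tensorFun f g) (cubeMeasure T (m + k)) := by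
    have h1 : AEStronglyMeasurable (fun t : Fin (m + k) → ℝ => f (fun i => t (Fin.castAdd k i)))
        (cubeMeasure T (m + k)) :=
      (hf.1.comp_quasiMeasurePreserving
        Measure.quasiMeasurePreserving_snd).comp_quasiMeasurePreserving
        hA.symm.quasiMeasurePreserving
    have h2 : AEStronglyMeasurable (fun t : Fin (m + k) → ℝ => g (fun i => t (Fin.natAdd m i)))
        (cubeMeasure T (m + k)) :=
      (hg.1.comp_quasiMeasurePreserving
        Measure.quasiMeasurePreserving_fst).comp_quasiMeasurePreserving
        hA.symm.quasiMeasurePreserving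
    exact h1.mul h2
  rw [memLp_two_iff_integrable_sq hm, ← hA.integrable_comp_emb (appendEquiv m k).measurableEmbedding]
  have := hg.integrable_sq.mul_prod hf.integrable_sq
  refine this.congr (Eventually.of_forall fun ⟨t, s⟩ => ?_)
  simp only [tensorFun, Function.comp, appendEquiv_apply, Fin.append_left, Fin.append_right]
  ring

/-- The tensor product of two kernels, as a bounded bilinear map. -/
def tensorL (T : ℝ) (m k : ℕ) : Kern T m →L[ℝ] Kern T k →L[ℝ] Kern T (m + k) :=
  LinearMap.mkContinuous₂
    (LinearMap.mk₂ ℝ (fun (f : Kern T m) (g : Kern T k) =>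
        toL2 (cubeMeasure T (m + k)) (tensorFun f g))
      (fun f f' g => by
        rw [← toL2_add (memLp_tensorFun (Lp.memLp f) (Lp.memLp g))
          (memLp_tensorFun (Lp.memLp f') (Lp.memLp g))]
        apply toL2_congr
        filter_upwards [ae_split (Lp.coeFn_add f f')
          (Eventually.of_forall fun _ => trivial : ∀ᵐ _ ∂(cubeMeasure T k), True)] with t ht
        simp only [tensorFun, ht.1, Pi.add_apply, add_mul])
      (fun c f g => by
        rw [← toL2_smul (memLp_tensorFun (Lp.memLp f) (Lp.memLp g))]
        apply toL2_congr
        filter_upwards [ae_split (Lp.coeFn_smul c f)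
          (Eventually.of_forall fun _ => trivial : ∀ᵐ _ ∂(cubeMeasure T k), True)] with t ht
        simp only [tensorFun, ht.1, Pi.smul_apply, smul_eq_mul, mul_assoc])
      (fun f g g' => by
        rw [← toL2_add (memLp_tensorFun (Lp.memLp f) (Lp.memLp g))
          (memLp_tensorFun (Lp.memLp f) (Lp.memLp g'))]
        apply toL2_congr
        filter_upwards [ae_split (m := m) (p := fun _ => True)
          (Eventually.of_forall fun _ => trivial) (Lp.coeFn_add g g')] with t ht
        simp only [tensorFun, ht.2, Pi.add_apply, mul_add])
      (fun c f g => by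
        rw [← toL2_smul (memLp_tensorFun (Lp.memLp f) (Lp.memLp g))]
        apply toL2_congr
        filter_upwards [ae_split (m := m) (p := fun _ => True)
          (Eventually.of_forall fun _ => trivial) (Lp.coeFn_smul c g)] with t ht
        simp only [tensorFun, ht.2, Pi.smul_apply, smul_eq_mul, mul_left_comm]))
    1 (fun f g => by
      refine le_of_sq_le_sq ?_ (by positivity)
      rw [LinearMap.mk₂_apply, ← real_inner_self_eq_norm_sq,
        inner_toL2 (memLp_tensorFun (Lp.memLp f) (Lp.memLp g))
          (memLp_tensorFun (Lp.memLp f) (Lp.memLp g)), one_mul, mul_pow,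
        ← real_inner_self_eq_norm_sq, ← real_inner_self_eq_norm_sq, inner_eq_integral_mul,
        inner_eq_integral_mul, ← integral_tensorFun]
      refine le_of_eq (integral_congr_ae (Eventually.of_forall fun t => ?_))
      simp only [tensorFun]; ring)

theorem tensorL_apply (f : Kern T m) (g : Kern T k) :
    tensorL T m k f g = toL2 (cubeMeasure T (m + k)) (tensorFun f g) := rfl

theorem norm_tensorL_le (f : Kern T m) (g : Kern T k) :
    ‖tensorL T m k f g‖ ≤ ‖f‖ * ‖g‖ := by
  have h : ‖tensorL T m k‖ ≤ 1 := LinearMap.mkContinuous₂_norm_le _ zero_le_one _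
  simpa using (tensorL T m k).le_of_opNorm₂_le_of_le h le_rfl le_rfl (x := f) (y := g)

theorem tensorL_tens {f : Fin m → ℝ → ℝ} {g : Fin k → ℝ → ℝ} (hf : ∀ i, BddMeas (f i))
    (hg : ∀ i, BddMeas (g i)) :
    tensorL T m k (tens T f) (tens T g) = tens T (Fin.append f g) := by
  rw [tensorL_apply]; conv_rhs => rw [tens]
  apply toL2_congr
  filter_upwards [ae_split (coeFn_tens (T := T) hf) (coeFn_tens (T := T) hg)] with t ht
  rw [tensorFun, ht.1, ht.2, Fin.prod_univ_add]
  simp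

theorem toL2_symmTensor (f : Kern T m) (g : Kern T k) :
    toL2 (cubeMeasure T (m + k)) (symmTensor f g) =
      (1 / ((m + k).factorial : ℝ)) • ∑ σ : Equiv.Perm (Fin (m + k)),
        permK σ (tensorL T m k f g) := by
  have hm := memLp_tensorFun (Lp.memLp f) (Lp.memLp g)
  symm
  apply eq_toL2
  have h1 : ∀ᵐ t ∂(cubeMeasure T (m + k)), ∀ σ : Equiv.Perm (Fin (m + k)),
      permK σ (tensorL T m k f g) t = tensorFun f g fun i => t (σ i) := by
    rw [ae_all_iff]
    intro σ
    filter_upwards [coeFn_permK σ (tensorL T m k f g),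
      (measurePreserving_perm σ).quasiMeasurePreserving.ae (coeFn_toL2 hm)] with t h1 h2
    rw [h1, tensorL_apply, h2]
  filter_upwards [h1, Lp.coeFn_smul (1 / ((m + k).factorial : ℝ))
    (∑ σ : Equiv.Perm (Fin (m + k)), permK σ (tensorL T m k f g)),
    Lp.coeFn_finsetSum Finset.univ fun σ : Equiv.Perm (Fin (m + k)) => 
      permK σ (tensorL T m k f g)] with t h1 h2 h3
  rw [h2, Pi.smul_apply, h3]
  simp [h1, symmTensor, tensorFun]

end Tensor

/-- A measurable function of two variables is measurable as a function of the first one with values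
in the classes of functions of the second one. -/
theorem stronglyMeasurable_toL2_section {α β : Type*} [MeasurableSpace α] [MeasurableSpace β]
    {μ : Measure β} [IsFiniteMeasure μ] [SecondCountableTopology (Lp ℝ 2 μ)]
    {F : α × β → ℝ} (hF : Measurable F) :
    StronglyMeasurable fun t => toL2 μ fun s => F (t, s) := by
  have hnorm : ∀ G : α × β → ℝ, Measurable G →
      Measurable fun t => eLpNorm (fun s => G (t, s)) 2 μ := by
    intro G hG
    simp_rw [eLpNorm_eq_lintegral_rpow_enorm_toReal two_ne_zero ENNReal.ofNat_ne_top]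
    exact ((hG.enorm.pow_const _).lintegral_prod_right').pow_const _
  -- Some sections may fail to be square integrable; there `toL2` takes the value 0, and the set
  -- where this happens has to be measurable.
  have hE : MeasurableSet {t : α | MemLp (fun s => F (t, s)) 2 μ} := by
    have : {t : α | MemLp (fun s => F (t, s)) 2 μ} =
        {t | eLpNorm (fun s => F (t, s)) 2 μ < ⊤} := by
      ext t
      exact ⟨fun H => H.2, fun H =>
        ⟨(hF.comp measurable_prodMk_left).aestronglyMeasurable, H⟩⟩
    rw [this]
    exact measurableSet_lt (hnorm _ hF) measurable_const
  have hdist : ∀ g : Lp ℝ 2 μ, Measurable fun t => edist (toL2 μ fun s => F (t, s)) g := by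
    classical
    intro g
    have : (fun t => edist (toL2 μ fun s => F (t, s)) g) = fun t =>
        if t ∈ {t : α | MemLp (fun s => F (t, s)) 2 μ} then
          eLpNorm (fun s => F (t, s) - g s) 2 μ else edist 0 g := by
      ext t
      split_ifs with ht
      · rw [Lp.edist_def]
        apply eLpNorm_congr_ae
        filter_upwards [coeFn_toL2 ht] with s hs
        rw [Pi.sub_apply, hs]
      · congr 1
        exact dif_neg ht
    rw [this]
    refine Measurable.ite hE (hnorm (fun p => F p - g p.2) ?_) measurable_const
    exact hF.sub ((Lp.stronglyMeasurable g).measurable.comp measurable_snd)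
  let _ : MeasurableSpace (Lp ℝ 2 μ) := borel _
  have : BorelSpace (Lp ℝ 2 μ) := ⟨rfl⟩
  refine Measurable.stronglyMeasurable (measurable_of_isOpen fun U hU => ?_)
  -- By second countability an open set is a countable union of balls, so measurability of the
  -- distances to fixed points is enough.
  choose! r hr0 hr using fun x (hx : x ∈ U) => EMetric.isOpen_iff.1 hU x hx
  obtain ⟨C, hCU, hC, hCU'⟩ := TopologicalSpace.isOpen_biUnion_countable U
    (fun x => Metric.eball x (r x)) fun x _ => Metric.isOpen_eball
  have hU' : U = ⋃ x ∈ C, Metric.eball x (r x) := by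
    rw [hCU']
    refine Set.Subset.antisymm (fun x hx => ?_) (Set.iUnion₂_subset hr)
    exact Set.mem_biUnion hx (Metric.mem_eball_self (hr0 x hx))
  rw [hU']
  simp only [Set.preimage_iUnion]
  exact MeasurableSet.biUnion hC fun x _ => measurableSet_lt (hdist x) measurable_const

/-! ### Slices of kernels in some of the variables -/

section Slice

variable {T : ℝ} {m k : ℕ}

/-- The kernel `h(·, t₁, …, t_k)`. -/
def sliceFun (h : Kern T (m + k)) (t : Fin k → ℝ) : Kern T m :=
  toL2 (cubeMeasure T m) fun s => h (Fin.append s t)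

theorem measurable_append_coe (h : Kern T (m + k)) :
    Measurable fun p : (Fin k → ℝ) × (Fin m → ℝ) => h (Fin.append p.2 p.1) :=
  (Lp.stronglyMeasurable h).measurable.comp (appendEquiv m k).measurable

theorem integrable_append_sq (h : Kern T (m + k)) :
    Integrable (fun p : (Fin k → ℝ) × (Fin m → ℝ) => h (Fin.append p.2 p.1) ^ 2)
      ((cubeMeasure T k).prod (cubeMeasure T m)) :=
  ((measurePreserving_appendEquiv T m k).integrable_comp_emb
    (appendEquiv m k).measurableEmbedding).2 (Lp.memLp h).integrable_sq

theorem ae_memLp_append (h : Kern T (m + k)) : ∀ᵐ t ∂(cubeMeasure T k),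
    MemLp (fun s => h (Fin.append s t)) 2 (cubeMeasure T m) := by
  filter_upwards [(integrable_append_sq h).prod_right_ae] with t ht
  exact (memLp_two_iff_integrable_sq
    ((measurable_append_coe h).comp measurable_prodMk_left).aestronglyMeasurable).2 ht

theorem stronglyMeasurable_sliceFun (h : Kern T (m + k)) : StronglyMeasurable (sliceFun h) :=
  have : Fact ((2 : ENNReal) ≠ ⊤) := ⟨ENNReal.ofNat_ne_top⟩
  stronglyMeasurable_toL2_section (measurable_append_coe h)

theorem sliceFun_norm_sq (h : Kern T (m + k)) : (fun t => ‖sliceFun h t‖ ^ 2)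
    =ᵐ[cubeMeasure T k] fun t => ∫ s, h (Fin.append s t) ^ 2 ∂(cubeMeasure T m) := by
  filter_upwards [ae_memLp_append h] with t ht
  rw [← real_inner_self_eq_norm_sq, sliceFun, inner_toL2 ht ht]
  simp_rw [sq]

theorem memLp_sliceFun (h : Kern T (m + k)) : MemLp (sliceFun h) 2 (cubeMeasure T k) := by
  rw [memLp_two_iff_integrable_sq_norm (stronglyMeasurable_sliceFun h).aestronglyMeasurable]
  exact (integrable_append_sq h).integral_prod_left.congr (sliceFun_norm_sq h).symm

theorem norm_sq_eq_integral {α E : Type*} [MeasurableSpace α] {μ : Measure α}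
    [NormedAddCommGroup E] [InnerProductSpace ℝ E] (f : Lp E 2 μ) :
    ‖f‖ ^ 2 = ∫ x, ‖f x‖ ^ 2 ∂μ := by
  rw [← real_inner_self_eq_norm_sq, L2.inner_def]
  simp

theorem ae_eq_sliceFun_of {h : Kern T (m + k)} {F : (Fin (m + k) → ℝ) → ℝ}
    (hF : h =ᵐ[cubeMeasure T (m + k)] F) : ∀ᵐ t ∂(cubeMeasure T k),
      sliceFun h t = toL2 (cubeMeasure T m) fun s => F (Fin.append s t) := by
  filter_upwards [ae_append hF] with t ht
  exact toL2_congr ht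

/-- A kernel of `m + k` variables as a square integrable function of the last `k` variables
whose values are kernels of `m` variables. -/
def sliceL (T : ℝ) (m k : ℕ) : Kern T (m + k) →ₗᵢ[ℝ] Lp (Kern T m) 2 (cubeMeasure T k) where
  toFun h := (memLp_sliceFun h).toLp _
  map_add' h g := by
    apply Lp.ext
    filter_upwards [(memLp_sliceFun (h + g)).coeFn_toLp, (memLp_sliceFun h).coeFn_toLp,
      (memLp_sliceFun g).coeFn_toLp, Lp.coeFn_add ((memLp_sliceFun h).toLp _)
      ((memLp_sliceFun g).toLp _), ae_eq_sliceFun_of (Lp.coeFn_add h g), ae_memLp_append h,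
      ae_memLp_append g] with t h1 h2 h3 h4 h5 h6 h7
    rw [h1, h4, Pi.add_apply, h2, h3, h5]
    exact toL2_add h6 h7
  map_smul' c h := by
    apply Lp.ext
    filter_upwards [(memLp_sliceFun (c • h)).coeFn_toLp, (memLp_sliceFun h).coeFn_toLp,
      Lp.coeFn_smul c ((memLp_sliceFun h).toLp _), ae_eq_sliceFun_of (Lp.coeFn_smul c h),
      ae_memLp_append h] with t h1 h2 h3 h4 h5
    rw [h1, RingHom.id_apply, h3, Pi.smul_apply, h2, h4]
    exact toL2_smul h5 c
  norm_map' h := by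
    rw [← sq_eq_sq₀ (norm_nonneg _) (norm_nonneg _), norm_sq_eq_integral, norm_sq_eq_integral]
    have : ∫ t, ‖((memLp_sliceFun h).toLp _ : Lp (Kern T m) 2 (cubeMeasure T k)) t‖ ^ 2
        ∂(cubeMeasure T k) =
        ∫ t, ∫ s, h (Fin.append s t) ^ 2 ∂(cubeMeasure T m) ∂(cubeMeasure T k) := by
      refine integral_congr_ae ?_
      filter_upwards [(memLp_sliceFun h).coeFn_toLp, sliceFun_norm_sq h] with t h1 h2
      rw [h1, h2]
    refine this.trans ?_
    have h2 := integral_prod (fun p : (Fin k → ℝ) × (Fin m → ℝ) => h (Fin.append p.2 p.1) ^ 2)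
      (integrable_append_sq h)
    rw [← h2]
    have h3 := (measurePreserving_appendEquiv T m k).integral_comp' fun t => h t ^ 2
    simp only [Real.norm_eq_abs, sq_abs]
    exact h3

theorem coeFn_sliceL (h : Kern T (m + k)) :
    sliceL T m k h =ᵐ[cubeMeasure T k] sliceFun h := (memLp_sliceFun h).coeFn_toLp

theorem sliceL_tens {f : Fin m → ℝ → ℝ} {g : Fin k → ℝ → ℝ} (hf : ∀ i, BddMeas (f i))
    (hg : ∀ i, BddMeas (g i)) :
    sliceL T m k (tens T (Fin.append f g)) =ᵐ[cubeMeasure T k]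
      fun t => (∏ j, g j (t j)) • tens T f := by
  have hfg : ∀ i, BddMeas (Fin.append f g i) := fun i => by
    refine Fin.addCases (fun i => ?_) (fun i => ?_) i
    · simpa using hf i
    · simpa using hg i
  filter_upwards [coeFn_sliceL (tens T (Fin.append f g)), ae_eq_sliceFun_of (coeFn_tens hfg)]
    with t h1 h2
  rw [h1, h2, tens, ← toL2_smul ((BddMeas.prod_eval hf).memLp _ _)]
  congr 1
  ext s
  simp [Fin.prod_univ_add, mul_comm]

/-- Slices of a symmetric kernel are symmetric. -/
theorem ae_permK_sliceFun {h : Kern T (m + k)} (hh : IsSymmKern h) :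
    ∀ᵐ t ∂(cubeMeasure T k), IsSymmKern (sliceFun h t) := by
  have H : ∀ σ : Equiv.Perm (Fin m), ∀ᵐ t ∂(cubeMeasure T k), ∀ᵐ s ∂(cubeMeasure T m),
      h (Fin.append (fun i => s (σ i)) t) = h (Fin.append s t) := by
    intro σ
    let τ : Equiv.Perm (Fin (m + k)) := finSumFinEquiv.permCongr (Equiv.sumCongr σ (Equiv.refl _))
    filter_upwards [ae_append (hh τ)] with t ht
    filter_upwards [ht] with s hs
    rw [← hs]
    congr 1
    ext i
    refine Fin.addCases (fun i => ?_) (fun i => ?_) i <;> simp [τ, Equiv.permCongr_apply]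
  filter_upwards [ae_all_iff.2 H, ae_memLp_append h] with t ht hm σ
  have h1 := coeFn_toL2 hm
  filter_upwards [h1, (measurePreserving_perm σ).quasiMeasurePreserving.ae h1, ht σ]
    with s h2 h3 h4
  rw [sliceFun, h2, h3, h4]

/-- Transport of kernels along an equality of the numbers of variables. -/
def castK (T : ℝ) (a b : ℕ) : Kern T a →L[ℝ] Kern T b :=
  if e : a = b then e ▸ ContinuousLinearMap.id ℝ (Kern T a) else 0

/-- For kernels taken from a family indexed by the number of variables, transport is harmless. It
reconciles `a` with `a - k + k`, which are equal for k ≤ a but not definitionally so. -/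
theorem castK_family {a b : ℕ} (e : a = b) (h : (n : ℕ) → Kern T n) :
    castK T a b (h a) = h b := by
  subst e; simp [castK]

end Slice

/-! ### Increments of Brownian motion -/

section Increments

variable {Ω : Type*} [MeasurableSpace Ω] {P : Measure Ω} [IsProbabilityMeasure P]
  {T : ℝ} {B : ℝ → Ω → ℝ}

theorem IsBrownianOn.measurable_sub (hB : IsBrownianOn P T B) {a b : ℝ} (ha : 0 ≤ a) (hab : a ≤ b)
    (hb : b ≤ T) : Measurable fun ω => B b ω - B a ω :=
  (hB.measurable b ⟨ha.trans hab, hb⟩).sub (hB.measurable a ⟨ha, hab.trans hb⟩)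

theorem IsBrownianOn.memLp_sub (hB : IsBrownianOn P T B) {a b : ℝ} (ha : 0 ≤ a) (hab : a ≤ b)
    (hb : b ≤ T) (p : NNReal) : MemLp (fun ω => B b ω - B a ω) p P := by
  have h := memLp_id_gaussianReal (μ := 0) (v := (b - a).toNNReal) p
  rw [← hB.gaussian_increments a b ha hab hb] at h
  exact (memLp_map_measure_iff aestronglyMeasurable_id
    (hB.measurable_sub ha hab hb).aemeasurable).1 h

theorem IsBrownianOn.integral_sub (hB : IsBrownianOn P T B) {a b : ℝ} (ha : 0 ≤ a) (hab : a ≤ b)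
    (hb : b ≤ T) : ∫ ω, (B b ω - B a ω) ∂P = 0 := by
  have h := integral_id_gaussianReal (μ := 0) (v := (b - a).toNNReal)
  rw [← hB.gaussian_increments a b ha hab hb, integral_map
    (hB.measurable_sub ha hab hb).aemeasurable (by fun_prop)] at h
  exact h

theorem IsBrownianOn.integral_sub_sq (hB : IsBrownianOn P T B) {a b : ℝ} (ha : 0 ≤ a) (hab : a ≤ b)
    (hb : b ≤ T) : ∫ ω, (B b ω - B a ω) ^ 2 ∂P = b - a := by
  have h : variance (fun x => x) (gaussianReal 0 (b - a).toNNReal) = (b - a).toNNReal :=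
    variance_id_gaussianReal
  rw [variance_of_integral_eq_zero (by fun_prop) integral_id_gaussianReal] at h
  rw [← hB.gaussian_increments a b ha hab hb, integral_map
    (hB.measurable_sub ha hab hb).aemeasurable (by fun_prop)] at h
  simpa [hab] using h

/-- The product of the increments of `B` over the intervals `(aᵢ, bᵢ]`. -/
def prodInc (P : Measure Ω) (B : ℝ → Ω → ℝ) {n : ℕ} (a b : Fin n → ℝ) : Lp ℝ 2 P :=
  toL2 P fun ω => ∏ i, (B (b i) ω - B (a i) ω)

/-- Gaussian increments have all moments; Hölder's inequality with exponent 2n for each of the n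
factors gives L². For n = 0 the combined exponent is infinite, so this case is separate. -/
theorem IsBrownianOn.memLp_prod (hB : IsBrownianOn P T B) {n : ℕ} {a b : Fin n → ℝ}
    (h : ∀ i, 0 ≤ a i ∧ a i ≤ b i ∧ b i ≤ T) :
    MemLp (fun ω => ∏ i, (B (b i) ω - B (a i) ω)) 2 P := by
  have := MemLp.prod' (s := Finset.univ) (f := fun i ω => B (b i) ω - B (a i) ω)
    (p := fun _ : Fin n => ((2 * n : ℕ) : NNReal)) (μ := P)
    fun i _ => hB.memLp_sub (h i).1 (h i).2.1 (h i).2.2 _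
  refine this.mono_exponent ?_
  rcases Nat.eq_zero_or_pos n with rfl | hn
  · simp
  · simp only [Finset.sum_const, Finset.card_univ, Fintype.card_fin, nsmul_eq_mul]
    rw [ENNReal.le_inv_iff_mul_le]
    have h0 : (n : ENNReal) ≠ 0 := by simp [hn.ne']
    push_cast
    rw [ENNReal.mul_inv (by simp) (by simp), ← mul_assoc, mul_comm (2 : ENNReal), mul_assoc,
      ← mul_assoc (2 : ENNReal), ENNReal.mul_inv_cancel two_ne_zero (by simp), one_mul, ENNReal.mul_inv_cancel h0 (by simp)]

theorem coeFn_prodInc (hB : IsBrownianOn P T B) {n : ℕ} {a b : Fin n → ℝ}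
    (h : ∀ i, 0 ≤ a i ∧ a i ≤ b i ∧ b i ≤ T) :
    prodInc P B a b =ᵐ[P] fun ω => ∏ i, (B (b i) ω - B (a i) ω) :=
  coeFn_toL2 (hB.memLp_prod h)

theorem mem_elementaryIto_iff {n : ℕ} {p : Kern T n × Lp ℝ 2 P} :
    p ∈ elementaryIto P T B n ↔ ∃ a b : Fin n → ℝ, OffDiag T a b ∧
      (p.1 : (Fin n → ℝ) → ℝ) =ᵐ[cubeMeasure T n]
        (Set.univ.pi fun i => Set.Ioc (a i) (b i)).indicator (fun _ => (1 : ℝ)) ∧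
      (p.2 : Ω → ℝ) =ᵐ[P] fun ω => ∏ i, (B (b i) ω - B (a i) ω) := by
  simp only [elementaryIto, OffDiag, Set.mem_ofPred_eq, and_assoc]

theorem IsBrownianOn.elementaryIto_eq (hB : IsBrownianOn P T B) (n : ℕ) :
    elementaryIto P T B n = {p | ∃ a b : Fin n → ℝ, OffDiag T a b ∧
      p = (tens T fun i => ivl (a i) (b i), prodInc P B a b)} := by
  ext p
  rw [mem_elementaryIto_iff]
  constructor
  · rintro ⟨a, b, hab, h1, h2⟩
    refine ⟨a, b, hab, Prod.ext ?_ (eq_toL2 h2)⟩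
    rw [← prod_ivl] at h1
    exact eq_toL2 h1
  · rintro ⟨a, b, hab, rfl⟩
    refine ⟨a, b, hab, ?_, coeFn_prodInc hB hab.1⟩
    rw [← prod_ivl]
    exact coeFn_tens fun i => bddMeas_ivl _ _

end Increments

/-! ### Cells of a grid -/

/-- A finite or infinite grid in `[0, T]`. -/
structure IsGrid (T : ℝ) (s : ℕ → ℝ) : Prop where
  mono : Monotone s
  mem : ∀ i, s i ∈ Set.Icc 0 T

theorem exists_grid {T : ℝ} (F : Finset ℝ) (hF : ∀ x ∈ F, x ∈ Set.Icc 0 T) (hne : F.Nonempty) :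
    ∃ s : ℕ → ℝ, ∃ N, IsGrid T s ∧ StrictMonoOn s (Set.Iic N) ∧ ∀ x ∈ F, ∃ p ≤ N, s p = x := by
  have hc : 0 < F.card := hne.card_pos
  let e := F.orderEmbOfFin rfl
  -- The sorted points are continued by the last one, so the grid is monotone on all of ℕ but
  -- strictly so only up to `N`.
  let t : ℕ → Fin F.card := fun k => ⟨min k (F.card - 1), by omega⟩
  refine ⟨fun k => e (t k), F.card - 1, ⟨fun i j hij => e.monotone ?_, fun i => hF _ ?_⟩, ?_, ?_⟩
  · simp only [t, Fin.mk_le_mk]; omega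
  · exact F.orderEmbOfFin_mem rfl _
  · intro i hi j hj hij
    apply e.strictMono
    simp only [t, Fin.mk_lt_mk, Set.mem_Iic] at *
    omega
  · intro x hx
    have : x ∈ Set.range e := by rw [F.range_orderEmbOfFin rfl]; exact hx
    obtain ⟨i, hi⟩ := this
    refine ⟨i, by omega, ?_⟩
    rw [← hi]
    refine congrArg e (Fin.ext ?_)
    simp only [t]; omega

theorem ivl_add {a b c : ℝ} (hab : a ≤ b) (hbc : b ≤ c) (x : ℝ) :
    ivl a c x = ivl a b x + ivl b c x := by
  simp only [ivl, Set.indicator_apply, Set.mem_Ioc]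
  grind

theorem ivl_eq_sum {s : ℕ → ℝ} (hs : Monotone s) {p q : ℕ} (hpq : p ≤ q) :
    ivl (s p) (s q) = fun x => ∑ j ∈ Finset.Ico p q, ivl (s j) (s (j + 1)) x := by
  ext x
  induction q, hpq using Nat.le_induction with
  | base => simp [ivl]
  | succ q hpq ih =>
    rw [Finset.sum_Ico_succ_top hpq, ← ih, ivl_add (hs hpq) (hs q.le_succ)]

theorem sub_eq_sum (F : ℕ → ℝ) {p q : ℕ} (hpq : p ≤ q) :
    F q - F p = ∑ j ∈ Finset.Ico p q, (F (j + 1) - F j) := by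
  induction q, hpq using Nat.le_induction with
  | base => simp
  | succ q hpq ih =>
    rw [Finset.sum_Ico_succ_top hpq, ← ih]; ring

section Cells

variable {Ω : Type*} [MeasurableSpace Ω] {P : Measure Ω} [IsProbabilityMeasure P]
  {T : ℝ} {B : ℝ → Ω → ℝ} {s : ℕ → ℝ} {n m : ℕ}

/-- The kernel of a product of cells. -/
def cellK (T : ℝ) (s : ℕ → ℝ) (c : Fin n → ℕ) : Kern T n :=
  tens T fun i => ivl (s (c i)) (s (c i + 1))

/-- The product of the increments over cells. -/
def cellX (P : Measure Ω) (B : ℝ → Ω → ℝ) (s : ℕ → ℝ) (c : Fin n → ℕ) : Lp ℝ 2 P :=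
  prodInc P B (fun i => s (c i)) fun i => s (c i + 1)

theorem IsGrid.bounds (hs : IsGrid T s) (j : ℕ) : 0 ≤ s j ∧ s j ≤ s (j + 1) ∧ s (j + 1) ≤ T :=
  ⟨(hs.mem j).1, hs.mono j.le_succ, (hs.mem _).2⟩

theorem IsGrid.disjoint_cells (hs : IsGrid T s) {i j : ℕ} (hij : i ≠ j) :
    Disjoint (Set.Ioc (s i) (s (i + 1))) (Set.Ioc (s j) (s (j + 1))) :=
  hs.mono.pairwise_disjoint_on_Ioc_succ hij

theorem IsGrid.offDiag (hs : IsGrid T s) {c : Fin n → ℕ} (hc : Function.Injective c) :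
    OffDiag T (fun i => s (c i)) fun i => s (c i + 1) :=
  ⟨fun i => hs.bounds (c i), fun _ _ hij => hs.disjoint_cells fun h => hij (hc h)⟩

theorem integral_ivl_mul_ivl (hs : IsGrid T s) (i j : ℕ) :
    ∫ x, ivl (s i) (s (i + 1)) x * ivl (s j) (s (j + 1)) x ∂(itvMeasure T) =
      if i = j then s (i + 1) - s i else 0 := by
  split_ifs with h
  · subst h
    have h1 : (fun x => ivl (s i) (s (i + 1)) x * ivl (s i) (s (i + 1)) x) =
        (Set.Ioc (s i) (s (i + 1))).indicator 1 := by
      ext x; by_cases hx : x ∈ Set.Ioc (s i) (s (i + 1)) <;> simp [ivl, hx]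
    rw [h1, integral_indicator_one measurableSet_Ioc, measureReal_restrict_apply measurableSet_Ioc,
      Set.inter_eq_left.2 (Set.Ioc_subset_Icc_self.trans
        (Set.Icc_subset_Icc (hs.mem i).1 (hs.mem _).2)), Real.volume_real_Ioc_of_le
          (hs.mono i.le_succ)]
  · have h1 : (fun x => ivl (s i) (s (i + 1)) x * ivl (s j) (s (j + 1)) x) = fun _ => 0 := by
      ext x
      by_cases hx : x ∈ Set.Ioc (s i) (s (i + 1))
      · have := Set.disjoint_left.1 (hs.disjoint_cells h) hx
        simp [ivl, this]
      · simp [ivl, hx]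
    rw [h1, integral_zero]

theorem inner_cellK (hs : IsGrid T s) (c c' : Fin n → ℕ) :
    inner ℝ (cellK T s c) (cellK T s c') =
      ∏ i, if c i = c' i then s (c i + 1) - s (c i) else 0 := by
  rw [cellK, cellK, inner_tens (fun _ => bddMeas_ivl _ _) fun _ => bddMeas_ivl _ _]
  exact Finset.prod_congr rfl fun i _ => integral_ivl_mul_ivl hs _ _

theorem IsBrownianOn.iIndepFun_cells (hB : IsBrownianOn P T B) (hs : IsGrid T s) :
    iIndepFun (fun (j : ℕ) ω => B (s (j + 1)) ω - B (s j) ω) P :=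
  hB.indep_increments.nat (t := fun j => ⟨s j, hs.mem j⟩) fun _ _ h => hs.mono h

/-- By independence the expectation factorizes over the cells. A cell in both sets contributes its
variance; a cell in only one contributes the mean of an increment, which is zero. -/
theorem integral_prod_cells (hB : IsBrownianOn P T B) (hs : IsGrid T s) (C C' : Finset ℕ) :
    ∫ ω, (∏ j ∈ C, (B (s (j + 1)) ω - B (s j) ω)) * ∏ j ∈ C', (B (s (j + 1)) ω - B (s j) ω) ∂P =
      if C = C' then ∏ j ∈ C, (s (j + 1) - s j) else 0 := by
  let ξ : ℕ → Ω → ℝ := fun j ω => B (s (j + 1)) ω - B (s j) ω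
  -- The factor of cell `j` is the square of the increment, the increment, or 1, according to how
  -- many of the two sets contain `j`.
  let φ : ℕ → ℝ → ℝ := fun j x => (if j ∈ C then x else 1) * if j ∈ C' then x else 1
  have hφ : ∀ j, Measurable (φ j) := fun j => by
    simp only [φ]; split_ifs <;> fun_prop
  have hind : iIndepFun (fun (j : ↥(C ∪ C')) ω => φ j (ξ j ω)) P :=
    ((hB.iIndepFun_cells hs).precomp Subtype.val_injective).comp
      (fun j : ↥(C ∪ C') => φ j) fun j => hφ j
  have hb := fun i => hs.bounds i
  have h1 : ∀ ω, (∏ j ∈ C, ξ j ω) * ∏ j ∈ C', ξ j ω = ∏ j : ↥(C ∪ C'), φ j (ξ j ω) := by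
    intro ω
    rw [Finset.prod_coe_sort (C ∪ C') fun j => φ j (ξ j ω)]
    simp only [φ]
    rw [Finset.prod_mul_distrib, Finset.prod_ite_mem, Finset.prod_ite_mem,
      Finset.union_inter_cancel_left, Finset.union_inter_cancel_right]
  change ∫ ω, (∏ j ∈ C, ξ j ω) * ∏ j ∈ C', ξ j ω ∂P = _
  simp_rw [h1]
  have h2 : ∫ ω, ∏ j : ↥(C ∪ C'), φ j (ξ j ω) ∂P = ∏ j ∈ C ∪ C', ∫ ω, φ j (ξ j ω) ∂P := by
    rw [hind.integral_fun_prod_eq_prod_integral fun j => ((hφ j).comp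
      (hB.measurable_sub (hb j).1 (hb j).2.1 (hb j).2.2)).aestronglyMeasurable]
    exact Finset.prod_coe_sort (C ∪ C') fun j => ∫ ω, φ j (ξ j ω) ∂P
  rw [h2]
  split_ifs with h
  · subst h
    rw [Finset.union_self]
    refine Finset.prod_congr rfl fun j hj => ?_
    simp only [φ, hj, if_true, ← sq]
    exact hB.integral_sub_sq (hb _).1 (hb _).2.1 (hb _).2.2
  · have : ∃ j ∈ C ∪ C', ¬ (j ∈ C ∧ j ∈ C') := by
      by_contra! H
      refine h (Finset.Subset.antisymm (fun j hj => ?_) fun j hj => ?_)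
      · exact (H j (Finset.mem_union_left _ hj)).2
      · exact (H j (Finset.mem_union_right _ hj)).1
    obtain ⟨j, hj, hj'⟩ := this
    refine Finset.prod_eq_zero hj ?_
    have h0 : ∫ ω, ξ j ω ∂P = 0 := hB.integral_sub (hb j).1 (hb j).2.1 (hb j).2.2
    rcases Finset.mem_union.1 hj with h2 | h2
    · have h3 : j ∉ C' := fun h3 => hj' ⟨h2, h3⟩
      simpa only [φ, h2, h3, if_true, if_false, mul_one] using h0
    · have h3 : j ∉ C := fun h3 => hj' ⟨h3, h2⟩
      simpa only [φ, h2, h3, if_true, if_false, one_mul] using h0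

theorem inner_cellX (hB : IsBrownianOn P T B) (hs : IsGrid T s) {c : Fin n → ℕ} {c' : Fin m → ℕ}
    (hc : Function.Injective c) (hc' : Function.Injective c') :
    inner ℝ (cellX P B s c) (cellX P B s c') =
      if Finset.univ.image c = Finset.univ.image c' then ∏ i, (s (c i + 1) - s (c i)) else 0 := by
  have h := integral_prod_cells hB hs (Finset.univ.image c) (Finset.univ.image c')
  simp_rw [Finset.prod_image fun _ _ _ _ h => hc h,
    Finset.prod_image fun _ _ _ _ h => hc' h] at h
  rw [← h, cellX, cellX, prodInc, prodInc, inner_toL2 (hB.memLp_prod fun i => hs.bounds _)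
    (hB.memLp_prod fun i => hs.bounds _)]

theorem permK_cellK (σ : Equiv.Perm (Fin n)) (c : Fin n → ℕ) :
    permK σ (cellK T s c) = cellK T s fun i => c (σ.symm i) :=
  permK_tens σ fun _ => bddMeas_ivl _ _

/-- The Itô isometry on cells. Exactly one permutation matches two injective families of cells with
the same image, and none does when the images differ. -/
theorem inner_cellX_eq_sum (hB : IsBrownianOn P T B) (hs : IsGrid T s) {c c' : Fin n → ℕ}
    (hc : Function.Injective c) (hc' : Function.Injective c') :
    inner ℝ (cellX P B s c) (cellX P B s c') =
      ∑ σ : Equiv.Perm (Fin n), inner ℝ (cellK T s c) (permK σ (cellK T s c')) := by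
  simp_rw [permK_cellK, inner_cellK hs]
  rw [inner_cellX hB hs hc hc']
  split_ifs with h
  · have hex : ∀ i, ∃ k, c' k = c i := fun i => by
      have : c i ∈ Finset.univ.image c' := h ▸ Finset.mem_image_of_mem c (Finset.mem_univ i)
      simpa using this
    -- `τ` is the unique matching of the two families, and only its inverse contributes to the sum.
    choose τ hτ using hex
    have hτi : Function.Injective τ := fun i j hij => hc (by rw [← hτ i, ← hτ j, hij])
    let τe : Equiv.Perm (Fin n) := Equiv.ofBijective τ (Finite.injective_iff_bijective.1 hτi)
    rw [Finset.sum_eq_single τe.symm]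
    · refine Finset.prod_congr rfl fun i _ => ?_
      have : c i = c' (τe i) := (hτ i).symm
      simp [← this]
    · intro σ _ hσ
      obtain ⟨i, hi⟩ : ∃ i, σ.symm i ≠ τe i := by
        by_contra! H
        have H' : σ.symm = τe := Equiv.ext H
        exact hσ (by rw [← H', Equiv.symm_symm])
      refine Finset.prod_eq_zero (Finset.mem_univ i) (if_neg fun h' => hi (hc' ?_))
      rw [← h']
      exact (hτ i).symm
    · simp
  · refine (Finset.sum_eq_zero fun σ _ => ?_).symm
    by_contra hne
    refine h ?_
    have h1 : ∀ i, c i = c' (σ.symm i) := fun i => by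
      by_contra h2
      exact hne (Finset.prod_eq_zero (Finset.mem_univ i) (if_neg h2))
    ext j
    simp only [Finset.mem_image, Finset.mem_univ, true_and]
    exact ⟨fun ⟨i, hi⟩ => ⟨σ.symm i, by rw [← h1, hi]⟩,
      fun ⟨i, hi⟩ => ⟨σ i, by rw [h1, Equiv.symm_apply_apply, hi]⟩⟩

theorem inner_cellX_of_ne (hB : IsBrownianOn P T B) (hs : IsGrid T s) {c : Fin n → ℕ}
    {c' : Fin m → ℕ} (hc : Function.Injective c) (hc' : Function.Injective c') (hnm : n ≠ m) :
    inner ℝ (cellX P B s c) (cellX P B s c') = 0 := by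
  rw [inner_cellX hB hs hc hc', if_neg]
  intro h
  have := congrArg Finset.card h
  rw [Finset.card_image_of_injective _ hc, Finset.card_image_of_injective _ hc'] at this
  simp at this
  exact hnm this

theorem tens_ivl_eq_sum_cellK (hs : IsGrid T s) {p q : Fin n → ℕ} (hpq : ∀ i, p i ≤ q i) :
    tens T (fun i => ivl (s (p i)) (s (q i))) =
      ∑ c ∈ Fintype.piFinset fun i => Finset.Ico (p i) (q i), cellK T s c := by
  simp_rw [fun i => ivl_eq_sum hs.mono (hpq i)]
  exact tens_sum (fun i => Finset.Ico (p i) (q i)) fun _ _ => bddMeas_ivl _ _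

theorem prodInc_eq_sum_cellX (hB : IsBrownianOn P T B) (hs : IsGrid T s) {p q : Fin n → ℕ}
    (hpq : ∀ i, p i ≤ q i) :
    prodInc P B (fun i => s (p i)) (fun i => s (q i)) =
      ∑ c ∈ Fintype.piFinset fun i => Finset.Ico (p i) (q i), cellX P B s c := by
  unfold cellX prodInc
  rw [← toL2_sum _ fun c _ => hB.memLp_prod fun i => hs.bounds (c i)]
  congr 1
  ext ω
  rw [← Finset.prod_univ_sum (fun i => Finset.Ico (p i) (q i))
    fun _ j => B (s (j + 1)) ω - B (s j) ω]
  exact Finset.prod_congr rfl fun i _ => sub_eq_sum (fun j => B (s j) ω) (hpq i)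

/-- A cell used twice would lie in two disjoint sides of the box. Strict monotonicity makes the cell
nonempty, and its right end point gives the contradiction. -/
theorem injective_of_mem_piFinset {N : ℕ} (hs : StrictMonoOn s (Set.Iic N)) {p q : Fin n → ℕ}
    (hq : ∀ i, q i ≤ N) (hd : OffDiag T (fun i => s (p i)) fun i => s (q i))
    (hm : Monotone s) {c : Fin n → ℕ}
    (hc : c ∈ Fintype.piFinset fun i => Finset.Ico (p i) (q i)) : Function.Injective c := by
  intro i j hij
  by_contra hne
  have h1 := Finset.mem_Ico.1 (Fintype.mem_piFinset.1 hc i)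
  have h2 := Finset.mem_Ico.1 (Fintype.mem_piFinset.1 hc j)
  have h3 : s (c i) < s (c i + 1) :=
    hs (Set.mem_Iic.2 (by have := hq i; omega)) (Set.mem_Iic.2 (by have := hq i; omega))
      (Nat.lt_succ_self _)
  refine (Set.disjoint_left.1 (hd.2 i j hne)) (?_ : s (c i + 1) ∈ _) ?_
  · exact ⟨(hm h1.1).trans_lt h3, hm h1.2⟩
  · rw [hij] at h3 ⊢
    exact ⟨(hm h2.1).trans_lt h3, hm h2.2⟩

end Cells

/-! ### The multiple Itô integral as a bounded operator -/

section Ito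

variable {Ω : Type*} [MeasurableSpace Ω] {P : Measure Ω} [IsProbabilityMeasure P]
  {T : ℝ} {B : ℝ → Ω → ℝ} {n m : ℕ}

theorem OffDiag.exists_common_grid (hT : 0 < T) {a b : Fin n → ℝ} {a' b' : Fin m → ℝ}
    (h : OffDiag T a b) (h' : OffDiag T a' b') :
    ∃ s : ℕ → ℝ, ∃ N, IsGrid T s ∧ StrictMonoOn s (Set.Iic N) ∧
      (∃ p q : Fin n → ℕ, (∀ i, p i ≤ q i ∧ q i ≤ N) ∧ (a = fun i => s (p i)) ∧
        b = fun i => s (q i)) ∧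
      (∃ p q : Fin m → ℕ, (∀ i, p i ≤ q i ∧ q i ≤ N) ∧ (a' = fun i => s (p i)) ∧
        b' = fun i => s (q i)) := by
  classical
  -- The point 0 keeps the set nonempty when both boxes have dimension zero.
  let F : Finset ℝ := insert 0 (Finset.univ.image a ∪ Finset.univ.image b ∪
    (Finset.univ.image a' ∪ Finset.univ.image b'))
  have hF : ∀ x ∈ F, x ∈ Set.Icc 0 T := by
    intro x hx
    simp only [F, Finset.mem_insert, Finset.mem_union, Finset.mem_image, Finset.mem_univ,
      true_and] at hx
    rcases hx with rfl | (⟨i, rfl⟩ | ⟨i, rfl⟩) | ⟨i, rfl⟩ | ⟨i, rfl⟩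
    · exact ⟨le_rfl, hT.le⟩
    · exact ⟨(h.1 i).1, (h.1 i).2.1.trans (h.1 i).2.2⟩
    · exact ⟨(h.1 i).1.trans (h.1 i).2.1, (h.1 i).2.2⟩
    · exact ⟨(h'.1 i).1, (h'.1 i).2.1.trans (h'.1 i).2.2⟩
    · exact ⟨(h'.1 i).1.trans (h'.1 i).2.1, (h'.1 i).2.2⟩
  obtain ⟨s, N, hs, hsm, hsF⟩ := exists_grid F hF ⟨0, by simp [F]⟩
  have aux : ∀ {k : ℕ} (u v : Fin k → ℝ), (∀ i, u i ∈ F) → (∀ i, v i ∈ F) → (∀ i, u i ≤ v i) →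
      ∃ p q : Fin k → ℕ, (∀ i, p i ≤ q i ∧ q i ≤ N) ∧ (u = fun i => s (p i)) ∧
        v = fun i => s (q i) := by
    intro k u v hu hv huv
    choose p hp hpu using fun i => hsF _ (hu i)
    choose q hq hqv using fun i => hsF _ (hv i)
    refine ⟨p, q, fun i => ⟨?_, hq i⟩, funext fun i => (hpu i).symm, funext fun i => (hqv i).symm⟩
    rw [← hsm.le_iff_le (hp i) (hq i), hpu, hqv]
    exact huv i
  refine ⟨s, N, hs, hsm, aux a b ?_ ?_ fun i => (h.1 i).2.1, aux a' b' ?_ ?_ fun i => (h'.1 i).2.1⟩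
  all_goals intro i; simp [F]

/-- Both boxes are cut into cells of a common grid; the two sides are bilinear in the cells, where
the identity is the isometry for cells. -/
theorem inner_prodInc (hT : 0 < T) (hB : IsBrownianOn P T B) {a b a' b' : Fin n → ℝ}
    (h : OffDiag T a b) (h' : OffDiag T a' b') :
    inner ℝ (prodInc P B a b) (prodInc P B a' b') = ∑ σ : Equiv.Perm (Fin n),
      inner ℝ (tens T fun i => ivl (a i) (b i)) (permK σ (tens T fun i => ivl (a' i) (b' i))) := by
  obtain ⟨s, N, hs, hsm, ⟨p, q, hpq, rfl, rfl⟩, ⟨p', q', hpq', rfl, rfl⟩⟩ :=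
    h.exists_common_grid hT h'
  rw [prodInc_eq_sum_cellX hB hs fun i => (hpq i).1,
    prodInc_eq_sum_cellX hB hs fun i => (hpq' i).1,
    tens_ivl_eq_sum_cellK hs fun i => (hpq i).1, tens_ivl_eq_sum_cellK hs fun i => (hpq' i).1]
  simp only [map_sum, sum_inner, inner_sum]
  rw [Finset.sum_comm (s := Finset.univ)]
  refine Finset.sum_congr rfl fun c hc => ?_
  rw [Finset.sum_comm (s := Finset.univ)]
  refine Finset.sum_congr rfl fun c' hc' => ?_
  exact inner_cellX_eq_sum hB hs
    (injective_of_mem_piFinset hsm (fun i => (hpq i).2) h hs.mono hc')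
    (injective_of_mem_piFinset hsm (fun i => (hpq' i).2) h' hs.mono hc)

theorem inner_prodInc_of_ne (hT : 0 < T) (hB : IsBrownianOn P T B) {a b : Fin n → ℝ}
    {a' b' : Fin m → ℝ} (h : OffDiag T a b) (h' : OffDiag T a' b') (hnm : n ≠ m) :
    inner ℝ (prodInc P B a b) (prodInc P B a' b') = 0 := by
  obtain ⟨s, N, hs, hsm, ⟨p, q, hpq, rfl, rfl⟩, ⟨p', q', hpq', rfl, rfl⟩⟩ :=
    h.exists_common_grid hT h'
  rw [prodInc_eq_sum_cellX hB hs fun i => (hpq i).1,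
    prodInc_eq_sum_cellX hB hs fun i => (hpq' i).1]
  simp only [sum_inner, inner_sum]
  refine Finset.sum_eq_zero fun c hc => Finset.sum_eq_zero fun c' hc' => ?_
  apply inner_cellX_of_ne hB hs _ _ hnm
  · exact injective_of_mem_piFinset hsm (fun i => (hpq i).2) h hs.mono ‹_›
  · exact injective_of_mem_piFinset hsm (fun i => (hpq' i).2) h' hs.mono ‹_›

theorem IsBrownianOn.itoGraph_induction (hB : IsBrownianOn P T B) {F : Type*}
    [NormedAddCommGroup F] [NormedSpace ℝ F] (f : (Kern T n × Lp ℝ 2 P) →L[ℝ] F)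
    (hf : ∀ a b : Fin n → ℝ, OffDiag T a b →
      f (tens T fun i => ivl (a i) (b i), prodInc P B a b) = 0)
    {p : Kern T n × Lp ℝ 2 P} (hp : p ∈ itoGraph P T B n) : f p = 0 := by
  have : itoGraph P T B n ≤ f.ker := by
    refine Submodule.topologicalClosure_minimal _ (Submodule.span_le.2 ?_) f.isClosed_ker
    rw [hB.elementaryIto_eq]
    rintro p ⟨a, b, hab, rfl⟩
    exact hf a b hab
  exact this hp

/-- The identity is a closed linear condition on each pair when the other is fixed, so it passes
from boxes to the closure in one argument and then in the other. -/
theorem inner_snd_of_mem_itoGraph (hT : 0 < T) (hB : IsBrownianOn P T B)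
    {p p' : Kern T n × Lp ℝ 2 P} (hp : p ∈ itoGraph P T B n) (hp' : p' ∈ itoGraph P T B n) :
    inner ℝ p.2 p'.2 = ∑ σ : Equiv.Perm (Fin n), inner ℝ p.1 (permK σ p'.1) := by
  have H : ∀ p p' : Kern T n × Lp ℝ 2 P,
      ((innerSL ℝ p'.2).comp (ContinuousLinearMap.snd ℝ (Kern T n) (Lp ℝ 2 P)) -
      (∑ σ : Equiv.Perm (Fin n), innerSL ℝ (permK σ p'.1)).comp
        (ContinuousLinearMap.fst ℝ (Kern T n) (Lp ℝ 2 P))) p = 0 ↔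
      inner ℝ p.2 p'.2 = ∑ σ : Equiv.Perm (Fin n), inner ℝ p.1 (permK σ p'.1) := by
    intro p p'
    simp [sub_eq_zero, real_inner_comm]
  -- The sum over permutations is symmetric in the kernels, by σ ↦ σ⁻¹. This permits exchanging the
  -- roles of the two pairs.
  have hsymm : ∀ f g : Kern T n, ∑ σ : Equiv.Perm (Fin n), inner ℝ f (permK σ g) =
      ∑ σ : Equiv.Perm (Fin n), inner ℝ g (permK σ f) := by
    intro f g
    rw [← Equiv.sum_comp (Equiv.inv _)]
    refine Finset.sum_congr rfl fun σ _ => ?_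
    rw [Equiv.inv_apply, ← inner_permK, real_inner_comm]
  rw [← H]
  refine hB.itoGraph_induction _ (fun a b hab => ?_) hp
  rw [H, real_inner_comm, hsymm, ← H]
  refine hB.itoGraph_induction _ (fun a' b' hab' => ?_) hp'
  rw [H]
  exact inner_prodInc hT hB hab' hab

theorem inner_snd_of_mem_itoGraph_of_ne (hT : 0 < T) (hB : IsBrownianOn P T B) (hnm : n ≠ m)
    {p : Kern T n × Lp ℝ 2 P} {p' : Kern T m × Lp ℝ 2 P} (hp : p ∈ itoGraph P T B n)
    (hp' : p' ∈ itoGraph P T B m) : inner ℝ p.2 p'.2 = 0 := by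
  rw [real_inner_comm]
  refine hB.itoGraph_induction
    ((innerSL ℝ p'.2).comp (ContinuousLinearMap.snd ℝ (Kern T n) (Lp ℝ 2 P)))
    (fun a b hab => ?_) hp
  simp only [ContinuousLinearMap.comp_apply, ContinuousLinearMap.coe_snd', innerSL_apply_apply]
  rw [real_inner_comm]
  refine hB.itoGraph_induction
    ((innerSL ℝ (prodInc P B a b)).comp (ContinuousLinearMap.snd ℝ (Kern T m) (Lp ℝ 2 P)))
    (fun a' b' hab' => ?_) hp'
  exact inner_prodInc_of_ne hT hB hab hab' hnm

theorem norm_snd_sq_le_of_mem_itoGraph (hT : 0 < T) (hB : IsBrownianOn P T B)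
    {p : Kern T n × Lp ℝ 2 P} (hp : p ∈ itoGraph P T B n) :
    ‖p.2‖ ^ 2 ≤ n.factorial * ‖p.1‖ ^ 2 := by
  rw [← real_inner_self_eq_norm_sq, inner_snd_of_mem_itoGraph hT hB hp hp]
  have : (n.factorial : ℝ) * ‖p.1‖ ^ 2 = ∑ _σ : Equiv.Perm (Fin n), ‖p.1‖ ^ 2 := by
    rw [Finset.sum_const, Finset.card_univ, Fintype.card_perm, Fintype.card_fin, nsmul_eq_mul]
  rw [this]
  refine Finset.sum_le_sum fun σ _ => (real_inner_le_norm _ _).trans_eq ?_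
  rw [LinearIsometry.norm_map, sq]

theorem norm_snd_le_of_mem_itoGraph (hT : 0 < T) (hB : IsBrownianOn P T B)
    {p : Kern T n × Lp ℝ 2 P} (hp : p ∈ itoGraph P T B n) :
    ‖p.2‖ ≤ √n.factorial * ‖p.1‖ := by
  refine le_of_sq_le_sq ?_ (by positivity)
  rw [mul_pow, Real.sq_sqrt (by positivity)]
  exact norm_snd_sq_le_of_mem_itoGraph hT hB hp

/-- The isometry bounds a point of the graph by its first component, so the projection of the
complete graph to the kernels has closed range. The range contains the boxes, whose span is dense.
-/
theorem exists_mem_itoGraph (hT : 0 < T) (hB : IsBrownianOn P T B) (h : Kern T n) :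
    ∃ X, (h, X) ∈ itoGraph P T B n := by
  have : CompleteSpace (itoGraph P T B n) :=
    (Submodule.isClosed_topologicalClosure _).completeSpace_coe
  let f : itoGraph P T B n →L[ℝ] Kern T n :=
    (ContinuousLinearMap.fst ℝ _ _).comp (itoGraph P T B n).subtypeL
  -- The norm on the product is the maximum of the two norms; 1 covers the kernel and √n! the random
  -- variable.
  have hf : AntilipschitzWith (1 + NNReal.sqrt n.factorial) f := by
    refine f.antilipschitz_of_bound fun p => ?_
    have h2 := norm_snd_le_of_mem_itoGraph hT hB p.2
    have h3 : ‖f p‖ = ‖p.1.1‖ := rfl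
    rw [Submodule.coe_norm, Prod.norm_def, h3]
    push_cast
    have h4 : 0 ≤ √(n.factorial : ℝ) * ‖p.1.1‖ := by positivity
    have h5 := norm_nonneg p.1.1
    refine max_le ?_ ?_ <;> linarith
  have hcl : IsClosed (f.range : Set (Kern T n)) := by
    exact hf.isClosed_range f.uniformContinuous
  have hle : (⊤ : Submodule ℝ (Kern T n)) ≤ f.range := by
    rw [← span_boxes_topologicalClosure hT]
    refine Submodule.topologicalClosure_minimal _ (Submodule.span_le.2 ?_) hcl
    rintro _ ⟨a, b, hab, rfl⟩
    have hmem : ((tens T fun i => ivl (a i) (b i), prodInc P B a b) : Kern T n × Lp ℝ 2 P) ∈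
        itoGraph P T B n := by
      refine Submodule.le_topologicalClosure _ (Submodule.subset_span ?_)
      rw [hB.elementaryIto_eq]
      exact ⟨a, b, hab, rfl⟩
    exact ⟨⟨_, hmem⟩, rfl⟩
  obtain ⟨⟨⟨h', X⟩, hp⟩, rfl⟩ := hle (Submodule.mem_top (x := h))
  exact ⟨X, hp⟩

theorem mem_itoGraph_multIto (hT : 0 < T) (hB : IsBrownianOn P T B) (h : Kern T n) :
    (h, multIto P T B n h) ∈ itoGraph P T B n := by
  have hX := exists_mem_itoGraph hT hB h
  rw [multIto, dif_pos hX]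
  exact hX.choose_spec

/-- The difference of two points over the same kernel has first component 0, and the norm bound
makes the second one 0 as well. Linearity of the integral and its values on boxes follow from this
uniqueness. -/
theorem multIto_eq_of_mem (hT : 0 < T) (hB : IsBrownianOn P T B) {h : Kern T n} {X : Lp ℝ 2 P}
    (hX : (h, X) ∈ itoGraph P T B n) : multIto P T B n h = X := by
  have := norm_snd_le_of_mem_itoGraph hT hB (Submodule.sub_mem _ (mem_itoGraph_multIto hT hB h) hX)
  simp only [Prod.mk_sub_mk, sub_self, norm_zero, mul_zero] at this
  exact sub_eq_zero.1 (norm_le_zero_iff.1 this)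

theorem norm_multIto_le (hT : 0 < T) (hB : IsBrownianOn P T B) (h : Kern T n) :
    ‖multIto P T B n h‖ ≤ √n.factorial * ‖h‖ :=
  norm_snd_le_of_mem_itoGraph (p := (h, multIto P T B n h)) hT hB (mem_itoGraph_multIto hT hB h)

theorem multIto_add (hT : 0 < T) (hB : IsBrownianOn P T B) (h g : Kern T n) :
    multIto P T B n (h + g) = multIto P T B n h + multIto P T B n g :=
  multIto_eq_of_mem hT hB (Submodule.add_mem _
    (mem_itoGraph_multIto hT hB h) (mem_itoGraph_multIto hT hB g))

theorem multIto_smul (hT : 0 < T) (hB : IsBrownianOn P T B) (c : ℝ) (h : Kern T n) :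
    multIto P T B n (c • h) = c • multIto P T B n h :=
  multIto_eq_of_mem hT hB (Submodule.smul_mem _ c (mem_itoGraph_multIto hT hB h))

/-- The multiple Itô integral as a bounded operator. -/
def itoL (hT : 0 < T) (hB : IsBrownianOn P T B) (n : ℕ) : Kern T n →L[ℝ] Lp ℝ 2 P :=
  LinearMap.mkContinuous
    { toFun := multIto P T B n
      map_add' := multIto_add hT hB
      map_smul' := multIto_smul hT hB }
    (√n.factorial) (norm_multIto_le hT hB)

variable (hT : 0 < T) (hB : IsBrownianOn P T B)

theorem itoL_apply (h : Kern T n) : itoL hT hB n h = multIto P T B n h := rfl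

theorem norm_itoL_le (h : Kern T n) : ‖itoL hT hB n h‖ ≤ √n.factorial * ‖h‖ :=
  norm_multIto_le hT hB h

theorem itoL_box {a b : Fin n → ℝ} (hab : OffDiag T a b) :
    itoL hT hB n (tens T fun i => ivl (a i) (b i)) = prodInc P B a b := by
  refine multIto_eq_of_mem hT hB (Submodule.le_topologicalClosure _ (Submodule.subset_span ?_))
  rw [hB.elementaryIto_eq]
  exact ⟨a, b, hab, rfl⟩

theorem inner_itoL (h g : Kern T n) : inner ℝ (itoL hT hB n h) (itoL hT hB n g) =
    ∑ σ : Equiv.Perm (Fin n), inner ℝ h (permK σ g) :=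
  inner_snd_of_mem_itoGraph hT hB (mem_itoGraph_multIto hT hB h) (mem_itoGraph_multIto hT hB g)

theorem inner_itoL_of_ne (hnm : n ≠ m) (h : Kern T n) (g : Kern T m) :
    inner ℝ (itoL hT hB n h) (itoL hT hB m g) = 0 :=
  inner_snd_of_mem_itoGraph_of_ne hT hB hnm (mem_itoGraph_multIto hT hB h)
    (mem_itoGraph_multIto hT hB g)

theorem norm_itoL_sq {h : Kern T n} (hh : IsSymmKern h) :
    ‖itoL hT hB n h‖ ^ 2 = n.factorial * ‖h‖ ^ 2 := by
  rw [← real_inner_self_eq_norm_sq, inner_itoL]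
  simp_rw [isSymmKern_iff.1 hh]
  rw [Finset.sum_const, Finset.card_univ, Fintype.card_perm, Fintype.card_fin, nsmul_eq_mul,
    real_inner_self_eq_norm_sq]

/-- The isometry symmetrizes: in the squared norm of the difference the two sums over permutations
agree after a translation of the group. -/
theorem itoL_permK (σ : Equiv.Perm (Fin n)) (h : Kern T n) :
    itoL hT hB n (permK σ h) = itoL hT hB n h := by
  rw [← sub_eq_zero, ← inner_self_eq_zero (𝕜 := ℝ), ← map_sub]
  rw [inner_itoL]
  simp_rw [map_sub, inner_sub_right, permK_mul]
  rw [Finset.sum_sub_distrib, sub_eq_zero]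
  exact Equiv.sum_comp (Equiv.mulRight σ) fun τ => inner ℝ (permK σ h - h) (permK τ h)

end Ito

/-! ### Products of square integrable random variables -/

section Mul

variable {Ω : Type*} [MeasurableSpace Ω] (P : Measure Ω) [IsProbabilityMeasure P]

/-- The product `L² × L² → L¹` as a bounded bilinear map. -/
def mulL : Lp ℝ 2 P →L[ℝ] Lp ℝ 2 P →L[ℝ] Lp ℝ 1 P :=
  (ContinuousLinearMap.mul ℝ ℝ).holderL P 2 2 1

theorem coeFn_mulL (X Y : Lp ℝ 2 P) : mulL P X Y =ᵐ[P] fun ω => X ω * Y ω :=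
  (ContinuousLinearMap.mul ℝ ℝ).coeFn_holder X Y

theorem mulL1_eq (X Y : Lp ℝ 2 P) : mulL1 P X Y = mulL P X Y := by
  apply Lp.ext
  exact (Integrable.coeFn_toL1 _).trans (coeFn_mulL P X Y).symm

theorem norm_mulL_le (X Y : Lp ℝ 2 P) : ‖mulL P X Y‖ ≤ ‖X‖ * ‖Y‖ := by
  have h1 : ‖mulL P‖ ≤ 1 := (ContinuousLinearMap.norm_holderL_le ..).trans (by simp)
  simpa using (mulL P).le_of_opNorm₂_le_of_le h1 le_rfl le_rfl (x := X) (y := Y)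

/-- The inclusion of `L²` into `L¹`. -/
def inclL : Lp ℝ 2 P →L[ℝ] Lp ℝ 1 P := (mulL P).flip (toL2 P fun _ => 1)

theorem coeFn_inclL (X : Lp ℝ 2 P) : inclL P X =ᵐ[P] X := by
  filter_upwards [coeFn_mulL P X (toL2 P fun _ => 1), coeFn_toL2 (memLp_const (μ := P) (1 : ℝ))]
    with ω h1 h2
  change mulL P X (toL2 P fun _ => 1) ω = _
  rw [h1, h2, mul_one]

end Mul

/-! ### Adding and removing a variable -/

section Snoc

variable {T : ℝ} {n : ℕ}

/-- A function of one variable as a kernel. -/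
abbrev kern1 (T : ℝ) (φ : ℝ → ℝ) : Kern T 1 := tens T fun _ => φ

/-- Append a function. -/
abbrev snocF (f : Fin n → ℝ → ℝ) (φ : ℝ → ℝ) : Fin (n + 1) → ℝ → ℝ :=
  Fin.snoc (α := fun _ => ℝ → ℝ) f φ

theorem bddMeas_snocF {f : Fin n → ℝ → ℝ} {φ : ℝ → ℝ} (hf : ∀ i, BddMeas (f i)) (hφ : BddMeas φ)
    (i : Fin (n + 1)) : BddMeas (snocF f φ i) := by
  refine Fin.lastCases ?_ (fun i => ?_) i
  · simpa using hφ
  · simpa using hf i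

theorem tensorL_kern1 {f : Fin n → ℝ → ℝ} {φ : ℝ → ℝ} (hf : ∀ i, BddMeas (f i))
    (hφ : BddMeas φ) : tensorL T n 1 (tens T f) (kern1 T φ) = tens T (snocF f φ) := by
  rw [tensorL_tens hf fun _ => hφ, Fin.append_right_eq_snoc]

theorem boxes_ext (hT : 0 < T) {F : Type*} [NormedAddCommGroup F] [NormedSpace ℝ F]
    {f f' : Kern T n →L[ℝ] F} (h : ∀ a b : Fin n → ℝ, OffDiag T a b →
      f (tens T fun i => ivl (a i) (b i)) = f' (tens T fun i => ivl (a i) (b i))) : f = f' := by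
  refine ContinuousLinearMap.ext_on (s := {h : Kern T n | ∃ a b : Fin n → ℝ, OffDiag T a b ∧
      h = tens T fun i => ivl (a i) (b i)}) ?_ ?_
  · rw [Submodule.dense_iff_topologicalClosure_eq_top]
    exact span_boxes_topologicalClosure hT
  · rintro _ ⟨a, b, hab, rfl⟩
    exact h a b hab

/-- The contraction of the last variable of a kernel with a function of one variable. -/
def ctrL (T : ℝ) (n : ℕ) : Kern T 1 →L[ℝ] Kern T (n + 1) →L[ℝ] Kern T n :=
  ((ContinuousLinearMap.lsmul ℝ ℝ).lpPairing (cubeMeasure T 1) 2 2).bilinearComp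
    (ContinuousLinearMap.id ℝ _) (sliceL T n 1).toContinuousLinearMap

theorem integral_cube_one (F : ℝ → ℝ) :
    ∫ t, F (t 0) ∂(cubeMeasure T 1) = ∫ x, F x ∂(itvMeasure T) := by
  have := integral_fintype_prod_eq_prod (𝕜 := ℝ) (ι := Fin 1) (μ := fun _ => itvMeasure T)
    fun _ x => F x
  simp only [Finset.univ_unique, Fin.default_eq_zero, Finset.prod_singleton] at this
  exact this

/-- Slicing off the last factor leaves a scalar function times a fixed kernel, so the pairing
reduces to one scalar integral. -/
theorem ctrL_tens {f : Fin n → ℝ → ℝ} {φ ψ : ℝ → ℝ} (hf : ∀ i, BddMeas (f i)) (hφ : BddMeas φ)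
    (hψ : BddMeas ψ) : ctrL T n (kern1 T φ) (tens T (snocF f ψ)) =
      (∫ x, φ x * ψ x ∂(itvMeasure T)) • tens T f := by
  change (ContinuousLinearMap.lsmul ℝ ℝ).lpPairing (cubeMeasure T 1) 2 2 (kern1 T φ)
    (sliceL T n 1 (tens T (snocF f ψ))) = _
  rw [ContinuousLinearMap.lpPairing_eq_integral]
  have h := sliceL_tens (T := T) hf (g := fun _ : Fin 1 => ψ) fun _ => hψ
  rw [Fin.append_right_eq_snoc] at h
  have h2 : ∫ t, ContinuousLinearMap.lsmul ℝ ℝ (kern1 T φ t)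
      (sliceL T n 1 (tens T (snocF f ψ)) t) ∂(cubeMeasure T 1) =
      ∫ t, ((fun x => φ x * ψ x) (t 0)) • tens T f ∂(cubeMeasure T 1) := by
    refine integral_congr_ae ?_
    filter_upwards [h, coeFn_tens (T := T) (f := fun _ : Fin 1 => φ) fun _ => hφ] with t h1 h2
    rw [h1, h2]
    simp [smul_smul, mul_comm]
  rw [h2, integral_smul_const, integral_cube_one fun x => φ x * ψ x]

/-- The permutation that moves the last index to `i` and keeps the order of the others. -/
def lastTo (i : Fin (n + 1)) : Equiv.Perm (Fin (n + 1)) :=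
  finSuccEquivLast.trans (finSuccEquiv' i).symm

theorem comp_lastTo {α : Type*} (f : Fin (n + 1) → α) (i : Fin (n + 1)) :
    (fun j => f (lastTo i j)) = Fin.snoc (α := fun _ => α) (fun j => f (i.succAbove j)) (f i) := by
  ext j
  refine Fin.lastCases ?_ (fun j => ?_) j <;> simp [lastTo]

theorem OffDiag.snoc {a b : Fin n → ℝ} (h : OffDiag T a b) {u v : ℝ}
    (huv : 0 ≤ u ∧ u ≤ v ∧ v ≤ T) (hd : ∀ i, Disjoint (Set.Ioc (a i) (b i)) (Set.Ioc u v)) :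
    OffDiag T (Fin.snoc (α := fun _ => ℝ) a u) (Fin.snoc (α := fun _ => ℝ) b v) := by
  refine ⟨fun i => ?_, fun i j => ?_⟩
  · refine Fin.lastCases ?_ (fun i => ?_) i
    · simpa using huv
    · simpa using h.1 i
  · refine Fin.lastCases ?_ (fun i => ?_) i <;> refine Fin.lastCases ?_ (fun j => ?_) j
    · exact fun h => absurd rfl h
    · exact fun _ => by simpa only [Fin.snoc_castSucc, Fin.snoc_last] using (hd j).symm
    · exact fun _ => by simpa only [Fin.snoc_castSucc, Fin.snoc_last] using hd i
    · intro hij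
      simpa using h.2 i j fun h => hij (by rw [h])

theorem ivl_snoc (a b : Fin n → ℝ) (u v : ℝ) :
    (fun i => ivl (Fin.snoc (α := fun _ => ℝ) a u i) (Fin.snoc (α := fun _ => ℝ) b v i)) =
      snocF (fun i => ivl (a i) (b i)) (ivl u v) := by
  ext i : 1
  refine Fin.lastCases ?_ (fun i => ?_) i <;> simp

variable {Ω : Type*} [MeasurableSpace Ω] {P : Measure Ω} [IsProbabilityMeasure P]
  {B : ℝ → Ω → ℝ} (hT : 0 < T) (hB : IsBrownianOn P T B)

theorem itoL_tens_comp (σ : Equiv.Perm (Fin n)) {f : Fin n → ℝ → ℝ} (hf : ∀ i, BddMeas (f i)) :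
    itoL hT hB n (tens T fun i => f (σ i)) = itoL hT hB n (tens T f) := by
  rw [← itoL_permK hT hB σ.symm (tens T f), permK_tens _ hf]
  simp

theorem itoL_tens_snoc_comp (σ : Equiv.Perm (Fin n)) {f : Fin n → ℝ → ℝ} {φ : ℝ → ℝ}
    (hf : ∀ i, BddMeas (f i)) (hφ : BddMeas φ) :
    itoL hT hB (n + 1) (tens T (snocF (fun i => f (σ i)) φ)) =
      itoL hT hB (n + 1) (tens T (snocF f φ)) := by
  let τ : Equiv.Perm (Fin (n + 1)) :=
    finSumFinEquiv.permCongr (Equiv.sumCongr σ (Equiv.refl (Fin 1)))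
  rw [← itoL_tens_comp hT hB τ (bddMeas_snocF hf hφ)]
  congr 2
  ext i : 1
  simp only [snocF, ← Fin.append_right_eq_snoc _ (fun _ : Fin 1 => φ)]
  refine Fin.addCases (fun i => ?_) (fun i => ?_) i <;> simp [τ, Equiv.permCongr_apply]

/-- The sum of the contractions of all the variables of a kernel with a function of one variable,
followed by the Itô integral. -/
def contrL : (n : ℕ) → Kern T 1 →L[ℝ] Kern T n →L[ℝ] Lp ℝ 2 P
  | 0 => 0
  | n + 1 => ∑ i : Fin (n + 1), ((ContinuousLinearMap.compL ℝ _ _ _ (itoL hT hB n)).comp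
      ((ctrL T n).bilinearComp (ContinuousLinearMap.id ℝ _)
        (permK (lastTo i)⁻¹).toContinuousLinearMap))

theorem contrL_tens {f : Fin (n + 1) → ℝ → ℝ} {φ : ℝ → ℝ} (hf : ∀ i, BddMeas (f i))
    (hφ : BddMeas φ) : contrL hT hB (n + 1) (kern1 T φ) (tens T f) =
      ∑ i, (∫ x, φ x * f i x ∂(itvMeasure T)) •
        itoL hT hB n (tens T fun j => f (i.succAbove j)) := by
  simp only [contrL, sum_apply]
  refine Finset.sum_congr rfl fun i _ => ?_
  change itoL hT hB n (ctrL T n (kern1 T φ) (permK (lastTo i)⁻¹ (tens T f))) = _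
  have h1 : (fun j => f ((lastTo i)⁻¹.symm j)) = snocF (fun j => f (i.succAbove j)) (f i) :=
    comp_lastTo f i
  rw [permK_tens _ hf, h1, ctrL_tens (fun j => hf _) hφ (hf i), map_smul]

end Snoc

/-! ### The quadratic variation and double integrals over a square -/

section QuadVar

variable {Ω : Type*} [MeasurableSpace Ω] {P : Measure Ω} [IsProbabilityMeasure P]
  {T : ℝ} {B : ℝ → Ω → ℝ} {n : ℕ}

/-- The variance of the square of a standard normal variable. -/
def normalSqVar : ℝ := ∫ x, (x ^ 2 - 1) ^ 2 ∂(gaussianReal 0 1)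

/-- Scaling by √δ. The value of `normalSqVar` plays no role: the quadratic dependence on δ makes the
sum over K equal cells of order 1/K. -/
theorem integral_gaussian_sq_sub_sq {δ : ℝ} (hδ : 0 ≤ δ) :
    ∫ x, (x ^ 2 - δ) ^ 2 ∂(gaussianReal 0 δ.toNNReal) = normalSqVar * δ ^ 2 := by
  have h := gaussianReal_map_const_mul (μ := 0) (v := 1) √δ
  have h2 : (NNReal.mk (√δ ^ 2) (sq_nonneg _) * 1 : NNReal) = δ.toNNReal := by
    rw [mul_one]; ext; simp [hδ]
  rw [mul_zero, h2] at h
  rw [← h, integral_map (by fun_prop) (by fun_prop), normalSqVar, ← integral_mul_const]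
  refine integral_congr_ae (Eventually.of_forall fun x => ?_)
  simp only [mul_pow, Real.sq_sqrt hδ]
  ring

/-- The centred square of an increment. -/
def sqInc (P : Measure Ω) (B : ℝ → Ω → ℝ) (u v : ℝ) : Lp ℝ 2 P :=
  toL2 P fun ω => (B v ω - B u ω) ^ 2 - (v - u)

theorem IsBrownianOn.memLp_sqInc (hB : IsBrownianOn P T B) {u v : ℝ}
    (huv : 0 ≤ u ∧ u ≤ v ∧ v ≤ T) : MemLp (fun ω => (B v ω - B u ω) ^ 2 - (v - u)) 2 P := by
  refine MemLp.sub ?_ (memLp_const _)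
  have h := (hB.memLp_sub huv.1 huv.2.1 huv.2.2 4)
  have : ENNReal.HolderTriple ((4 : NNReal) : ENNReal) ((4 : NNReal) : ENNReal) 2 := by
    constructor
    rw [← ENNReal.toReal_eq_toReal_iff' (by simp) (by simp), ENNReal.toReal_add (by simp) (by simp)]
    norm_num
  have h2 := h.mul (r := 2) h
  refine h2.ae_eq (Eventually.of_forall fun ω => ?_)
  simp [sq]

theorem norm_sqInc_sq (hB : IsBrownianOn P T B) {u v : ℝ} (huv : 0 ≤ u ∧ u ≤ v ∧ v ≤ T) :
    ‖sqInc P B u v‖ ^ 2 = normalSqVar * (v - u) ^ 2 := by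
  have hm := hB.memLp_sqInc huv
  rw [← real_inner_self_eq_norm_sq, sqInc, inner_toL2 hm hm,
    ← integral_gaussian_sq_sub_sq (sub_nonneg.2 huv.2.1),
    ← hB.gaussian_increments u v huv.1 huv.2.1 huv.2.2,
    integral_map (hB.measurable_sub huv.1 huv.2.1 huv.2.2).aemeasurable (by fun_prop)]
  simp_rw [sq]

theorem IsBrownianOn.integral_sqInc (hB : IsBrownianOn P T B) {u v : ℝ}
    (huv : 0 ≤ u ∧ u ≤ v ∧ v ≤ T) : ∫ ω, ((B v ω - B u ω) ^ 2 - (v - u)) ∂P = 0 := by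
  have h : Integrable (fun ω => (B v ω - B u ω) ^ 2) P :=
    (hB.memLp_sub huv.1 huv.2.1 huv.2.2 2).integrable_sq
  rw [MeasureTheory.integral_sub h (integrable_const _), hB.integral_sub_sq huv.1 huv.2.1 huv.2.2]
  simp

/-- The centred squares over different cells are independent with mean zero, hence orthogonal. -/
theorem norm_sum_sqInc_sq (hB : IsBrownianOn P T B) {s : ℕ → ℝ} (hs : IsGrid T s) (K : ℕ) :
    ‖∑ k ∈ Finset.range K, sqInc P B (s k) (s (k + 1))‖ ^ 2 =
      ∑ k ∈ Finset.range K, normalSqVar * (s (k + 1) - s k) ^ 2 := by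
  rw [← real_inner_self_eq_norm_sq, sum_inner]
  refine Finset.sum_congr rfl fun k hk => ?_
  rw [inner_sum, Finset.sum_eq_single_of_mem k hk]
  · rw [real_inner_self_eq_norm_sq, norm_sqInc_sq hB (hs.bounds k)]
  · intro l _ hlk
    rw [sqInc, sqInc, inner_toL2 (hB.memLp_sqInc (hs.bounds k)) (hB.memLp_sqInc (hs.bounds l))]
    have hind := ((hB.iIndepFun_cells hs).indepFun hlk.symm).comp
      (φ := fun x : ℝ => x ^ 2 - (s (k + 1) - s k)) (ψ := fun x : ℝ => x ^ 2 - (s (l + 1) - s l))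
      (by fun_prop) (by fun_prop)
    have := hind.integral_fun_mul_eq_mul_integral (hB.memLp_sqInc (hs.bounds k)).1
      (hB.memLp_sqInc (hs.bounds l)).1
    refine this.trans ?_
    have h0 := hB.integral_sqInc (hs.bounds k)
    simp only [Function.comp_def] at h0 ⊢
    rw [h0, zero_mul]

/-- The uniform grid with `K` cells on `[u, v]`. -/
def uniformGrid (u v : ℝ) (K : ℕ) (k : ℕ) : ℝ := u + (min k K : ℕ) * ((v - u) / K)

theorem isGrid_uniformGrid {u v : ℝ} (huv : 0 ≤ u ∧ u ≤ v ∧ v ≤ T) {K : ℕ} (hK : 0 < K) :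
    IsGrid T (uniformGrid u v K) := by
  have hK' : (0 : ℝ) < K := Nat.cast_pos.2 hK
  have hδ : 0 ≤ (v - u) / K := div_nonneg (sub_nonneg.2 huv.2.1) hK'.le
  refine ⟨fun i j hij => ?_, fun i => ⟨?_, ?_⟩⟩
  · have : ((min i K : ℕ) : ℝ) ≤ (min j K : ℕ) := by exact_mod_cast min_le_min_right K hij
    have := mul_le_mul_of_nonneg_right this hδ
    unfold uniformGrid; linarith
  · have := huv.1
    unfold uniformGrid; positivity
  · have : ((min i K : ℕ) : ℝ) ≤ K := by exact_mod_cast min_le_right i K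
    have := mul_le_mul_of_nonneg_right this hδ
    rw [mul_div_cancel₀ _ hK'.ne'] at this
    unfold uniformGrid; linarith [huv.2.2]

theorem uniformGrid_zero (u v : ℝ) (K : ℕ) : uniformGrid u v K 0 = u := by simp [uniformGrid]

theorem uniformGrid_self (u v : ℝ) {K : ℕ} (hK : 0 < K) : uniformGrid u v K K = v := by
  have hK' : (K : ℝ) ≠ 0 := Nat.cast_ne_zero.2 hK.ne'
  rw [uniformGrid, min_self, mul_div_cancel₀ _ hK']; ring

theorem uniformGrid_sub (u v : ℝ) {K k : ℕ} (hk : k < K) :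
    uniformGrid u v K (k + 1) - uniformGrid u v K k = (v - u) / K := by
  rw [uniformGrid, uniformGrid, min_eq_left hk, min_eq_left hk.le]; push_cast; ring

theorem kern1_sum {ι : Type*} (S : Finset ι) {φ : ι → ℝ → ℝ} (hφ : ∀ k, BddMeas (φ k)) :
    kern1 T (fun x => ∑ k ∈ S, φ k x) = ∑ k ∈ S, kern1 T (φ k) := by
  simp only [kern1, tens, Finset.univ_unique, Finset.prod_singleton]
  exact toL2_sum S fun k _ => ((hφ k).comp (measurable_pi_apply _)).memLp _ _

theorem coeFn_prodInc_snoc (hB : IsBrownianOn P T B) {a b : Fin n → ℝ} {u v : ℝ}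
    (hab : ∀ i, 0 ≤ a i ∧ a i ≤ b i ∧ b i ≤ T) (huv : 0 ≤ u ∧ u ≤ v ∧ v ≤ T) :
    prodInc P B (Fin.snoc (α := fun _ => ℝ) a u) (Fin.snoc (α := fun _ => ℝ) b v) =ᵐ[P]
      fun ω => prodInc P B a b ω * (B v ω - B u ω) := by
  have h : ∀ i : Fin (n + 1), 0 ≤ Fin.snoc (α := fun _ => ℝ) a u i ∧
      Fin.snoc (α := fun _ => ℝ) a u i ≤ Fin.snoc (α := fun _ => ℝ) b v i ∧
      Fin.snoc (α := fun _ => ℝ) b v i ≤ T := fun i => by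
    refine Fin.lastCases ?_ (fun i => ?_) i
    · simpa using huv
    · simpa using hab i
  filter_upwards [coeFn_prodInc hB h, coeFn_prodInc hB hab] with ω h1 h2
  rw [h1, h2, Fin.prod_univ_castSucc]
  simp

variable (hT : 0 < T) (hB : IsBrownianOn P T B)

theorem OffDiag.snoc_snoc {a b : Fin n → ℝ} (hab : OffDiag T a b) {u v : ℝ}
    (hd : ∀ i, Disjoint (Set.Ioc (a i) (b i)) (Set.Ioc u v)) {s : ℕ → ℝ} (hs : IsGrid T s)
    {K k l : ℕ} (h0 : s 0 = u) (hK : s K = v) (hk : k < K) (hl : l < K) (hkl : k ≠ l) :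
    OffDiag T (Fin.snoc (α := fun _ => ℝ) (Fin.snoc (α := fun _ => ℝ) a (s k)) (s l))
      (Fin.snoc (α := fun _ => ℝ) (Fin.snoc (α := fun _ => ℝ) b (s (k + 1))) (s (l + 1))) := by
  have hsub : ∀ k < K, Set.Ioc (s k) (s (k + 1)) ⊆ Set.Ioc u v := fun k hk =>
    Set.Ioc_subset_Ioc (h0 ▸ hs.mono k.zero_le) (hK ▸ hs.mono hk)
  refine (hab.snoc (hs.bounds k) fun i => (hd i).mono_right (hsub k hk)).snoc (hs.bounds l)
    fun i => ?_
  refine Fin.lastCases ?_ (fun i => ?_) i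
  · simpa only [Fin.snoc_last] using hs.disjoint_cells hkl
  · simpa only [Fin.snoc_castSucc] using (hd i).mono_right (hsub l hl)

/-- Squares over different diagonal cells are disjoint, so their kernels are orthogonal and the
squared norm is, up to ‖f‖², the total area of the squares. -/
theorem norm_diag_sq {f : Fin n → ℝ → ℝ} (hf : ∀ i, BddMeas (f i)) {s : ℕ → ℝ}
    (hs : IsGrid T s) (K : ℕ) :
    ‖∑ k ∈ Finset.range K, tens T (snocF (snocF f (ivl (s k) (s (k + 1))))
      (ivl (s k) (s (k + 1))))‖ ^ 2 =
      ∑ k ∈ Finset.range K, ‖tens T f‖ ^ 2 * (s (k + 1) - s k) ^ 2 := by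
  have hff : ∀ k i, BddMeas (snocF (snocF f (ivl (s k) (s (k + 1))))
      (ivl (s k) (s (k + 1))) i) := fun k =>
    bddMeas_snocF (bddMeas_snocF hf (bddMeas_ivl _ _)) (bddMeas_ivl _ _)
  have hin : ∀ k l, inner ℝ (tens T (snocF (snocF f (ivl (s k) (s (k + 1))))
      (ivl (s k) (s (k + 1))))) (tens T (snocF (snocF f (ivl (s l) (s (l + 1))))
      (ivl (s l) (s (l + 1))))) = ‖tens T f‖ ^ 2 * (if k = l then s (k + 1) - s k else 0) ^ 2 := by
    intro k l
    rw [inner_tens (hff k) (hff l), ← real_inner_self_eq_norm_sq, inner_tens hf hf,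
      Fin.prod_univ_castSucc, Fin.prod_univ_castSucc]
    simp only [Fin.snoc_castSucc, Fin.snoc_last, integral_ivl_mul_ivl hs]
    ring
  rw [← real_inner_self_eq_norm_sq, sum_inner]
  refine Finset.sum_congr rfl fun k hk => ?_
  rw [inner_sum, Finset.sum_eq_single_of_mem k hk]
  · rw [hin, if_pos rfl]
  · intro l _ hlk
    rw [hin, if_neg hlk.symm]; simp

theorem tens_snoc_snoc_sum {f : Fin n → ℝ → ℝ} (hf : ∀ i, BddMeas (f i)) {ι : Type*}
    (S : Finset ι) {φ : ι → ℝ → ℝ} (hφ : ∀ k, BddMeas (φ k)) :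
    tens T (snocF (snocF f fun x => ∑ k ∈ S, φ k x) fun x => ∑ k ∈ S, φ k x) =
      ∑ k ∈ S, ∑ l ∈ S, tens T (snocF (snocF f (φ k)) (φ l)) := by
  have hS := BddMeas.sum S fun k _ => hφ k
  rw [← tensorL_kern1 (bddMeas_snocF hf hS) hS, ← tensorL_kern1 hf hS, kern1_sum S hφ]
  simp only [map_sum, sum_apply]
  rw [Finset.sum_comm]
  refine Finset.sum_congr rfl fun k _ => Finset.sum_congr rfl fun l _ => ?_
  rw [tensorL_kern1 hf (hφ k), tensorL_kern1 (bddMeas_snocF hf (hφ k)) (hφ l)]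

/-- Both the kernel of the square and the square of the increment split over pairs of cells. Pairs
of distinct cells give off-diagonal boxes, whose integrals are the products of increments, and
cancel. Only the diagonal remains on the right. -/
theorem double_sub_eq {a b : Fin n → ℝ} (hab : OffDiag T a b) {u v : ℝ}
    (huv : 0 ≤ u ∧ u ≤ v ∧ v ≤ T) (hd : ∀ i, Disjoint (Set.Ioc (a i) (b i)) (Set.Ioc u v))
    {s : ℕ → ℝ} (hs : IsGrid T s) {K : ℕ} (h0 : s 0 = u) (hK : s K = v) :
    inclL P (itoL hT hB (n + 2) (tens T
      (snocF (snocF (fun i => ivl (a i) (b i)) (ivl u v)) (ivl u v)))) -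
      mulL P (sqInc P B u v) (prodInc P B a b) =
    inclL P (itoL hT hB (n + 2) (∑ k ∈ Finset.range K, tens T
      (snocF (snocF (fun i => ivl (a i) (b i)) (ivl (s k) (s (k + 1)))) (ivl (s k) (s (k + 1)))))) -
      mulL P (∑ k ∈ Finset.range K, sqInc P B (s k) (s (k + 1))) (prodInc P B a b) := by
  set f : Fin n → ℝ → ℝ := fun i => ivl (a i) (b i) with hf
  have hfb : ∀ i, BddMeas (f i) := fun i => bddMeas_ivl _ _
  set e : ℕ → ℝ → ℝ := fun k => ivl (s k) (s (k + 1)) with he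
  have heb : ∀ k, BddMeas (e k) := fun k => bddMeas_ivl _ _
  have hsum : ivl u v = fun x => ∑ k ∈ Finset.range K, e k x := by
    rw [← h0, ← hK, ivl_eq_sum hs.mono K.zero_le, Finset.range_eq_Ico]
  -- `A` is the common contribution of the pairs of distinct cells.
  set A : Lp ℝ 2 P := ∑ k ∈ Finset.range K, ∑ l ∈ (Finset.range K).erase k,
    itoL hT hB (n + 2) (tens T (snocF (snocF f (e k)) (e l))) with hA
  have h1 : itoL hT hB (n + 2) (tens T (snocF (snocF f (ivl u v)) (ivl u v))) =
      A + itoL hT hB (n + 2) (∑ k ∈ Finset.range K, tens T (snocF (snocF f (e k)) (e k))) := by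
    rw [hsum, tens_snoc_snoc_sum hfb _ heb, hA]
    simp only [map_sum]
    rw [← Finset.sum_add_distrib]
    refine Finset.sum_congr rfl fun k hk => ?_
    rw [Finset.sum_erase_add _ _ hk]
  have hAe : A =ᵐ[P] fun ω => ∑ k ∈ Finset.range K, ∑ l ∈ (Finset.range K).erase k,
      prodInc P B a b ω * (B (s (k + 1)) ω - B (s k) ω) * (B (s (l + 1)) ω - B (s l) ω) := by
    have hkl : ∀ k ∈ Finset.range K, ∀ l ∈ (Finset.range K).erase k,
        itoL hT hB (n + 2) (tens T (snocF (snocF f (e k)) (e l))) =ᵐ[P] fun ω =>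
        prodInc P B a b ω * (B (s (k + 1)) ω - B (s k) ω) * (B (s (l + 1)) ω - B (s l) ω) := by
      intro k hk l hl
      obtain ⟨hlk, hl⟩ := Finset.mem_erase.1 hl
      have hk' := Finset.mem_range.1 hk
      have hl' := Finset.mem_range.1 hl
      have hod := hab.snoc_snoc hd hs h0 hK hk' hl' hlk.symm
      have hsub : Set.Ioc (s k) (s (k + 1)) ⊆ Set.Ioc u v :=
        Set.Ioc_subset_Ioc (h0 ▸ hs.mono k.zero_le) (hK ▸ hs.mono hk')
      have hod1 := hab.snoc (hs.bounds k) fun i => (hd i).mono_right hsub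
      have hbox := itoL_box hT hB hod
      rw [ivl_snoc, ivl_snoc] at hbox
      rw [hbox]
      filter_upwards [coeFn_prodInc_snoc hB hod1.1 (hs.bounds l),
        coeFn_prodInc_snoc hB hab.1 (hs.bounds k)] with ω h1 h2
      rw [h1, h2]
    have h2 : ∀ᵐ ω ∂P, ∀ k ∈ Finset.range K, ∀ l ∈ (Finset.range K).erase k,
        itoL hT hB (n + 2) (tens T (snocF (snocF f (e k)) (e l))) ω =
        prodInc P B a b ω * (B (s (k + 1)) ω - B (s k) ω) * (B (s (l + 1)) ω - B (s l) ω) := by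
      refine (Finset.eventually_all _).2 fun k hk => (Finset.eventually_all _).2 fun l hl => ?_
      exact hkl k hk l hl
    have h3 : ∀ᵐ ω ∂P, ∀ k ∈ Finset.range K, (∑ l ∈ (Finset.range K).erase k,
        itoL hT hB (n + 2) (tens T (snocF (snocF f (e k)) (e l))) : Lp ℝ 2 P) ω =
        ∑ l ∈ (Finset.range K).erase k,
          itoL hT hB (n + 2) (tens T (snocF (snocF f (e k)) (e l))) ω := by
      refine (Finset.eventually_all _).2 fun k hk => ?_
      filter_upwards [Lp.coeFn_finsetSum ((Finset.range K).erase k) fun l =>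
        itoL hT hB (n + 2) (tens T (snocF (snocF f (e k)) (e l)))] with ω h
      rw [h, Finset.sum_apply]
    filter_upwards [h2, h3, Lp.coeFn_finsetSum (Finset.range K) fun k =>
      ∑ l ∈ (Finset.range K).erase k,
        itoL hT hB (n + 2) (tens T (snocF (snocF f (e k)) (e l)))] with ω h4 h5 h6
    rw [hA, h6, Finset.sum_apply]
    refine Finset.sum_congr rfl fun k hk => ?_
    rw [h5 k hk]
    exact Finset.sum_congr rfl fun l hl => h4 k hk l hl
  have hQ : ∀ᵐ ω ∂P, (∑ k ∈ Finset.range K, sqInc P B (s k) (s (k + 1)) : Lp ℝ 2 P) ω =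
      ∑ k ∈ Finset.range K, ((B (s (k + 1)) ω - B (s k) ω) ^ 2 - (s (k + 1) - s k)) := by
    have h2 : ∀ᵐ ω ∂P, ∀ k ∈ Finset.range K, sqInc P B (s k) (s (k + 1)) ω =
        (B (s (k + 1)) ω - B (s k) ω) ^ 2 - (s (k + 1) - s k) :=
      (Finset.eventually_all _).2 fun k _ => coeFn_toL2 (hB.memLp_sqInc (hs.bounds k))
    filter_upwards [h2, Lp.coeFn_finsetSum (Finset.range K) fun k =>
      sqInc P B (s k) (s (k + 1))] with ω h3 h4
    rw [h4, Finset.sum_apply]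
    exact Finset.sum_congr rfl fun k hk => h3 k hk
  rw [h1, map_add, sub_eq_sub_iff_add_eq_add, add_right_comm, add_comm _ (mulL P _ _),
    add_comm (inclL P _) (mulL P _ _), add_right_cancel_iff]
  apply Lp.ext
  filter_upwards [hQ, hAe, coeFn_toL2 (hB.memLp_sqInc huv), coeFn_inclL P A,
    Lp.coeFn_add (mulL P (∑ k ∈ Finset.range K, sqInc P B (s k) (s (k + 1))) (prodInc P B a b))
      (inclL P A), coeFn_mulL P (sqInc P B u v) (prodInc P B a b),
    coeFn_mulL P (∑ k ∈ Finset.range K, sqInc P B (s k) (s (k + 1))) (prodInc P B a b)]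
    with ω g1 g2 g3 g4 g5 g6 g7
  rw [g5, Pi.add_apply, g7, g4, g6, g1, g2, sqInc, g3]
  have e1 : B v ω - B u ω = ∑ k ∈ Finset.range K, (B (s (k + 1)) ω - B (s k) ω) := by
    rw [← h0, ← hK, sub_eq_sum (fun j => B (s j) ω) K.zero_le, Finset.range_eq_Ico]
  have e2 : v - u = ∑ k ∈ Finset.range K, (s (k + 1) - s k) := by
    rw [← h0, ← hK, sub_eq_sum s K.zero_le, Finset.range_eq_Ico]
  rw [e1, e2, sq, Finset.sum_mul_sum, Finset.sum_sub_distrib, sub_mul, sub_mul, sub_add_eq_add_sub,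
    sub_left_inj, Finset.sum_mul, Finset.sum_mul, ← Finset.sum_add_distrib]
  refine Finset.sum_congr rfl fun k hk => ?_
  rw [← Finset.add_sum_erase _ _ hk, add_mul, ← sq, Finset.sum_mul]
  congr 1
  exact Finset.sum_congr rfl fun l _ => by ring

/-- The multiple integral of a box one of whose sides is repeated. -/
theorem inclL_itoL_double {a b : Fin n → ℝ} (hab : OffDiag T a b) {u v : ℝ}
    (huv : 0 ≤ u ∧ u ≤ v ∧ v ≤ T) (hd : ∀ i, Disjoint (Set.Ioc (a i) (b i)) (Set.Ioc u v)) :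
    inclL P (itoL hT hB (n + 2) (tens T
      (snocF (snocF (fun i => ivl (a i) (b i)) (ivl u v)) (ivl u v)))) =
      mulL P (sqInc P B u v) (prodInc P B a b) := by
  set f : Fin n → ℝ → ℝ := fun i => ivl (a i) (b i)
  -- The error `Z` does not depend on a grid, while `double_sub_eq` expresses it by diagonal terms
  -- for each number `K` of cells.
  set Z := inclL P (itoL hT hB (n + 2) (tens T (snocF (snocF f (ivl u v)) (ivl u v)))) -
      mulL P (sqInc P B u v) (prodInc P B a b) with hZ
  set c₁ : ℝ := ‖inclL P‖ * √(n + 2).factorial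
  set c₂ : ℝ := ‖prodInc P B a b‖
  have hdiv : ∀ c : ℝ, ∀ K : ℕ, 0 < K →
      ∑ k ∈ Finset.range K, c * (uniformGrid u v K (k + 1) - uniformGrid u v K k) ^ 2 =
        c * (v - u) ^ 2 / K := by
    intro c K hK
    rw [Finset.sum_congr rfl fun k hk => by rw [uniformGrid_sub u v (Finset.mem_range.1 hk)]]
    have hK' : (K : ℝ) ≠ 0 := Nat.cast_ne_zero.2 hK.ne'
    simp only [Finset.sum_const, Finset.card_range, nsmul_eq_mul]
    field_simp
  -- Both diagonal terms have squared norm of order 1/K on the uniform grid.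
  have hbound : ∀ K : ℕ, 0 < K → ‖Z‖ ≤ c₁ * √(‖tens T f‖ ^ 2 * (v - u) ^ 2 / K) +
      √(normalSqVar * (v - u) ^ 2 / K) * c₂ := by
    intro K hK
    have hs := isGrid_uniformGrid huv hK
    have h1 := norm_diag_sq (T := T) (f := f) (fun i => bddMeas_ivl _ _) hs K
    have h2 := norm_sum_sqInc_sq hB hs K
    rw [hdiv _ K hK] at h1 h2
    rw [hZ, double_sub_eq hT hB hab huv hd hs (uniformGrid_zero u v K) (uniformGrid_self u v hK)]
    refine (norm_sub_le _ _).trans (add_le_add ?_ ?_)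
    · refine ((inclL P).le_opNorm _).trans ?_
      rw [← h1, Real.sqrt_sq (norm_nonneg _), mul_assoc]
      exact mul_le_mul_of_nonneg_left (norm_itoL_le hT hB _) (norm_nonneg _)
    · rw [← h2, Real.sqrt_sq (norm_nonneg _)]
      exact norm_mulL_le P _ _
  have hlim : Tendsto (fun K : ℕ => c₁ * √(‖tens T f‖ ^ 2 * (v - u) ^ 2 / K) +
      √(normalSqVar * (v - u) ^ 2 / K) * c₂) atTop (𝓝 0) := by
    have h0 : ∀ c : ℝ, Tendsto (fun K : ℕ => √(c / K)) atTop (𝓝 0) := fun c => by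
      simpa using (tendsto_const_div_atTop_nhds_zero_nat c).sqrt
    have := ((h0 (‖tens T f‖ ^ 2 * (v - u) ^ 2)).const_mul c₁).add
      ((h0 (normalSqVar * (v - u) ^ 2)).mul_const c₂)
    rwa [mul_zero, zero_mul, add_zero] at this
  have hle : ‖Z‖ ≤ 0 := ge_of_tendsto hlim ((eventually_gt_atTop 0).mono hbound)
  exact sub_eq_zero.1 (norm_le_zero_iff.1 hle)

end QuadVar

/-! ### The product of a multiple integral with a Wiener integral -/

section Product

variable {Ω : Type*} [MeasurableSpace Ω] {P : Measure Ω} [IsProbabilityMeasure P]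
  {T : ℝ} {B : ℝ → Ω → ℝ} {s : ℕ → ℝ} {n : ℕ} (hT : 0 < T) (hB : IsBrownianOn P T B)

theorem itoL_cellK (hs : IsGrid T s) {c : Fin n → ℕ} (hc : Function.Injective c) :
    itoL hT hB n (cellK T s c) = cellX P B s c := itoL_box hT hB (hs.offDiag hc)

theorem itoL_one_ivl {u v : ℝ} (huv : 0 ≤ u ∧ u ≤ v ∧ v ≤ T) :
    itoL hT hB 1 (kern1 T (ivl u v)) =ᵐ[P] fun ω => B v ω - B u ω := by
  have h : OffDiag T (fun _ : Fin 1 => u) fun _ => v :=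
    ⟨fun _ => huv, fun i j hij => absurd (Subsingleton.elim i j) hij⟩
  rw [kern1, itoL_box hT hB h]
  filter_upwards [coeFn_prodInc hB h.1] with ω hω
  simpa using hω

theorem cellX_eq_snoc (i : Fin (n + 1)) (c : Fin (n + 1) → ℕ) :
    prodInc P B (Fin.snoc (α := fun _ => ℝ) (fun j => s (c (i.succAbove j))) (s (c i)))
      (Fin.snoc (α := fun _ => ℝ) (fun j => s (c (i.succAbove j) + 1)) (s (c i + 1))) =
      cellX P B s c := by
  unfold cellX prodInc
  congr 1
  ext ω
  rw [Fin.prod_univ_castSucc, Fin.prod_univ_succAbove _ i, mul_comm]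
  simp

/-- The additional cell is disjoint from the others, so the enlarged box is still off-diagonal and
its integral is the product of increments. -/
theorem mulL_cells_of_notMem (hs : IsGrid T s) {c : Fin n → ℕ} (hc : Function.Injective c) {j : ℕ}
    (hj : ∀ i, c i ≠ j) :
    mulL P (itoL hT hB n (cellK T s c)) (itoL hT hB 1 (kern1 T (ivl (s j) (s (j + 1))))) =
      inclL P (itoL hT hB (n + 1) (tens T
        (snocF (fun i => ivl (s (c i)) (s (c i + 1))) (ivl (s j) (s (j + 1)))))) := by
  have hod := (hs.offDiag hc).snoc (hs.bounds j) fun i => hs.disjoint_cells (hj i)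
  have hbox := itoL_box hT hB hod
  rw [ivl_snoc] at hbox
  rw [hbox, itoL_cellK hT hB hs hc]
  apply Lp.ext
  filter_upwards [coeFn_mulL P (cellX P B s c) (itoL hT hB 1 (kern1 T (ivl (s j) (s (j + 1))))),
    itoL_one_ivl hT hB (hs.bounds j), coeFn_prodInc_snoc hB (hs.offDiag hc).1 (hs.bounds j),
    coeFn_inclL P (prodInc P B (Fin.snoc (α := fun _ => ℝ) (fun i => s (c i)) (s j))
      (Fin.snoc (α := fun _ => ℝ) (fun i => s (c i + 1)) (s (j + 1))))] with ω h1 h2 h3 h4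
  rw [h1, h2, h4, h3, cellX]

/-- By symmetry of the integral the repeated cell may be moved to the last place. The square of its
increment is the centred square, which is a double integral, plus the length of the cell, which is
the contraction. -/
theorem mulL_cells_self (hs : IsGrid T s) {c : Fin (n + 1) → ℕ} (hc : Function.Injective c)
    (i : Fin (n + 1)) :
    mulL P (itoL hT hB (n + 1) (cellK T s c))
      (itoL hT hB 1 (kern1 T (ivl (s (c i)) (s (c i + 1))))) =
      inclL P (itoL hT hB (n + 2) (tens T
        (snocF (fun k => ivl (s (c k)) (s (c k + 1))) (ivl (s (c i)) (s (c i + 1))))) +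
        (s (c i + 1) - s (c i)) • itoL hT hB n (cellK T s fun k => c (i.succAbove k))) := by
  have hc' : Function.Injective fun k => c (i.succAbove k) :=
    hc.comp Fin.succAbove_right_injective
  have hne : ∀ k, c (i.succAbove k) ≠ c i := fun k h => Fin.succAbove_ne i k (hc h)
  have hb : ∀ k, BddMeas (ivl (s (c k)) (s (c k + 1))) := fun k => bddMeas_ivl _ _
  rw [← itoL_tens_snoc_comp hT hB (lastTo i) hb (bddMeas_ivl _ _)]
  rw [comp_lastTo (fun k => ivl (s (c k)) (s (c k + 1))) i]
  rw [map_add, inclL_itoL_double hT hB (hs.offDiag hc') (hs.bounds (c i))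
    fun k => hs.disjoint_cells (hne k), itoL_cellK hT hB hs hc, itoL_cellK hT hB hs hc', map_smul]
  set R := cellX P B s fun k => c (i.succAbove k) with hR
  apply Lp.ext
  filter_upwards [coeFn_mulL P (cellX P B s c)
    (itoL hT hB 1 (kern1 T (ivl (s (c i)) (s (c i + 1))))),
    itoL_one_ivl hT hB (hs.bounds (c i)), coeFn_prodInc_snoc hB (hs.offDiag hc').1
    (hs.bounds (c i)), coeFn_inclL P R, coeFn_toL2 (hB.memLp_sqInc (hs.bounds (c i))),
    coeFn_mulL P (sqInc P B (s (c i)) (s (c i + 1))) R,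
    Lp.coeFn_add (mulL P (sqInc P B (s (c i)) (s (c i + 1))) R)
      ((s (c i + 1) - s (c i)) • inclL P R),
    Lp.coeFn_smul (s (c i + 1) - s (c i)) (inclL P R)] with ω h1 h2 h3 h4 h5 h6 h7 h8
  rw [cellX_eq_snoc i c] at h3
  rw [h1, h2, h3]
  refine Eq.trans ?_ h7.symm
  rw [Pi.add_apply, h8, h6, Pi.smul_apply, h4, sqInc, h5, smul_eq_mul]
  change R ω * _ * _ = _
  ring

/-- Injectivity of `c` leaves at most one nonzero contraction, so the cases of a new and of a
repeated cell combine into one formula. -/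
theorem mulL_cells (hs : IsGrid T s) {c : Fin n → ℕ} (hc : Function.Injective c) (j : ℕ) :
    mulL P (itoL hT hB n (cellK T s c)) (itoL hT hB 1 (cellK T s fun _ : Fin 1 => j)) =
      inclL P (itoL hT hB (n + 1) (tensorL T n 1 (cellK T s c) (cellK T s fun _ : Fin 1 => j)) +
        contrL hT hB n (cellK T s fun _ : Fin 1 => j) (cellK T s c)) := by
  have hb : ∀ k, BddMeas (ivl (s (c k)) (s (c k + 1))) := fun k => bddMeas_ivl _ _
  change mulL P _ (itoL hT hB 1 (kern1 T (ivl (s j) (s (j + 1))))) =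
    inclL P (itoL hT hB (n + 1) (tensorL T n 1 (tens T _) (kern1 T (ivl (s j) (s (j + 1))))) +
      contrL hT hB n (kern1 T (ivl (s j) (s (j + 1)))) (tens T _))
  rw [tensorL_kern1 hb (bddMeas_ivl _ _)]
  cases n with
  | zero =>
    rw [mulL_cells_of_notMem hT hB hs hc fun i => i.elim0]
    simp [contrL]
  | succ n =>
    rw [contrL_tens hT hB hb (bddMeas_ivl _ _)]
    simp only [integral_ivl_mul_ivl hs]
    by_cases hj : ∃ i, c i = j
    · obtain ⟨i, rfl⟩ := hj
      rw [mulL_cells_self hT hB hs hc i, Finset.sum_eq_single_of_mem i (Finset.mem_univ i),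
        if_pos rfl]
      · rfl
      · intro k _ hk
        rw [if_neg fun h => hk (hc h).symm, zero_smul]
    · push Not at hj
      rw [mulL_cells_of_notMem hT hB hs hc hj, Finset.sum_eq_zero, add_zero]
      intro k _
      rw [if_neg fun h => hj k h.symm, zero_smul]

/-- The product formula for a multiple integral and a Wiener integral. -/
theorem mulL_itoL_itoL_one (g : Kern T n) (φ : Kern T 1) :
    mulL P (itoL hT hB n g) (itoL hT hB 1 φ) =
      inclL P (itoL hT hB (n + 1) (tensorL T n 1 g φ) + contrL hT hB n φ g) := by
  let L₁ : Kern T n →L[ℝ] Kern T 1 →L[ℝ] Lp ℝ 1 P :=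
    (mulL P).bilinearComp (itoL hT hB n) (itoL hT hB 1)
  let L₂ : Kern T n →L[ℝ] Kern T 1 →L[ℝ] Lp ℝ 1 P :=
    (ContinuousLinearMap.compL ℝ _ _ _ (inclL P ∘L itoL hT hB (n + 1))).comp (tensorL T n 1) +
      ((ContinuousLinearMap.compL ℝ _ _ _ (inclL P)).comp (contrL hT hB n)).flip
  -- Two bounded bilinear maps that agree on boxes are equal, and boxes are sums of cells of a
  -- common grid.
  have key : L₁ = L₂ := by
    refine boxes_ext hT fun a b hab => boxes_ext hT fun a' b' hab' => ?_
    obtain ⟨s, N, hs, hsm, ⟨p, q, hpq, rfl, rfl⟩, ⟨p', q', hpq', rfl, rfl⟩⟩ :=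
      hab.exists_common_grid hT hab'
    rw [tens_ivl_eq_sum_cellK hs fun i => (hpq i).1, tens_ivl_eq_sum_cellK hs fun i => (hpq' i).1]
    simp only [map_sum, sum_apply]
    refine Finset.sum_congr rfl fun c hc => Finset.sum_congr rfl fun c' hc' => ?_
    have hinj := injective_of_mem_piFinset hsm (fun i => (hpq i).2) hab hs.mono ‹_›
    have hc1 : ∀ c : Fin 1 → ℕ, c = fun _ => c 0 := fun c => by
      ext i; rw [Subsingleton.elim i 0]
    rw [hc1 c]
    refine (mulL_cells hT hB hs hinj (c 0)).trans ?_
    exact map_add (inclL P) _ _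
  have := DFunLike.congr_fun (DFunLike.congr_fun key g) φ
  refine this.trans (map_add (inclL P) _ _).symm

end Product

/-! ### The algebra of Hermite type recursions -/

section Recursion

/-- The recursion satisfied by the normalized multiple integrals of `φ^{⊗p} ⊗ ψ^{⊗q}`, where `y` is
the Wiener integral of `ψ`, `d = ⟨ψ, ψ⟩` and `c = ⟨φ, ψ⟩`. -/
structure HermiteRec (y c d : ℝ) (v : ℕ → ℕ → ℝ) : Prop where
  zero_zero : v 0 0 = 1
  mul_eq : ∀ p q, y * v p q = (q + 1) * v p (q + 1) + (if q = 0 then 0 else d * v p (q - 1)) +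
    (if p = 0 then 0 else c * v (p - 1) q)

variable {y c d : ℝ} {v : ℕ → ℕ → ℝ}

/-- `v` at the indices lowered by `r`, and `0` at negative indices. -/
def lowered (v : ℕ → ℕ → ℝ) (r p q : ℕ) : ℝ := if r ≤ p ∧ r ≤ q then v (p - r) (q - r) else 0

/-- This is the recursion at (p - r, q - r). The extension by zero is compatible with it, and its
last term is one further lowering. -/
theorem HermiteRec.mul_lowered (h : HermiteRec y c d v) (r p q : ℕ) :
    y * lowered v r p q = ((q + 1) - r) * lowered v r p (q + 1) +
      (if q = 0 then 0 else d * lowered v r p (q - 1)) + c * lowered v (r + 1) p (q + 1) := by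
  by_cases hp : r ≤ p
  · by_cases hq : r ≤ q
    · obtain ⟨a, rfl⟩ := Nat.exists_eq_add_of_le hp
      obtain ⟨b, rfl⟩ := Nat.exists_eq_add_of_le hq
      have h1 : lowered v r (r + a) (r + b) = v a b := by simp [lowered]
      have h2 : lowered v r (r + a) (r + b + 1) = v a (b + 1) := by
        rw [lowered, if_pos (by omega)]; congr 1 <;> omega
      have h3 : (if r + b = 0 then 0 else d * lowered v r (r + a) (r + b - 1)) =
          if b = 0 then 0 else d * v a (b - 1) := by
        rcases Nat.eq_zero_or_pos b with rfl | hb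
        · simp only [if_true, lowered]; split_ifs <;> first | rfl | omega | simp
        · rw [if_neg (by omega), if_neg (by omega), lowered, if_pos (by omega)]
          congr 2 <;> omega
      have h4 : c * lowered v (r + 1) (r + a) (r + b + 1) = if a = 0 then 0 else c * v (a - 1) b := by
        rcases Nat.eq_zero_or_pos a with rfl | ha
        · simp [lowered]
        · rw [if_neg (by omega), lowered, if_pos (by omega)]
          congr 2 <;> omega
      rw [h1, h2, h3, h4, h.mul_eq]
      push_cast; ring
    · have h1 : lowered v r p q = 0 := if_neg (by omega)
      have h2 : lowered v (r + 1) p (q + 1) = 0 := if_neg (by omega)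
      have h3 : lowered v r p (q - 1) = 0 := if_neg (by omega)
      -- At `r = q + 1` the lowered value need not vanish, but its coefficient does.
      have h4 : (((q : ℝ) + 1) - r) * lowered v r p (q + 1) = 0 := by
        rcases eq_or_ne r (q + 1) with rfl | hne
        · push_cast; ring
        · rw [lowered, if_neg (by omega), mul_zero]
      rw [h1, h2, h3, h4]; simp
  · have h1 : ∀ q, lowered v r p q = 0 := fun q => if_neg (by omega)
    have h2 : ∀ q, lowered v (r + 1) p q = 0 := fun q => if_neg (by omega)
    simp [h1, h2]

/-- As functions of `q`, both sides satisfy the recursion of the sequence v(0, ·), which has no `c`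
term and determines the value at `q + 1` from those at `q` and `q - 1`. -/
theorem HermiteRec.mul_eq_sum_lowered (h : HermiteRec y c d v) (p q : ℕ) :
    v p 0 * v 0 q = ∑ r ∈ Finset.range (p + 1), c ^ r / r.factorial * lowered v r p q := by
  have step : ∀ q, v p 0 * v 0 q =
      ∑ r ∈ Finset.range (p + 1), c ^ r / r.factorial * lowered v r p q →
      (q ≠ 0 → v p 0 * v 0 (q - 1) =
        ∑ r ∈ Finset.range (p + 1), c ^ r / r.factorial * lowered v r p (q - 1)) →
      v p 0 * v 0 (q + 1) =
        ∑ r ∈ Finset.range (p + 1), c ^ r / r.factorial * lowered v r p (q + 1) := by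
    intro q h1 h2
    have h0 := h.mul_eq 0 q
    rw [if_pos rfl, add_zero] at h0
    -- Shifting `r` by one gives the `c` terms the factor `r`, which turns the coefficient `q + 1 -
    -- r` into `q + 1`, free of `r`.
    have hs : ∑ r ∈ Finset.range (p + 1), c ^ (r + 1) / r.factorial * lowered v (r + 1) p (q + 1) =
        ∑ r ∈ Finset.range (p + 1), r * (c ^ r / r.factorial * lowered v r p (q + 1)) := by
      have hz : lowered v (p + 1) p (q + 1) = 0 := if_neg (by omega)
      have e := Finset.sum_range_succ'
        (fun r : ℕ => r * (c ^ r / r.factorial * lowered v r p (q + 1))) (p + 1)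
      rw [Finset.sum_range_succ, hz] at e
      simp only [mul_zero, add_zero, Nat.cast_zero, zero_mul] at e
      rw [e]
      refine Finset.sum_congr rfl fun r _ => ?_
      rw [Nat.factorial_succ]
      have : (r.factorial : ℝ) ≠ 0 := by positivity
      push_cast
      field_simp
    have hmain : ((q : ℝ) + 1) * ∑ r ∈ Finset.range (p + 1),
        c ^ r / r.factorial * lowered v r p (q + 1) =
        y * (∑ r ∈ Finset.range (p + 1), c ^ r / r.factorial * lowered v r p q) -
        ∑ r ∈ Finset.range (p + 1), c ^ r / r.factorial *
          (if q = 0 then 0 else d * lowered v r p (q - 1)) := by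
      rw [Finset.mul_sum, Finset.mul_sum, ← Finset.sum_sub_distrib]
      have e : ∀ r ∈ Finset.range (p + 1), y * (c ^ r / r.factorial * lowered v r p q) -
          c ^ r / r.factorial * (if q = 0 then 0 else d * lowered v r p (q - 1)) =
          (((q : ℝ) + 1) * (c ^ r / r.factorial * lowered v r p (q + 1)) -
          r * (c ^ r / r.factorial * lowered v r p (q + 1))) +
          c ^ (r + 1) / r.factorial * lowered v (r + 1) p (q + 1) := by
        intro r _
        rw [mul_left_comm, h.mul_lowered r p q, pow_succ]
        ring
      rw [Finset.sum_congr rfl e, Finset.sum_add_distrib, Finset.sum_sub_distrib, hs]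
      ring
    have hq : ((q : ℝ) + 1) ≠ 0 := by positivity
    apply mul_left_cancel₀ hq
    rw [hmain, ← h1]
    rcases Nat.eq_zero_or_pos q with rfl | hq'
    · simp only [if_true, mul_zero, Finset.sum_const_zero, sub_zero]
      simp only [if_true] at h0
      linear_combination (-v p 0) * h0
    · simp only [if_neg hq'.ne'] at h0 ⊢
      have h3 := h2 hq'.ne'
      simp_rw [mul_left_comm _ d]
      rw [← Finset.mul_sum, ← h3]
      linear_combination (-v p 0) * h0
  -- The recursion has second order, hence the induction carries two consecutive values.
  have hboth : ∀ q, (v p 0 * v 0 q =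
      ∑ r ∈ Finset.range (p + 1), c ^ r / r.factorial * lowered v r p q) ∧
      v p 0 * v 0 (q + 1) =
      ∑ r ∈ Finset.range (p + 1), c ^ r / r.factorial * lowered v r p (q + 1) := by
    intro q
    induction q with
    | zero =>
      have h0 : v p 0 * v 0 0 =
          ∑ r ∈ Finset.range (p + 1), c ^ r / r.factorial * lowered v r p 0 := by
        rw [Finset.sum_eq_single_of_mem 0 (by simp)]
        · simp [lowered, h.zero_zero]
        · intro r _ hr
          rw [lowered, if_neg (by omega), mul_zero]
      exact ⟨h0, step 0 h0 fun h => absurd rfl h⟩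
    | succ q ih => exact ⟨ih.2, step (q + 1) ih.2 fun _ => ih.1⟩
  exact (hboth q).1

theorem sum_lowered_eq (a : ℕ → ℝ) (p q : ℕ) :
    ∑ r ∈ Finset.range (p + 1), a r * lowered v r p q =
      ∑ r ∈ Finset.range (min p q + 1), a r * v (p - r) (q - r) := by
  have hsub : Finset.range (min p q + 1) ⊆ Finset.range (p + 1) := by
    intro r; simp only [Finset.mem_range]; omega
  rw [← Finset.sum_subset hsub]
  · refine Finset.sum_congr rfl fun r hr => ?_
    have := Finset.mem_range.1 hr
    rw [lowered, if_pos (by omega)]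
  · intro r _ hr
    rw [Finset.mem_range] at hr
    rw [lowered, if_neg (by omega), mul_zero]

/-- The binomial theorem for (c + c)^N: here the powers of 2 of the main formula arise. -/
theorem sum_antidiagonal_pow_div_factorial (c : ℝ) (N : ℕ) :
    ∑ x ∈ Finset.HasAntidiagonal.antidiagonal N, c ^ x.1 / x.1.factorial * (c ^ x.2 / x.2.factorial) =
      (2 * c) ^ N / N.factorial := by
  rw [two_mul, add_pow, Finset.Nat.sum_antidiagonal_eq_sum_range_succ
    (fun i j => c ^ i / i.factorial * (c ^ j / j.factorial)), Finset.sum_div]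
  refine Finset.sum_congr rfl fun k hk => ?_
  rw [Nat.cast_choose ℝ (Nat.lt_succ_iff.1 (Finset.mem_range.1 hk))]
  have h1 : (N.factorial : ℝ) ≠ 0 := by positivity
  have h2 : (k.factorial : ℝ) ≠ 0 := by positivity
  have h3 : ((N - k).factorial : ℝ) ≠ 0 := by positivity
  field_simp

/-- The identity e^{cL} e^{cL} = e^{2cL}. With the product formula inserted, lowering by k and then
by r is lowering by k + r, and the coefficients are collected along N = k + r. -/
theorem HermiteRec.sum_mul_eq (h : HermiteRec y c d v) (p q : ℕ) :
    ∑ k ∈ Finset.range (min p q + 1), c ^ k / k.factorial * (v (p - k) 0 * v 0 (q - k)) =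
      ∑ k ∈ Finset.range (min p q + 1), (2 * c) ^ k / k.factorial * v (p - k) (q - k) := by
  simp_rw [h.mul_eq_sum_lowered, sum_lowered_eq, Finset.mul_sum]
  simp_rw [← sum_antidiagonal_pow_div_factorial, Finset.sum_mul]
  rw [Finset.sum_sigma', Finset.sum_sigma']
  refine Finset.sum_bij' (fun x _ => ⟨x.1 + x.2, (x.1, x.2)⟩) (fun x _ => ⟨x.2.1, x.2.2⟩)
    ?_ ?_ ?_ ?_ ?_
  · rintro ⟨k, r⟩ hx
    simp only [Finset.mem_sigma, Finset.mem_range,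
      Finset.HasAntidiagonal.mem_antidiagonal, Nat.lt_succ_iff, le_min_iff] at hx ⊢
    obtain ⟨⟨h1, h2⟩, h3, h4⟩ := hx
    have h5 := Nat.add_le_of_le_sub' h1 h3
    have h6 := Nat.add_le_of_le_sub' h2 h4
    exact ⟨⟨h5, h6⟩, trivial⟩
  · rintro ⟨N, k, r⟩ hx
    simp only [Finset.mem_sigma, Finset.mem_range,
      Finset.HasAntidiagonal.mem_antidiagonal, Nat.lt_succ_iff, le_min_iff] at hx ⊢
    omega
  · rintro ⟨k, r⟩ _; rfl
  · rintro ⟨N, k, r⟩ hx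
    simp only [Finset.mem_sigma, Finset.mem_range,
      Finset.HasAntidiagonal.mem_antidiagonal] at hx ⊢
    obtain ⟨_, rfl⟩ := hx
    rfl
  · rintro ⟨k, r⟩ _
    simp only [Nat.sub_sub]
    ring

end Recursion

/-! ### Powers of functions of one variable -/

section Powers

variable {Ω : Type*} [MeasurableSpace Ω] {P : Measure Ω} [IsProbabilityMeasure P]
  {T : ℝ} {B : ℝ → Ω → ℝ} {n : ℕ} (hT : 0 < T) (hB : IsBrownianOn P T B) {φ ψ : ℝ → ℝ}

/-- The first `p` functions are `φ`, the others are `ψ`. -/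
def blockF (φ ψ : ℝ → ℝ) (p n : ℕ) : Fin n → ℝ → ℝ := fun i => if i.val < p then φ else ψ

theorem bddMeas_blockF (hφ : BddMeas φ) (hψ : BddMeas ψ) (p : ℕ) (i : Fin n) :
    BddMeas (blockF φ ψ p n i) := by
  unfold blockF; split_ifs <;> assumption

/-- The multiple integral of `φ^{⊗p} ⊗ ψ^{⊗(n-p)}`. -/
def blockI (φ ψ : ℝ → ℝ) (p n : ℕ) : Lp ℝ 2 P := itoL hT hB n (tens T (blockF φ ψ p n))

theorem snocF_blockF {p : ℕ} (hp : p ≤ n) : snocF (blockF φ ψ p n) ψ = blockF φ ψ p (n + 1) := by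
  ext i : 1
  refine Fin.lastCases ?_ (fun i => ?_) i
  · simp [blockF, hp]
  · simp [blockF]

theorem sum_fin_ite {E : Type*} [AddCommGroup E] [Module ℝ E] {p : ℕ} (hp : p ≤ n) (A D : E) :
    ∑ i : Fin n, (if i.val < p then A else D) = (p : ℝ) • A + ((n : ℝ) - p) • D := by
  rw [Fin.sum_univ_eq_sum_range (fun i => if i < p then A else D) n, Finset.range_eq_Ico,
    ← Finset.sum_Ico_consecutive _ (Nat.zero_le p) hp,
    Finset.sum_congr rfl (g := fun _ => A) fun i hi => if_pos (Finset.mem_Ico.1 hi).2,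
    Finset.sum_congr (s₁ := Finset.Ico p n) rfl (g := fun _ => D) fun i hi => if_neg
      (not_lt.2 (Finset.mem_Ico.1 hi).1)]
  simp only [Finset.sum_const, Nat.card_Ico, ← Nat.cast_smul_eq_nsmul ℝ, Nat.sub_zero]
  rw [Nat.cast_sub hp]

/-- The contraction of ψ meets one of the `p` factors φ or one of the `n + 1 - p` factors ψ. Where
`p - 1` is truncated, or the second block would be too short, the coefficient is zero. -/
theorem mulL_blockI_succ (hφ : BddMeas φ) (hψ : BddMeas ψ) {p : ℕ} (hp : p ≤ n + 1) :
    mulL P (blockI hT hB φ ψ p (n + 1)) (itoL hT hB 1 (kern1 T ψ)) =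
      inclL P (blockI hT hB φ ψ p (n + 2) +
        ((p * ∫ x, φ x * ψ x ∂(itvMeasure T)) • blockI hT hB φ ψ (p - 1) n +
        (((n : ℝ) + 1 - p) * ∫ x, ψ x * ψ x ∂(itvMeasure T)) • blockI hT hB φ ψ p n)) := by
  rw [blockI, mulL_itoL_itoL_one, tensorL_kern1 (bddMeas_blockF hφ hψ p) hψ, snocF_blockF hp,
    contrL_tens hT hB (bddMeas_blockF hφ hψ p) hψ]
  congr 2
  have hterm : ∀ i : Fin (n + 1), (∫ x, ψ x * blockF φ ψ p (n + 1) i x ∂(itvMeasure T)) •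
      itoL hT hB n (tens T fun j => blockF φ ψ p (n + 1) (i.succAbove j)) =
      if i.val < p then (∫ x, φ x * ψ x ∂(itvMeasure T)) • blockI hT hB φ ψ (p - 1) n else
        (∫ x, ψ x * ψ x ∂(itvMeasure T)) • blockI hT hB φ ψ p n := by
    intro i
    split_ifs with hi
    · have h1 : blockF φ ψ p (n + 1) i = φ := if_pos hi
      have h2 : (fun j => blockF φ ψ p (n + 1) (i.succAbove j)) = blockF φ ψ (p - 1) n := by
        ext j : 1
        simp only [blockF, Fin.succAbove, Fin.lt_def, Fin.val_castSucc]
        split_ifs <;> simp_all <;> omega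
      rw [h1, h2, blockI]
      simp_rw [mul_comm (ψ _)]
    · have h1 : blockF φ ψ p (n + 1) i = ψ := if_neg hi
      have h2 : (fun j => blockF φ ψ p (n + 1) (i.succAbove j)) = blockF φ ψ p n := by
        ext j : 1
        simp only [blockF, Fin.succAbove, Fin.lt_def, Fin.val_castSucc]
        split_ifs <;> simp_all <;> omega
      rw [h1, h2, blockI]
  rw [Finset.sum_congr rfl fun i _ => hterm i, sum_fin_ite hp, smul_smul, smul_smul]
  push_cast
  rfl

theorem blockI_zero_zero : blockI hT hB φ ψ 0 0 =ᵐ[P] fun _ => 1 := by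
  have h : OffDiag T (fun i : Fin 0 => (0 : ℝ)) fun _ => 0 := ⟨fun i => i.elim0, fun i => i.elim0⟩
  have hb : blockF φ ψ 0 0 = fun i : Fin 0 => ivl 0 0 := Subsingleton.elim _ _
  rw [blockI, hb, itoL_box hT hB h]
  filter_upwards [coeFn_prodInc hB h.1] with ω hω
  simpa using hω

theorem mulL_blockI_zero (hφ : BddMeas φ) (hψ : BddMeas ψ) :
    mulL P (blockI hT hB φ ψ 0 0) (itoL hT hB 1 (kern1 T ψ)) = inclL P (blockI hT hB φ ψ 0 1) := by
  rw [blockI, mulL_itoL_itoL_one, tensorL_kern1 (bddMeas_blockF hφ hψ 0) hψ, snocF_blockF le_rfl]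
  simp [contrL, blockI]

/-- The product formula divided by p! q!. There are countably many pairs (p, q), so a single null
set serves for all of them and the recursion can be used pointwise in ω. -/
theorem ae_hermiteRec (hφ : BddMeas φ) (hψ : BddMeas ψ) : ∀ᵐ ω ∂P,
    HermiteRec (itoL hT hB 1 (kern1 T ψ) ω) (∫ x, φ x * ψ x ∂(itvMeasure T))
      (∫ x, ψ x * ψ x ∂(itvMeasure T)) fun p q =>
        blockI hT hB φ ψ p (p + q) ω / (p.factorial * q.factorial) := by
  set y := itoL hT hB 1 (kern1 T ψ) with hy
  set c := ∫ x, φ x * ψ x ∂(itvMeasure T)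
  set d := ∫ x, ψ x * ψ x ∂(itvMeasure T)
  have hrec : ∀ᵐ ω ∂P, ∀ n p : ℕ, p ≤ n + 1 → blockI hT hB φ ψ p (n + 1) ω * y ω =
      blockI hT hB φ ψ p (n + 2) ω + ((p * c) * blockI hT hB φ ψ (p - 1) n ω +
        (((n : ℝ) + 1 - p) * d) * blockI hT hB φ ψ p n ω) := by
    rw [ae_all_iff]; intro n
    rw [ae_all_iff]; intro p
    by_cases hp : p ≤ n + 1
    · have h := mulL_blockI_succ hT hB hφ hψ hp
      rw [← hy] at h
      have h1 := coeFn_mulL P (blockI hT hB φ ψ p (n + 1)) y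
      rw [h] at h1
      filter_upwards [h1, coeFn_inclL P (blockI hT hB φ ψ p (n + 2) +
        ((p * c) • blockI hT hB φ ψ (p - 1) n + (((n : ℝ) + 1 - p) * d) • blockI hT hB φ ψ p n)),
        Lp.coeFn_add (blockI hT hB φ ψ p (n + 2)) ((p * c) • blockI hT hB φ ψ (p - 1) n +
          (((n : ℝ) + 1 - p) * d) • blockI hT hB φ ψ p n),
        Lp.coeFn_add ((p * c) • blockI hT hB φ ψ (p - 1) n)
          ((((n : ℝ) + 1 - p) * d) • blockI hT hB φ ψ p n),
        Lp.coeFn_smul (p * c) (blockI hT hB φ ψ (p - 1) n),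
        Lp.coeFn_smul (((n : ℝ) + 1 - p) * d) (blockI hT hB φ ψ p n)]
        with ω g1 g2 g3 g4 g5 g6 _
      rw [← g1, g2, g3, Pi.add_apply, g4, Pi.add_apply, g5, g6]
      rfl
    · exact Eventually.of_forall fun ω h => absurd h hp
  have hz : ∀ᵐ ω ∂P, blockI hT hB φ ψ 0 0 ω * y ω = blockI hT hB φ ψ 0 1 ω := by
    have h1 := coeFn_mulL P (blockI hT hB φ ψ 0 0) y
    rw [hy, mulL_blockI_zero hT hB hφ hψ] at h1
    filter_upwards [h1, coeFn_inclL P (blockI hT hB φ ψ 0 1)] with ω g1 g2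
    rw [← g2, g1]
  filter_upwards [hrec, hz, blockI_zero_zero hT hB (φ := φ) (ψ := ψ)] with ω g1 g2 g3
  refine ⟨by simp [g3], fun p q => ?_⟩
  have hpf : (p.factorial : ℝ) ≠ 0 := by positivity
  have hqf : (q.factorial : ℝ) ≠ 0 := by positivity
  rcases p with _ | p
  · rcases q with _ | q
    · simp only [if_true, add_zero, zero_add, Nat.factorial]
      rw [← g2]; simp; ring
    · have e := g1 q 0 (Nat.zero_le _)
      have hq2 : (q.factorial : ℝ) ≠ 0 := by positivity
      simp only [zero_add, if_true, add_zero, if_neg (Nat.succ_ne_zero q), Nat.add_sub_cancel] at *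
      rw [mul_comm, div_mul_eq_mul_div, e, Nat.factorial_succ (q + 1), Nat.factorial_succ q]
      push_cast
      field_simp
      ring
  · rcases q with _ | q
    · have e := g1 p (p + 1) le_rfl
      have hp2 : (p.factorial : ℝ) ≠ 0 := by positivity
      simp only [zero_add, if_true, add_zero, if_neg (Nat.succ_ne_zero p), Nat.add_sub_cancel] at *
      rw [mul_comm, div_mul_eq_mul_div, e, Nat.factorial_succ p]
      push_cast
      field_simp
      ring
    · have e := g1 (p + 1 + q) (p + 1) (by omega)
      have hp2 : (p.factorial : ℝ) ≠ 0 := by positivity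
      have hq2 : (q.factorial : ℝ) ≠ 0 := by positivity
      simp only [if_neg (Nat.succ_ne_zero p), if_neg (Nat.succ_ne_zero q),
        Nat.add_sub_cancel] at *
      have i1 : p + 1 + (q + 1) = p + 1 + q + 1 := rfl
      have i2 : p + 1 + (q + 1 + 1) = p + 1 + q + 2 := rfl
      have i3 : p + (q + 1) = p + 1 + q := by omega
      rw [i1, i2, i3, mul_comm, div_mul_eq_mul_div, e, Nat.factorial_succ (q + 1),
        Nat.factorial_succ q, Nat.factorial_succ p]
      push_cast
      field_simp
      ring

end Powers

/-! ### Powers are total among the symmetric kernels -/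

section Polarization

variable {T : ℝ} {n : ℕ}

/-- Inclusion-exclusion: the signs of the sets containing the range of `c` cancel unless the range
is everything. -/
theorem sum_neg_one_pow_card_of_forall_mem (c : Fin n → Fin n) :
    ∑ S : Finset (Fin n), (if ∀ i, c i ∈ S then (-1 : ℝ) ^ (n + S.card) else 0) =
      if Function.Bijective c then 1 else 0 := by
  classical
  split_ifs with hc
  · rw [Finset.sum_eq_single Finset.univ]
    · rw [if_pos fun i => Finset.mem_univ _, Finset.card_univ, Fintype.card_fin]
      exact Even.neg_one_pow ⟨n, rfl⟩
    · intro S _ hS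
      refine if_neg fun h => hS (Finset.eq_univ_iff_forall.2 fun j => ?_)
      obtain ⟨i, rfl⟩ := hc.2 j
      exact h i
    · exact fun h => absurd (Finset.mem_univ _) h
  · have : ¬ Function.Surjective c := fun h => hc (Finite.surjective_iff_bijective.1 h)
    simp only [Function.Surjective, not_forall, not_exists] at this
    obtain ⟨j, hj⟩ := this
    have hiff : ∀ S : Finset (Fin n), (∀ i, c i ∈ if j ∈ S then S.erase j else insert j S) ↔
        ∀ i, c i ∈ S := by
      intro S
      refine forall_congr' fun i => ?_
      split_ifs
      · simp [hj i]
      · simp [hj i]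
    have hsign : ∀ S : Finset (Fin n), (-1 : ℝ) ^ (n + S.card) +
        (-1 : ℝ) ^ (n + (if j ∈ S then S.erase j else insert j S).card) = 0 := by
      intro S
      split_ifs with h
      · have := Finset.card_erase_add_one h
        rw [← this, ← add_assoc, pow_succ]; ring
      · rw [Finset.card_insert_of_notMem h, ← add_assoc, pow_succ]; ring
    -- Inserting or removing a point `j` missed by `c` reverses the sign and keeps the condition.
    refine Finset.sum_involution (fun S _ => if j ∈ S then S.erase j else insert j S) ?_ ?_ ?_ ?_
    · intro S _
      simp only [hiff]
      by_cases h : ∀ i, c i ∈ S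
      · rw [if_pos h, if_pos h]
        exact hsign S
      · rw [if_neg h, if_neg h, add_zero]
    · intro S _ _
      split_ifs with h
      · exact fun h' => Finset.notMem_erase j S (h'.symm ▸ h)
      · exact fun h' => h (h' ▸ Finset.mem_insert_self j S)
    · exact fun S _ => Finset.mem_univ _
    · intro S _
      by_cases h : j ∈ S <;> simp [h]

/-- The polarization identity for tensor products of functions. -/
theorem sum_permK_tens {f : Fin n → ℝ → ℝ} (hf : ∀ i, BddMeas (f i)) :
    ∑ σ : Equiv.Perm (Fin n), permK σ (tens T f) =
      ∑ S : Finset (Fin n), (-1 : ℝ) ^ (n + S.card) •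
        tens T (fun _ : Fin n => fun x => ∑ j ∈ S, f j x) := by
  classical
  have h1 : ∀ S : Finset (Fin n), (-1 : ℝ) ^ (n + S.card) •
      tens T (fun _ : Fin n => fun x => ∑ j ∈ S, f j x) = ∑ c : Fin n → Fin n,
        (if ∀ i, c i ∈ S then (-1 : ℝ) ^ (n + S.card) else 0) • tens T fun i => f (c i) := by
    intro S
    rw [tens_sum (fun _ => S) fun _ j => hf j, Finset.smul_sum]
    simp_rw [ite_smul, zero_smul]
    rw [← Finset.sum_filter]
    refine Finset.sum_congr ?_ fun _ _ => rfl
    ext c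
    simp
  simp_rw [h1]
  rw [Finset.sum_comm]
  simp_rw [← Finset.sum_smul, sum_neg_one_pow_card_of_forall_mem, ite_smul, one_smul, zero_smul]
  rw [← Finset.sum_filter, ← Equiv.sum_comp (Equiv.inv _)]
  refine Finset.sum_bij (fun σ _ => ⇑σ) (fun σ _ => Finset.mem_filter.2 ⟨Finset.mem_univ _, σ.bijective⟩)
    (fun σ _ τ _ h => DFunLike.coe_injective h) (fun c hc => ?_) fun σ _ => ?_
  · exact ⟨Equiv.ofBijective c (Finset.mem_filter.1 hc).2, Finset.mem_univ _, rfl⟩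
  · rw [permK_tens _ hf]
    rfl

/-- A bounded operator that vanishes on all powers vanishes on the symmetric kernels. -/
theorem eq_zero_of_pow (hT : 0 < T) {F : Type*} [NormedAddCommGroup F] [NormedSpace ℝ F]
    (L : Kern T n →L[ℝ] F) (hL : ∀ φ, BddMeas φ → L (tens T fun _ => φ) = 0) {h : Kern T n}
    (hh : IsSymmKern h) : L h = 0 := by
  -- By polarization a symmetrized box is a combination of powers, so `L` vanishes after
  -- symmetrization. On symmetric kernels symmetrization is multiplication by n!.
  have h0 : L.comp (∑ σ : Equiv.Perm (Fin n), (permK σ).toContinuousLinearMap) = 0 := by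
    refine boxes_ext hT fun a b _ => ?_
    have hb : ∀ i, BddMeas (ivl (a i) (b i)) := fun i => bddMeas_ivl _ _
    change L ((∑ σ : Equiv.Perm (Fin n), (permK σ).toContinuousLinearMap) _) = 0
    rw [sum_apply]
    change L (∑ σ : Equiv.Perm (Fin n), permK σ _) = 0
    rw [sum_permK_tens hb, map_sum]
    refine Finset.sum_eq_zero fun S _ => ?_
    rw [map_smul, hL _ (BddMeas.sum S fun j _ => hb j), smul_zero]
  have h1 := DFunLike.congr_fun h0 h
  change L ((∑ σ : Equiv.Perm (Fin n), (permK σ).toContinuousLinearMap) h) = 0 at h1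
  rw [sum_apply] at h1
  change L (∑ σ : Equiv.Perm (Fin n), permK σ h) = 0 at h1
  simp_rw [isSymmKern_iff.1 hh] at h1
  rw [Finset.sum_const, Finset.card_univ, Fintype.card_perm, Fintype.card_fin,
    ← Nat.cast_smul_eq_nsmul ℝ, map_smul] at h1
  exact (smul_eq_zero.1 h1).resolve_left (by positivity)

end Polarization

/-! ### Pairing of the slices of two kernels -/

section Pairing

variable {T : ℝ} {p q : ℕ} {G : Type*} [NormedAddCommGroup G] [NormedSpace ℝ G]

/-- The function `t ↦ b(h(·, t), g(·, t))` of `k` variables. -/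
def pairL (k : ℕ) (b : Kern T p →L[ℝ] Kern T q →L[ℝ] G) :
    Kern T (p + k) →L[ℝ] Kern T (q + k) →L[ℝ] Lp G 1 (cubeMeasure T k) :=
  (b.holderL (cubeMeasure T k) 2 2 1).bilinearComp (sliceL T p k).toContinuousLinearMap
    (sliceL T q k).toContinuousLinearMap

theorem coeFn_pairL (k : ℕ) (b : Kern T p →L[ℝ] Kern T q →L[ℝ] G) (h : Kern T (p + k))
    (g : Kern T (q + k)) :
    pairL k b h g =ᵐ[cubeMeasure T k] fun t => b (sliceFun h t) (sliceFun g t) := by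
  filter_upwards [b.coeFn_holder (r := 1) (sliceL T p k h) (sliceL T q k g), coeFn_sliceL h,
    coeFn_sliceL g] with t h1 h2 h3
  rw [← h2, ← h3, ← h1]
  rfl

theorem norm_pairL_le (k : ℕ) (b : Kern T p →L[ℝ] Kern T q →L[ℝ] G) (h : Kern T (p + k))
    (g : Kern T (q + k)) : ‖pairL k b h g‖ ≤ ‖b‖ * ‖h‖ * ‖g‖ := by
  have := b.norm_holder_apply_apply_le (r := 1) (sliceL T p k h) (sliceL T q k g)
  rwa [LinearIsometry.norm_map, LinearIsometry.norm_map] at this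

variable [CompleteSpace G]

/-- The integral `∫ b(h(·, t), g(·, t)) dt`. -/
def pairInt (k : ℕ) (b : Kern T p →L[ℝ] Kern T q →L[ℝ] G) :
    Kern T (p + k) →L[ℝ] Kern T (q + k) →L[ℝ] G :=
  (ContinuousLinearMap.compL ℝ _ _ _ (L1.integralCLM' ℝ)).comp (pairL k b)

theorem pairInt_eq_integral (k : ℕ) (b : Kern T p →L[ℝ] Kern T q →L[ℝ] G) (h : Kern T (p + k))
    (g : Kern T (q + k)) : pairInt k b h g = ∫ t, pairL k b h g t ∂(cubeMeasure T k) := by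
  rw [← L1.integral_eq_integral, L1.integral_eq' (𝕜 := ℝ)]
  rfl

theorem pairInt_eq_integral_slices (k : ℕ) (b : Kern T p →L[ℝ] Kern T q →L[ℝ] G)
    (h : Kern T (p + k)) (g : Kern T (q + k)) :
    pairInt k b h g = ∫ t, b (sliceFun h t) (sliceFun g t) ∂(cubeMeasure T k) := by
  rw [pairInt_eq_integral]
  exact integral_congr_ae (coeFn_pairL k b h g)

theorem append_const {α : Type*} (m k : ℕ) (x : α) :
    Fin.append (fun _ : Fin m => x) (fun _ : Fin k => x) = fun _ => x := by
  ext i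
  refine Fin.addCases (fun i => ?_) (fun i => ?_) i <;> simp

/-- A slice of a power is a scalar times a lower power, and the integral of the scalars over the
cube factorizes. -/
theorem pairInt_pow (k : ℕ) (b : Kern T p →L[ℝ] Kern T q →L[ℝ] G) {φ ψ : ℝ → ℝ}
    (hφ : BddMeas φ) (hψ : BddMeas ψ) :
    pairInt k b (tens T fun _ => φ) (tens T fun _ => ψ) =
      (∫ x, φ x * ψ x ∂(itvMeasure T)) ^ k • b (tens T fun _ => φ) (tens T fun _ => ψ) := by
  have h1 := sliceL_tens (T := T) (f := fun _ : Fin p => φ) (g := fun _ : Fin k => φ)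
    (fun _ => hφ) fun _ => hφ
  have h2 := sliceL_tens (T := T) (f := fun _ : Fin q => ψ) (g := fun _ : Fin k => ψ)
    (fun _ => hψ) fun _ => hψ
  rw [append_const] at h1 h2
  rw [pairInt_eq_integral_slices]
  have h3 : ∫ t, b (sliceFun (tens T fun _ : Fin (p + k) => φ) t)
      (sliceFun (tens T fun _ : Fin (q + k) => ψ) t) ∂(cubeMeasure T k) =
      ∫ t, (∏ i, (fun _ x => φ x * ψ x) i (t i)) • b (tens T fun _ => φ) (tens T fun _ => ψ)
        ∂(cubeMeasure T k) := by
    refine integral_congr_ae ?_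
    filter_upwards [h1, h2, coeFn_sliceL (tens T fun _ : Fin (p + k) => φ),
      coeFn_sliceL (tens T fun _ : Fin (q + k) => ψ)] with t e1 e2 e3 e4
    rw [← e3, ← e4, e1, e2]
    simp only [map_smul, smul_apply, smul_smul, Finset.prod_mul_distrib]
    rw [mul_comm]
  rw [h3, integral_smul_const]
  congr 1
  rw [cubeMeasure, integral_fintype_prod_eq_prod (μ := fun _ => itvMeasure T)
    fun (_ : Fin k) x => φ x * ψ x]
  simp

end Pairing

/-! ### The identity for two multiple integrals -/

section SingleChaos

variable {Ω : Type*} [MeasurableSpace Ω] {P : Measure Ω} [IsProbabilityMeasure P]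
  {T : ℝ} {B : ℝ → Ω → ℝ} (hT : 0 < T) (hB : IsBrownianOn P T B)

/-- The product of two multiple integrals. -/
def prodB (p q : ℕ) : Kern T p →L[ℝ] Kern T q →L[ℝ] Lp ℝ 1 P :=
  (mulL P).bilinearComp (itoL hT hB p) (itoL hT hB q)

/-- The Wick product of two multiple integrals. -/
def wickB (p q : ℕ) : Kern T p →L[ℝ] Kern T q →L[ℝ] Lp ℝ 2 P :=
  (ContinuousLinearMap.compL ℝ _ _ _ (itoL hT hB (p + q))).comp (tensorL T p q)

theorem prodB_apply {p q : ℕ} (f : Kern T p) (g : Kern T q) :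
    prodB hT hB p q f g = mulL P (itoL hT hB p f) (itoL hT hB q g) := rfl

theorem wickB_apply {p q : ℕ} (f : Kern T p) (g : Kern T q) :
    wickB hT hB p q f g = itoL hT hB (p + q) (tensorL T p q f g) := rfl

theorem prodB_pow {φ ψ : ℝ → ℝ} (p q : ℕ) :
    prodB hT hB p q (tens T fun _ => φ) (tens T fun _ => ψ) =
      mulL P (blockI hT hB φ ψ p p) (blockI hT hB φ ψ 0 q) := by
  have h1 : blockF φ ψ p p = fun _ => φ := by ext i : 1; exact if_pos i.2
  have h2 : blockF φ ψ 0 q = fun _ => ψ := by ext i : 1; exact if_neg (Nat.not_lt_zero _)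
  rw [prodB_apply, blockI, blockI, h1, h2]

theorem wickB_pow {φ ψ : ℝ → ℝ} (hφ : BddMeas φ) (hψ : BddMeas ψ) (p q : ℕ) :
    wickB hT hB p q (tens T fun _ => φ) (tens T fun _ => ψ) = blockI hT hB φ ψ p (p + q) := by
  rw [wickB_apply, tensorL_tens (fun _ => hφ) fun _ => hψ, blockI]
  congr 2
  ext i : 1
  refine Fin.addCases (fun i => ?_) (fun i => ?_) i <;> simp [blockF]

/-- On powers every pairing produces a factor c^k, and pointwise in ω the claim becomes
`HermiteRec.sum_mul_eq`. -/
theorem sum_prodB_pow {φ ψ : ℝ → ℝ} (hφ : BddMeas φ) (hψ : BddMeas ψ) (a b : ℕ) :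
    ∑ k ∈ Finset.range (min a b + 1),
      (1 / (k.factorial : ℝ) * (a.descFactorial k * b.descFactorial k)) •
        pairInt k (prodB hT hB (a - k) (b - k)) (tens T fun _ => φ) (tens T fun _ => ψ) =
    inclL P (∑ k ∈ Finset.range (min a b + 1),
      (2 ^ k / (k.factorial : ℝ) * (a.descFactorial k * b.descFactorial k)) •
        pairInt k (wickB hT hB (a - k) (b - k)) (tens T fun _ => φ) (tens T fun _ => ψ)) := by
  obtain ⟨c, hc⟩ : ∃ c, c = ∫ x, φ x * ψ x ∂(itvMeasure T) := ⟨_, rfl⟩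
  simp_rw [pairInt_pow _ _ hφ hψ, prodB_pow, wickB_pow hT hB hφ hψ, smul_smul, ← hc]
  apply Lp.ext
  have hp : ∀ᵐ ω ∂P, ∀ p q, mulL P (blockI hT hB φ ψ p p) (blockI hT hB φ ψ 0 q) ω =
      blockI hT hB φ ψ p p ω * blockI hT hB φ ψ 0 q ω := by
    simp only [ae_all_iff]
    exact fun p q => coeFn_mulL P _ _
  set R := Finset.range (min a b + 1)
  have hs1 : ∀ᵐ ω ∂P, ∀ k, ((1 / (k.factorial : ℝ) * (a.descFactorial k * b.descFactorial k) *
      c ^ k) • mulL P (blockI hT hB φ ψ (a - k) (a - k)) (blockI hT hB φ ψ 0 (b - k)) :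
        Lp ℝ 1 P) ω = (1 / (k.factorial : ℝ) * (a.descFactorial k * b.descFactorial k) *
      c ^ k) * mulL P (blockI hT hB φ ψ (a - k) (a - k)) (blockI hT hB φ ψ 0 (b - k)) ω := by
    rw [ae_all_iff]; exact fun k => Lp.coeFn_smul _ _
  have hs2 : ∀ᵐ ω ∂P, ∀ k, ((2 ^ k / (k.factorial : ℝ) *
      (a.descFactorial k * b.descFactorial k) * c ^ k) •
        blockI hT hB φ ψ (a - k) (a - k + (b - k)) : Lp ℝ 2 P) ω =
      (2 ^ k / (k.factorial : ℝ) * (a.descFactorial k * b.descFactorial k) * c ^ k) *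
        blockI hT hB φ ψ (a - k) (a - k + (b - k)) ω := by
    rw [ae_all_iff]; exact fun k => Lp.coeFn_smul _ _
  filter_upwards [ae_hermiteRec hT hB hφ hψ, hp, hs1, hs2,
    Lp.coeFn_finsetSum R fun k => (1 / (k.factorial : ℝ) *
      (a.descFactorial k * b.descFactorial k) * c ^ k) •
        mulL P (blockI hT hB φ ψ (a - k) (a - k)) (blockI hT hB φ ψ 0 (b - k)),
    Lp.coeFn_finsetSum R fun k => (2 ^ k / (k.factorial : ℝ) *
      (a.descFactorial k * b.descFactorial k) * c ^ k) •
        blockI hT hB φ ψ (a - k) (a - k + (b - k)),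
    coeFn_inclL P (∑ k ∈ R, (2 ^ k / (k.factorial : ℝ) *
      (a.descFactorial k * b.descFactorial k) * c ^ k) •
        blockI hT hB φ ψ (a - k) (a - k + (b - k)))] with ω h1 h2 h3 h4 h5 h6 h7
  rw [h5, h7, h6, Finset.sum_apply, Finset.sum_apply]
  simp_rw [h3, h4, h2]
  -- Multiplying by a! b! undoes the normalization: a! / (a - k)! is the descending factorial in the
  -- derivative of order k.
  have h8 := congrArg (fun x => (a.factorial : ℝ) * b.factorial * x) (h1.sum_mul_eq a b)
  rw [← hc] at h8
  simp only [Finset.mul_sum] at h8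
  refine (Finset.sum_congr rfl fun k hk => ?_).trans
    (h8.trans (Finset.sum_congr rfl fun k hk => ?_))
  all_goals
    have hk' := Finset.mem_range.1 hk
    have ha : k ≤ a := by omega
    have hb : k ≤ b := by omega
    have e1 : (a.factorial : ℝ) = (a - k).factorial * a.descFactorial k := by
      exact_mod_cast (Nat.factorial_mul_descFactorial ha).symm
    have e2 : (b.factorial : ℝ) = (b - k).factorial * b.descFactorial k := by
      exact_mod_cast (Nat.factorial_mul_descFactorial hb).symm
    have e3 : ((a - k).factorial : ℝ) ≠ 0 := by positivity
    have e4 : ((b - k).factorial : ℝ) ≠ 0 := by positivity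
    rw [e1, e2]
    simp only [Nat.factorial_zero, Nat.cast_one, mul_one, one_mul, add_zero, zero_add, mul_pow]
    field_simp

/-- The identity for two multiple integrals. -/
theorem sum_prodB_eq {a b : ℕ} {f : Kern T a} {g : Kern T b} (hf : IsSymmKern f)
    (hg : IsSymmKern g) :
    ∑ k ∈ Finset.range (min a b + 1),
      (1 / (k.factorial : ℝ) * (a.descFactorial k * b.descFactorial k)) •
        pairInt k (prodB hT hB (a - k) (b - k)) (castK T a (a - k + k) f)
          (castK T b (b - k + k) g) =
    inclL P (∑ k ∈ Finset.range (min a b + 1),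
      (2 ^ k / (k.factorial : ℝ) * (a.descFactorial k * b.descFactorial k)) •
        pairInt k (wickB hT hB (a - k) (b - k)) (castK T a (a - k + k) f)
          (castK T b (b - k + k) g)) := by
  let L : Kern T a →L[ℝ] Kern T b →L[ℝ] Lp ℝ 1 P :=
    ∑ k ∈ Finset.range (min a b + 1),
      ((1 / (k.factorial : ℝ) * (a.descFactorial k * b.descFactorial k)) •
        (pairInt k (prodB hT hB (a - k) (b - k))).bilinearComp (castK T a (a - k + k))
          (castK T b (b - k + k)) -
      (2 ^ k / (k.factorial : ℝ) * (a.descFactorial k * b.descFactorial k)) •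
        (ContinuousLinearMap.compL ℝ _ _ _ (inclL P)).comp
          ((pairInt k (wickB hT hB (a - k) (b - k))).bilinearComp (castK T a (a - k + k))
            (castK T b (b - k + k))))
  have hL : ∀ f g, L f g = ∑ k ∈ Finset.range (min a b + 1),
      (1 / (k.factorial : ℝ) * (a.descFactorial k * b.descFactorial k)) •
        pairInt k (prodB hT hB (a - k) (b - k)) (castK T a (a - k + k) f)
          (castK T b (b - k + k) g) -
      inclL P (∑ k ∈ Finset.range (min a b + 1),
      (2 ^ k / (k.factorial : ℝ) * (a.descFactorial k * b.descFactorial k)) •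
        pairInt k (wickB hT hB (a - k) (b - k)) (castK T a (a - k + k) f)
          (castK T b (b - k + k) g)) := by
    intro f g
    rw [map_sum, ← Finset.sum_sub_distrib]
    simp only [L, sum_apply, map_smul]
    rfl
  rw [← sub_eq_zero, ← hL]
  -- Polarization is applied to one argument at a time: in the second with a power in the first,
  -- then in the first.
  have h1 : ∀ φ, BddMeas φ → L (tens T fun _ => φ) g = 0 := by
    intro φ hφ
    refine eq_zero_of_pow hT (L (tens T fun _ => φ)) (fun ψ hψ => ?_) hg
    rw [hL, sub_eq_zero]
    have hk : ∀ k ∈ Finset.range (min a b + 1),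
        castK T a (a - k + k) (tens T fun _ => φ) = (tens T fun _ => φ) ∧
        castK T b (b - k + k) (tens T fun _ => ψ) = tens T fun _ => ψ := by
      intro k hk
      have hk' := Finset.mem_range.1 hk
      exact ⟨castK_family (by omega) fun n => tens T fun _ : Fin n => φ,
        castK_family (by omega) fun n => tens T fun _ : Fin n => ψ⟩
    rw [Finset.sum_congr rfl fun k h => by rw [(hk k h).1, (hk k h).2],
      sum_prodB_pow hT hB hφ hψ a b]
    congr 1
    exact Finset.sum_congr rfl fun k h => by rw [(hk k h).1, (hk k h).2]
  exact eq_zero_of_pow hT (L.flip g) h1 hf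

end SingleChaos

/-! ### Series -/

section Series

theorem lintegral_tsum_enorm_ne_top {α ι G : Type*} [MeasurableSpace α] {μ : Measure α}
    [Countable ι] [NormedAddCommGroup G] {F : ι → Lp G 1 μ} (hF : Summable fun i => ‖F i‖) :
    ∫⁻ t, ∑' i, ‖F i t‖ₑ ∂μ ≠ ⊤ := by
  rw [lintegral_tsum fun i => (Lp.aestronglyMeasurable (F i)).enorm]
  have h2 : ∀ i, ∫⁻ t, ‖F i t‖ₑ ∂μ = (‖F i‖₊ : ENNReal) := by
    intro i
    rw [← eLpNorm_one_eq_lintegral_enorm, ← Lp.enorm_def]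
    rfl
  simp_rw [h2]
  exact ENNReal.tsum_coe_ne_top_iff_summable.2 (NNReal.summable_coe.1 hF)

theorem ae_summable_norm {α ι G : Type*} [MeasurableSpace α] {μ : Measure α} [Countable ι]
    [NormedAddCommGroup G] {F : ι → Lp G 1 μ} (hF : Summable fun i => ‖F i‖) :
    ∀ᵐ t ∂μ, Summable fun i => ‖F i t‖ := by
  filter_upwards [ae_lt_top' (AEMeasurable.tsum fun i =>
    (Lp.aestronglyMeasurable (F i)).enorm) (lintegral_tsum_enorm_ne_top hF)] with t ht
  exact NNReal.summable_coe.2 (ENNReal.tsum_coe_ne_top_iff_summable.1 ht.ne)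

/-- Termwise integration of an absolutely convergent series in `L¹`. -/
theorem integrable_and_hasSum_integral {α ι G : Type*} [MeasurableSpace α] {μ : Measure α}
    [Countable ι] [NormedAddCommGroup G] [NormedSpace ℝ G] [CompleteSpace G]
    {F : ι → Lp G 1 μ} (hF : Summable fun i => ‖F i‖) {f : α → G}
    (hf : ∀ᵐ t ∂μ, (Summable fun i => ‖F i t‖) → HasSum (fun i => F i t) (f t)) :
    Integrable f μ ∧ HasSum (fun i => ∫ t, F i t ∂μ) (∫ t, f t ∂μ) := by
  have hs := ae_summable_norm hF
  have hf' : ∀ᵐ t ∂μ, HasSum (fun i => F i t) (f t) := by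
    filter_upwards [hs, hf] with t h1 h2 using h2 h1
  have hn : ∀ i, ∫ t, ‖F i t‖ ∂μ = ‖F i‖ := fun i => (L1.norm_eq_integral_norm _).symm
  have hint : ∀ i, Integrable (fun t => F i t) μ := fun i => L1.integrable_coeFn (F i)
  have hsum : Summable fun i => ∫ t, ‖F i t‖ ∂μ := by simpa only [hn] using hF
  constructor
  · have hm : AEStronglyMeasurable f μ :=
      aestronglyMeasurable_of_tendsto_ae (atTop : Filter (Finset ι))
        (f := fun s t => ∑ i ∈ s, F i t)
        (fun s => Finset.aestronglyMeasurable_fun_sum s fun i _ => (hint i).1) hf'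
    have hg : Integrable (fun t => ∑' i, ‖F i t‖) μ := by
      refine ⟨(AEMeasurable.tsum fun i => (hint i).norm.1.aemeasurable).aestronglyMeasurable, ?_⟩
      refine lt_of_le_of_lt (lintegral_mono fun t => ?_) (lintegral_tsum_enorm_ne_top hF).lt_top
      refine (enorm_tsum_le_tsum_enorm).trans (le_of_eq (tsum_congr fun i => ?_))
      exact enorm_norm _
    refine hg.mono' hm ?_
    filter_upwards [hs, hf'] with t h1 h2
    rw [← h2.tsum_eq]
    exact norm_tsum_le_tsum_norm h1
  · have h := hasSum_integral_of_summable_integral_norm hint hsum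
    rwa [integral_congr_ae (g := f)] at h
    filter_upwards [hf'] with t h2 using h2.tsum_eq

/-- Summability of the double series is assumed; its value is found by summing over one index after
the other. -/
theorem hasSum_bilin {E₁ E₂ G : Type*} [NormedAddCommGroup E₁] [NormedSpace ℝ E₁]
    [NormedAddCommGroup E₂] [NormedSpace ℝ E₂] [NormedAddCommGroup G] [NormedSpace ℝ G]
    (b : E₁ →L[ℝ] E₂ →L[ℝ] G) {ι κ : Type*} {x : ι → E₁} {y : κ → E₂} {X : E₁} {Y : E₂}
    (hx : HasSum x X) (hy : HasSum y Y) (hs : Summable fun z : ι × κ => b (x z.1) (y z.2)) :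
    HasSum (fun z : ι × κ => b (x z.1) (y z.2)) (b X Y) := by
  have h1 := hs.hasSum.prod_fiberwise fun i => (b (x i)).hasSum hy
  have h2 : HasSum (fun i => b (x i) Y) (b X Y) := (b.flip Y).hasSum hx
  rw [← h1.unique h2]
  exact hs.hasSum

theorem hasSum_antidiagonal {G : Type*} [AddCommGroup G] [TopologicalSpace G]
    [IsTopologicalAddGroup G] [T3Space G] {f : ℕ × ℕ → G} {s : G} (hf : HasSum f s) :
    HasSum (fun n => ∑ p ∈ Finset.HasAntidiagonal.antidiagonal n, f p) s := by
  refine ((Finset.HasAntidiagonal.sigmaAntidiagonalEquivProd (A := ℕ)).hasSum_iff.2 hf).sigma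
    fun n => ?_
  exact Finset.hasSum _ f

/-- Triples `(k, p, q)` are parametrized by `(p + k, q + k)` and `k`. -/
def shiftEquiv : (Σ x : ℕ × ℕ, {k // k ∈ Finset.range (min x.1 x.2 + 1)}) ≃ ℕ × ℕ × ℕ where
  toFun y := (y.2.1, y.1.1 - y.2.1, y.1.2 - y.2.1)
  invFun z := ⟨(z.2.1 + z.1, z.2.2 + z.1), z.1, by simp⟩
  left_inv := by
    rintro ⟨⟨a, b⟩, k, hk⟩
    have key : ∀ y z : Σ x : ℕ × ℕ, {k // k ∈ Finset.range (min x.1 x.2 + 1)},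
        y.1 = z.1 → y.2.1 = z.2.1 → y = z := by
      rintro ⟨_, _, _⟩ ⟨_, _, _⟩ h1 h2
      cases h1
      cases h2
      rfl
    have hk' := Finset.mem_range.1 hk
    dsimp only at hk'
    refine key _ _ (Prod.ext ?_ ?_) rfl
    · exact Nat.sub_add_cancel (show k ≤ a by omega)
    · exact Nat.sub_add_cancel (show k ≤ b by omega)
  right_inv := by
    rintro ⟨k, p, q⟩
    simp

/-- For given degrees of the original kernels only finitely many orders `k` occur, so the regrouped
inner sums are finite. -/
theorem hasSum_shift {G : Type*} [AddCommGroup G] [TopologicalSpace G]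
    [IsTopologicalAddGroup G] [T3Space G] {f : ℕ × ℕ × ℕ → G} {s : G} (hf : HasSum f s) :
    HasSum (fun x : ℕ × ℕ => ∑ k ∈ Finset.range (min x.1 x.2 + 1), f (k, x.1 - k, x.2 - k)) s := by
  refine (shiftEquiv.hasSum_iff.2 hf).sigma fun x => ?_
  exact Finset.hasSum (Finset.range (min x.1 x.2 + 1)) fun k => f (k, x.1 - k, x.2 - k)

/-- The descending factorial is split into two square roots: one completes m! to (m+k)!, the other
is at most √k! · 2^{m+k} by the bound for binomial coefficients. Two such estimates together cost
k!, which the factor 1/k! of the series pays for. -/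
theorem sqrt_factorial_mul_descFactorial_le (m k : ℕ) :
    √(m.factorial) * ((m + k).descFactorial k : ℝ) ≤
      √(k.factorial) * √((m + k).factorial) * 2 ^ (m + k) := by
  have h1 : ((m + k).factorial : ℝ) = m.factorial * (m + k).descFactorial k := by
    have := Nat.factorial_mul_descFactorial (Nat.le_add_left k m)
    rw [Nat.add_sub_cancel] at this
    exact_mod_cast this.symm
  have h2 : ((m + k).descFactorial k : ℝ) ≤ k.factorial * 2 ^ (m + k) := by
    rw [Nat.descFactorial_eq_factorial_mul_choose]
    push_cast
    gcongr
    exact_mod_cast Nat.choose_le_two_pow _ _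
  have h3 : (1 : ℝ) ≤ 2 ^ (m + k) := one_le_pow₀ (by norm_num)
  rw [h1, Real.sqrt_mul (by positivity)]
  set d := ((m + k).descFactorial k : ℝ)
  have hd : 0 ≤ d := Nat.cast_nonneg _
  have h4 : √d ≤ √(k.factorial) * 2 ^ (m + k) := by
    refine Real.sqrt_le_iff.2 ⟨by positivity, h2.trans ?_⟩
    rw [mul_pow, Real.sq_sqrt (by positivity)]
    gcongr
    nlinarith
  calc √(m.factorial) * d = √(m.factorial) * √d * √d := by
        rw [mul_assoc, Real.mul_self_sqrt hd]
    _ ≤ √(m.factorial) * √d * (√(k.factorial) * 2 ^ (m + k)) := by gcongr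
    _ = _ := by ring

theorem sqrt_factorial_add_le (p q : ℕ) :
    √((p + q).factorial) ≤ 2 ^ (p + q) * (√(p.factorial) * √(q.factorial)) := by
  refine Real.sqrt_le_iff.2 ⟨by positivity, ?_⟩
  rw [mul_pow, mul_pow, Real.sq_sqrt (by positivity), Real.sq_sqrt (by positivity)]
  have h1 : ((p + q).factorial : ℝ) = (p + q).choose q * (p.factorial * q.factorial) := by
    rw [← mul_assoc]; exact_mod_cast (Nat.add_choose_mul_factorial_mul_factorial p q).symm
  rw [h1]
  gcongr
  have h2 : ((p + q).choose q : ℝ) ≤ 2 ^ (p + q) := by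
    exact_mod_cast Nat.choose_le_two_pow _ _
  have h3 : (1 : ℝ) ≤ 2 ^ (p + q) := one_le_pow₀ (by norm_num)
  nlinarith

end Series

/-! ### Chaos expansions of smooth random variables -/

section SmoothChaos

variable {Ω : Type*} [MeasurableSpace Ω] {P : Measure Ω} [IsProbabilityMeasure P]
  {T : ℝ} {B : ℝ → Ω → ℝ}

/-- Different chaoses are orthogonal, so pairing the difference of the two expansions with I_m(h_m -
g_m) isolates m! ‖h_m - g_m‖². -/
theorem IsChaosExpansion.unique (hT : 0 < T) (hB : IsBrownianOn P T B) {X : Lp ℝ 2 P}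
    {h g : (n : ℕ) → Kern T n} (hh : IsChaosExpansion P T B X h)
    (hg : IsChaosExpansion P T B X g) : h = g := by
  funext m
  have hd : IsSymmKern (h m - g m) := by
    rw [isSymmKern_iff]
    intro σ
    rw [map_sub, isSymmKern_iff.1 (hh.1 m), isSymmKern_iff.1 (hg.1 m)]
  have h1 : HasSum (fun n => itoL hT hB n (h n - g n)) 0 := by
    simpa only [map_sub, sub_self, itoL_apply] using hh.2.sub hg.2
  have h2 := (innerSL ℝ (itoL hT hB m (h m - g m))).hasSum h1
  have h3 := (hasSum_single m fun n hn => inner_itoL_of_ne hT hB (Ne.symm hn) _ _).unique h2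
  simp only [map_zero] at h3
  rw [real_inner_self_eq_norm_sq, norm_itoL_sq hT hB hd] at h3
  have h4 := (mul_eq_zero.1 h3).resolve_left (by positivity)
  exact sub_eq_zero.1 (norm_eq_zero.1 (pow_eq_zero_iff two_ne_zero |>.1 h4))

theorem IsChaosExpansion.chaosKernel_eq (hT : 0 < T) (hB : IsBrownianOn P T B) {X : Lp ℝ 2 P}
    {h : (n : ℕ) → Kern T n} (hh : IsChaosExpansion P T B X h) : chaosKernel P T B X = h := by
  have hX : ∃ h, IsChaosExpansion P T B X h := ⟨h, hh⟩
  rw [chaosKernel, dif_pos hX]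
  exact hX.choose_spec.unique hT hB hh

/-- Families of kernels whose norms decrease rapidly. -/
def RapidDecay (h : (n : ℕ) → Kern T n) : Prop :=
  ∀ c : ℝ, 0 ≤ c → Summable fun n => √(n.factorial) * c ^ n * ‖h n‖

/-- Integer rates suffice, so that for slices depending on `t` only countably many conditions need
to hold almost everywhere. -/
theorem rapidDecay_of_sq {h : (n : ℕ) → Kern T n}
    (hh : ∀ r : ℕ, Summable fun n => (n.factorial : ℝ) * (r : ℝ) ^ (2 * n) * ‖h n‖ ^ 2) :
    RapidDecay h := by
  intro c hc
  -- A rate `r ≥ 2 * c` leaves a factor 2^{-n}; then a product is bounded by the sum of the squares.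
  obtain ⟨r, hr⟩ := exists_nat_ge (2 * c)
  have h1 : Summable fun n : ℕ => ((1 / 2 : ℝ) ^ n) ^ 2 := by
    simp_rw [← pow_mul, mul_comm _ 2, pow_mul]
    exact summable_geometric_of_lt_one (by norm_num) (by norm_num)
  refine Summable.of_nonneg_of_le (fun n => by positivity) (fun n => ?_) (h1.add (hh r))
  have h2 : √(n.factorial : ℝ) * c ^ n * ‖h n‖ ≤
      (1 / 2) ^ n * (√(n.factorial) * (r : ℝ) ^ n * ‖h n‖) := by
    have : c ^ n ≤ (1 / 2 : ℝ) ^ n * (r : ℝ) ^ n := by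
      rw [← mul_pow]; exact pow_le_pow_left₀ hc (by linarith) n
    calc √(n.factorial : ℝ) * c ^ n * ‖h n‖
        ≤ √(n.factorial : ℝ) * ((1 / 2 : ℝ) ^ n * (r : ℝ) ^ n) * ‖h n‖ := by gcongr
      _ = _ := by ring
  have h3 : (n.factorial : ℝ) * (r : ℝ) ^ (2 * n) * ‖h n‖ ^ 2 =
      (√(n.factorial) * (r : ℝ) ^ n * ‖h n‖) ^ 2 := by
    rw [mul_pow, mul_pow, Real.sq_sqrt (by positivity), mul_comm 2 n, pow_mul]
  rw [h3]
  nlinarith [sq_nonneg ((1 / 2 : ℝ) ^ n - √(n.factorial) * (r : ℝ) ^ n * ‖h n‖),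
    sq_nonneg ((1 / 2 : ℝ) ^ n + √(n.factorial) * (r : ℝ) ^ n * ‖h n‖)]

theorem RapidDecay.summable_sq {h : (n : ℕ) → Kern T n} (hh : RapidDecay h) {lam : ℝ}
    (hl : 0 ≤ lam) : Summable fun n => (n.factorial : ℝ) * lam ^ (2 * n) * ‖h n‖ ^ 2 := by
  have h1 := ((hh lam hl).mul_of_nonneg (hh lam hl) (fun n => by positivity)
    (fun n => by positivity)).comp_injective (i := fun n : ℕ => (n, n))
    fun a b h => congrArg Prod.fst h
  refine h1.congr fun n => ?_
  have h2 : (n.factorial : ℝ) = √(n.factorial) * √(n.factorial) :=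
    (Real.mul_self_sqrt (by positivity)).symm
  rw [h2]
  simp only [Function.comp]
  rw [mul_comm 2 n, pow_mul]
  ring_nf

/-- By uniqueness the expansions for the various `lam` coincide, so one sequence of kernels
satisfies all the summability conditions. -/
theorem mem_GSmooth_iff (hT : 0 < T) (hB : IsBrownianOn P T B) {X : Lp ℝ 2 P} :
    X ∈ GSmooth P T B ↔ IsChaosExpansion P T B X (chaosKernel P T B X) ∧
      RapidDecay (chaosKernel P T B X) := by
  constructor
  · intro h
    have h1 : ∀ lam : ℝ, 1 ≤ lam → IsChaosExpansion P T B X (chaosKernel P T B X) ∧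
        Summable fun n => (n.factorial : ℝ) * lam ^ (2 * n) * ‖chaosKernel P T B X n‖ ^ 2 := by
      intro lam hlam
      obtain ⟨k, hk, hs⟩ := h lam hlam
      rw [hk.chaosKernel_eq hT hB]
      exact ⟨hk, hs⟩
    refine ⟨(h1 1 le_rfl).1, rapidDecay_of_sq fun r => ?_⟩
    refine Summable.of_nonneg_of_le (fun n => ?_) (fun n => ?_)
      (h1 (r + 1) (by linarith [Nat.cast_nonneg (α := ℝ) r])).2
    · positivity
    · gcongr
      linarith
  · exact fun h lam hlam => ⟨_, h.1, h.2.summable_sq (zero_le_one.trans hlam)⟩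

theorem RapidDecay.summable_norm_itoL (hT : 0 < T) (hB : IsBrownianOn P T B)
    {h : (n : ℕ) → Kern T n} (hh : RapidDecay h) :
    Summable fun n => ‖itoL hT hB n (h n)‖ := by
  refine Summable.of_nonneg_of_le (fun n => norm_nonneg _) (fun n => norm_itoL_le hT hB _) ?_
  simpa using hh 1 zero_le_one

theorem RapidDecay.mem_GSmooth (hT : 0 < T) (hB : IsBrownianOn P T B)
    {h : (n : ℕ) → Kern T n} (hh : RapidDecay h) (hs : ∀ n, IsSymmKern (h n)) :
    chaosKernel P T B (∑' n, itoL hT hB n (h n)) = h ∧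
      (∑' n, itoL hT hB n (h n)) ∈ GSmooth P T B := by
  have h1 : IsChaosExpansion P T B (∑' n, itoL hT hB n (h n)) h :=
    ⟨hs, (hh.summable_norm_itoL hT hB).of_norm.hasSum⟩
  have h2 := h1.chaosKernel_eq hT hB
  exact ⟨h2, (mem_GSmooth_iff hT hB).2 (by rw [h2]; exact ⟨h1, hh⟩)⟩

/-- The kernels of the derivative of order `k` at `t`. -/
def derivKernel (k : ℕ) (h : (n : ℕ) → Kern T n) (t : Fin k → ℝ) (m : ℕ) : Kern T m :=
  ((m + k).descFactorial k : ℝ) • sliceFun (h (m + k)) t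

theorem ae_isSymmKern_derivKernel (k : ℕ) {h : (n : ℕ) → Kern T n} (hs : ∀ n, IsSymmKern (h n)) :
    ∀ᵐ t ∂(cubeMeasure T k), ∀ m, IsSymmKern (derivKernel k h t m) := by
  refine ae_all_iff.2 fun m => ?_
  filter_upwards [ae_permK_sliceFun (hs (m + k))] with t ht
  rw [isSymmKern_iff] at ht ⊢
  intro σ
  rw [derivKernel, map_smul, ht]

/-- Integrated over t, the squared norms of the slices of h_{m+k} are controlled by ‖h_{m+k}‖², so
the weighted series of slices has finite integral and converges for almost every t. -/
theorem RapidDecay.ae_derivKernel (k : ℕ) {h : (n : ℕ) → Kern T n} (hh : RapidDecay h) :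
    ∀ᵐ t ∂(cubeMeasure T k), RapidDecay (derivKernel k h t) := by
  have h1 : ∀ r : ℕ, Summable fun m => ‖((m.factorial : ℝ) * (r : ℝ) ^ (2 * m) *
      ((m + k).descFactorial k : ℝ) ^ 2) • pairL k (innerSL ℝ) (h (m + k)) (h (m + k))‖ := by
    intro r
    -- The factor 2 absorbs the squared descending factorial; `r + 1 ≥ 1` allows raising the
    -- exponent from 2m to 2(m + k).
    have h2 := (((hh.summable_sq (lam := 2 * (r + 1)) (by positivity)).comp_injective
      (add_left_injective k)).mul_left (k.factorial : ℝ))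
    refine Summable.of_nonneg_of_le (fun n => norm_nonneg _) (fun m => ?_) h2
    rw [norm_smul, Real.norm_of_nonneg (by positivity)]
    have h3 : ‖pairL k (innerSL ℝ) (h (m + k)) (h (m + k))‖ ≤ ‖h (m + k)‖ ^ 2 := by
      refine (norm_pairL_le _ _ _ _).trans ?_
      rw [mul_assoc, ← sq]
      exact mul_le_of_le_one_left (by positivity) (norm_innerSL_le ℝ)
    have h4 := sqrt_factorial_mul_descFactorial_le m k
    have h5 : (m.factorial : ℝ) * ((m + k).descFactorial k : ℝ) ^ 2 ≤
        k.factorial * (m + k).factorial * 2 ^ (2 * (m + k)) := by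
      have := pow_le_pow_left₀ (by positivity) h4 2
      rw [mul_pow, mul_pow, mul_pow, Real.sq_sqrt (by positivity), Real.sq_sqrt (by positivity),
        Real.sq_sqrt (by positivity), ← pow_mul, mul_comm (m + k) 2] at this
      exact this
    have h6 : (r : ℝ) ^ (2 * m) ≤ (r + 1) ^ (2 * (m + k)) :=
      (pow_le_pow_left₀ (by positivity) (by linarith) _).trans
        (pow_le_pow_right₀ (by linarith [Nat.cast_nonneg (α := ℝ) r]) (by omega))
    calc (m.factorial : ℝ) * (r : ℝ) ^ (2 * m) * ((m + k).descFactorial k : ℝ) ^ 2 *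
          ‖pairL k (innerSL ℝ) (h (m + k)) (h (m + k))‖
        = ((m.factorial : ℝ) * ((m + k).descFactorial k : ℝ) ^ 2) * (r : ℝ) ^ (2 * m) *
          ‖pairL k (innerSL ℝ) (h (m + k)) (h (m + k))‖ := by ring
      _ ≤ (k.factorial * (m + k).factorial * 2 ^ (2 * (m + k))) * (r + 1) ^ (2 * (m + k)) *
          ‖h (m + k)‖ ^ 2 := by gcongr
      _ = _ := by simp only [Function.comp]; rw [mul_pow]; ring
  have h2 : ∀ᵐ t ∂(cubeMeasure T k), ∀ r m : ℕ, (((m.factorial : ℝ) * (r : ℝ) ^ (2 * m) *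
      ((m + k).descFactorial k : ℝ) ^ 2) • pairL k (innerSL ℝ) (h (m + k)) (h (m + k)) :
        Lp ℝ 1 (cubeMeasure T k)) t =
      (m.factorial : ℝ) * (r : ℝ) ^ (2 * m) * ‖derivKernel k h t m‖ ^ 2 := by
    refine ae_all_iff.2 fun r => ae_all_iff.2 fun m => ?_
    filter_upwards [Lp.coeFn_smul ((m.factorial : ℝ) * (r : ℝ) ^ (2 * m) *
      ((m + k).descFactorial k : ℝ) ^ 2) (pairL k (innerSL ℝ) (h (m + k)) (h (m + k))),
      coeFn_pairL k (innerSL ℝ) (h (m + k)) (h (m + k))] with t e1 e2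
    rw [e1, Pi.smul_apply, e2, innerSL_apply_apply, real_inner_self_eq_norm_sq, derivKernel,
      norm_smul, Real.norm_of_nonneg (by positivity), smul_eq_mul]
    ring
  filter_upwards [h2, ae_all_iff.2 fun r => ae_summable_norm (h1 r)] with t e1 e2
  refine rapidDecay_of_sq fun r => (e2 r).congr fun m => ?_
  rw [e1, Real.norm_of_nonneg (by positivity)]

theorem hidaD_eq (hT : 0 < T) (hB : IsBrownianOn P T B) (k : ℕ) (X : Lp ℝ 2 P)
    (t : Fin k → ℝ) : hidaD P T B k X t =
      ∑' m, itoL hT hB m (derivKernel k (chaosKernel P T B X) t m) := by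
  simp_rw [derivKernel, map_smul]
  rfl

/-- The derivatives of a smooth random variable are smooth, and their kernels are the slices of
its kernels. -/
theorem ae_hidaD (hT : 0 < T) (hB : IsBrownianOn P T B) {X : Lp ℝ 2 P}
    (hX : X ∈ GSmooth P T B) (k : ℕ) : ∀ᵐ t ∂(cubeMeasure T k),
      hidaD P T B k X t ∈ GSmooth P T B ∧
      chaosKernel P T B (hidaD P T B k X t) = derivKernel k (chaosKernel P T B X) t ∧
      HasSum (fun m => itoL hT hB m (derivKernel k (chaosKernel P T B X) t m))
        (hidaD P T B k X t) := by
  obtain ⟨h1, h2⟩ := (mem_GSmooth_iff hT hB).1 hX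
  filter_upwards [h2.ae_derivKernel k, ae_isSymmKern_derivKernel k h1.1] with t e1 e2
  rw [hidaD_eq hT hB]
  exact ⟨(e1.mem_GSmooth hT hB e2).2, (e1.mem_GSmooth hT hB e2).1,
    (e1.summable_norm_itoL hT hB).of_norm.hasSum⟩

end SmoothChaos

/-! ### Series of pairings -/

section PairingSeries

variable {T : ℝ} {G : Type*} [NormedAddCommGroup G] [NormedSpace ℝ G]

/-- The product of the combinatorial factors in the derivatives of order `k`. -/
def descCoeff (k p q : ℕ) : ℝ := (p + k).descFactorial k * (q + k).descFactorial k

theorem descCoeff_nonneg (k p q : ℕ) : 0 ≤ descCoeff k p q := by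
  unfold descCoeff; positivity

/-- A single majorant for the triple series of products and of Wick products. -/
theorem summable_weight {h g : (n : ℕ) → Kern T n} (hh : RapidDecay h) (hg : RapidDecay g) :
    Summable fun z : ℕ × ℕ × ℕ => 2 ^ z.1 / (z.1.factorial : ℝ) * descCoeff z.1 z.2.1 z.2.2 *
      (2 ^ (z.2.1 + z.2.2) * (√(z.2.1.factorial) * √(z.2.2.factorial))) *
      (‖h (z.2.1 + z.1)‖ * ‖g (z.2.2 + z.1)‖) := by
  -- The powers of 2 from the estimates are at most 2^{5k+3p+3q}. The rate 8 at the indices p + k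
  -- and q + k gives 2^{6k+3p+3q}, which leaves 2^{-k} for the sum over k.
  have h1 : Summable fun z : ℕ × ℕ × ℕ => (1 / 2 : ℝ) ^ z.1 *
      ((√(z.2.1.factorial) * 8 ^ z.2.1 * ‖h z.2.1‖) *
        (√(z.2.2.factorial) * 8 ^ z.2.2 * ‖g z.2.2‖)) := by
    refine Summable.mul_of_nonneg (f := fun k : ℕ => (1 / 2 : ℝ) ^ k)
      (g := fun z : ℕ × ℕ => (√(z.1.factorial) * 8 ^ z.1 * ‖h z.1‖) *
        (√(z.2.factorial) * 8 ^ z.2 * ‖g z.2‖))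
      (summable_geometric_of_lt_one (by norm_num) (by norm_num)) ?_ (fun k => by positivity)
      (fun z => by positivity)
    exact (hh 8 (by norm_num)).mul_of_nonneg (hg 8 (by norm_num)) (fun n => by positivity)
      fun n => by positivity
  have hinj : Function.Injective fun z : ℕ × ℕ × ℕ => (z.1, z.2.1 + z.1, z.2.2 + z.1) := by
    rintro ⟨k, p, q⟩ ⟨k', p', q'⟩ e
    simp only [Prod.mk.injEq] at e ⊢
    omega
  refine Summable.of_nonneg_of_le (fun z => ?_) (fun z => ?_) (h1.comp_injective hinj)
  · have := descCoeff_nonneg z.1 z.2.1 z.2.2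
    positivity
  obtain ⟨k, p, q⟩ := z
  simp only [Function.comp, descCoeff]
  have hp := sqrt_factorial_mul_descFactorial_le p k
  have hq := sqrt_factorial_mul_descFactorial_le q k
  calc 2 ^ k / (k.factorial : ℝ) * (((p + k).descFactorial k : ℝ) * (q + k).descFactorial k) *
        (2 ^ (p + q) * (√(p.factorial) * √(q.factorial))) * (‖h (p + k)‖ * ‖g (q + k)‖)
      = 2 ^ k / (k.factorial : ℝ) * 2 ^ (p + q) *
        ((√(p.factorial) * ((p + k).descFactorial k : ℝ)) *
          (√(q.factorial) * (q + k).descFactorial k)) * (‖h (p + k)‖ * ‖g (q + k)‖) := by ring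
    _ ≤ 2 ^ k / (k.factorial : ℝ) * 2 ^ (p + q) *
        ((√(k.factorial) * √((p + k).factorial) * 2 ^ (p + k)) *
          (√(k.factorial) * √((q + k).factorial) * 2 ^ (q + k))) *
          (‖h (p + k)‖ * ‖g (q + k)‖) := by gcongr
    _ = 2 ^ k * 2 ^ (p + q) * 2 ^ (p + k) * 2 ^ (q + k) *
        ((√((p + k).factorial) * ‖h (p + k)‖) * (√((q + k).factorial) * ‖g (q + k)‖)) := by
      have e : (k.factorial : ℝ) = √(k.factorial) * √(k.factorial) :=
        (Real.mul_self_sqrt (by positivity)).symm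
      have e' : √(k.factorial : ℝ) ≠ 0 := by positivity
      rw [e]
      rw [Real.sqrt_mul_self (by positivity)]
      field_simp
    _ ≤ ((1 / 2 : ℝ) ^ k * 8 ^ (p + k) * 8 ^ (q + k)) *
        ((√((p + k).factorial) * ‖h (p + k)‖) * (√((q + k).factorial) * ‖g (q + k)‖)) := by
      refine mul_le_mul_of_nonneg_right ?_ (by positivity)
      have e1 : (8 : ℝ) = 2 ^ 3 := by norm_num
      have e2 : (1 / 2 : ℝ) ^ k * 2 ^ k = 1 := by rw [← mul_pow]; norm_num
      have e3 : (2 : ℝ) ^ k * 2 ^ (p + q) * 2 ^ (p + k) * 2 ^ (q + k) ≤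
          2 ^ (5 * k + 3 * p + 3 * q) := by
        rw [← pow_add, ← pow_add, ← pow_add]
        exact pow_le_pow_right₀ (by norm_num) (by omega)
      refine e3.trans (le_of_eq ?_)
      rw [e1, ← pow_mul, ← pow_mul]
      calc (2 : ℝ) ^ (5 * k + 3 * p + 3 * q)
          = ((1 / 2 : ℝ) ^ k * 2 ^ k) * 2 ^ (5 * k + 3 * p + 3 * q) := by rw [e2, one_mul]
        _ = _ := by ring
    _ = _ := by ring

variable {b : (p q : ℕ) → Kern T p →L[ℝ] Kern T q →L[ℝ] G} {h g : (n : ℕ) → Kern T n}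

/-- The bound on `c` admits the coefficients 1/k! of the products as well as 2^k/k! of the Wick
products. -/
theorem summable_norm_pairL (hb : ∀ p q, ‖b p q‖ ≤ 2 ^ (p + q) * (√p.factorial * √q.factorial))
    (hh : RapidDecay h) (hg : RapidDecay g) {c : ℕ → ℝ} (hc0 : ∀ k, 0 ≤ c k)
    (hc : ∀ k, c k ≤ 2 ^ k / k.factorial) :
    Summable fun z : ℕ × ℕ × ℕ => ‖(c z.1 * descCoeff z.1 z.2.1 z.2.2) •
      pairL z.1 (b z.2.1 z.2.2) (h (z.2.1 + z.1)) (g (z.2.2 + z.1))‖ := by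
  refine Summable.of_nonneg_of_le (fun z => norm_nonneg _) (fun z => ?_) (summable_weight hh hg)
  have h1 := descCoeff_nonneg z.1 z.2.1 z.2.2
  rw [norm_smul, Real.norm_of_nonneg (mul_nonneg (hc0 _) h1)]
  calc c z.1 * descCoeff z.1 z.2.1 z.2.2 *
        ‖pairL z.1 (b z.2.1 z.2.2) (h (z.2.1 + z.1)) (g (z.2.2 + z.1))‖
      ≤ c z.1 * descCoeff z.1 z.2.1 z.2.2 *
        (‖b z.2.1 z.2.2‖ * ‖h (z.2.1 + z.1)‖ * ‖g (z.2.2 + z.1)‖) :=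
      mul_le_mul_of_nonneg_left (norm_pairL_le _ _ _ _) (mul_nonneg (hc0 _) h1)
    _ ≤ 2 ^ z.1 / z.1.factorial * descCoeff z.1 z.2.1 z.2.2 *
        ((2 ^ (z.2.1 + z.2.2) * (√(z.2.1.factorial) * √(z.2.2.factorial))) *
          ‖h (z.2.1 + z.1)‖ * ‖g (z.2.2 + z.1)‖) := by
      gcongr
      · exact hc _
      · exact hb _ _
    _ = _ := by ring

variable [CompleteSpace G]

/-- Termwise integration of the series `∑ b(D^k h(t), D^k g(t))`. -/
theorem hasSum_integral_pairing
    (hb : ∀ p q, ‖b p q‖ ≤ 2 ^ (p + q) * (√p.factorial * √q.factorial))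
    (hh : RapidDecay h) (hg : RapidDecay g) (k : ℕ) {f : (Fin k → ℝ) → G}
    (hf : ∀ᵐ t ∂(cubeMeasure T k),
      (Summable fun z : ℕ × ℕ => b z.1 z.2 (derivKernel k h t z.1) (derivKernel k g t z.2)) →
      HasSum (fun z : ℕ × ℕ => b z.1 z.2 (derivKernel k h t z.1) (derivKernel k g t z.2)) (f t)) :
    Integrable f (cubeMeasure T k) ∧
      HasSum (fun z : ℕ × ℕ => descCoeff k z.1 z.2 •
        pairInt k (b z.1 z.2) (h (z.1 + k)) (g (z.2 + k))) (∫ t, f t ∂(cubeMeasure T k)) := by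
  have h1 : Summable fun z : ℕ × ℕ => ‖descCoeff k z.1 z.2 •
      pairL k (b z.1 z.2) (h (z.1 + k)) (g (z.2 + k))‖ := by
    -- The series at fixed `k` is a slice of the triple series, with the positive weight 2^k/k!
    -- divided out.
    have h2 := ((summable_norm_pairL hb hh hg (c := fun k => 2 ^ k / k.factorial)
      (fun k => by positivity) fun k => le_rfl).comp_injective
      (i := fun z : ℕ × ℕ => (k, z)) fun x y e => (Prod.mk.inj e).2).mul_left
        ((2 ^ k / (k.factorial : ℝ))⁻¹)
    refine h2.congr fun z => ?_
    have h3 : (0 : ℝ) < 2 ^ k / k.factorial := by positivity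
    simp only [Function.comp]
    rw [mul_smul, norm_smul (2 ^ k / (k.factorial : ℝ)), Real.norm_of_nonneg h3.le,
      inv_mul_cancel_left₀ h3.ne']
  have h2 : ∀ᵐ t ∂(cubeMeasure T k), ∀ z : ℕ × ℕ, (descCoeff k z.1 z.2 •
      pairL k (b z.1 z.2) (h (z.1 + k)) (g (z.2 + k)) : Lp G 1 (cubeMeasure T k)) t =
      b z.1 z.2 (derivKernel k h t z.1) (derivKernel k g t z.2) := by
    refine ae_all_iff.2 fun z => ?_
    filter_upwards [Lp.coeFn_smul (descCoeff k z.1 z.2)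
      (pairL k (b z.1 z.2) (h (z.1 + k)) (g (z.2 + k))),
      coeFn_pairL k (b z.1 z.2) (h (z.1 + k)) (g (z.2 + k))] with t e1 e2
    rw [e1, Pi.smul_apply, e2, derivKernel, derivKernel, descCoeff]
    simp only [map_smul, smul_apply, smul_smul]
    rw [mul_comm]
  have h3 := integrable_and_hasSum_integral h1 (f := f) (by
    filter_upwards [h2, hf] with t e1 e2
    simp only [e1]
    exact fun e3 => e2 e3.of_norm)
  refine ⟨h3.1, ?_⟩
  convert h3.2 using 2 with z
  rw [integral_congr_ae (Lp.coeFn_smul (descCoeff k z.1 z.2) _)]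
  simp only [Pi.smul_apply]
  rw [integral_smul, pairInt_eq_integral]

theorem norm_pairInt_le {k p q : ℕ} (b : Kern T p →L[ℝ] Kern T q →L[ℝ] G) (h : Kern T (p + k))
    (g : Kern T (q + k)) : ‖pairInt k b h g‖ ≤ ‖pairL k b h g‖ := by
  rw [pairInt_eq_integral, L1.norm_eq_integral_norm]
  exact norm_integral_le_integral_norm _

/-- Summation of the integrated series over the order `k`. -/
theorem summable_pairInt
    (hb : ∀ p q, ‖b p q‖ ≤ 2 ^ (p + q) * (√p.factorial * √q.factorial))
    (hh : RapidDecay h) (hg : RapidDecay g) {c : ℕ → ℝ} (hc0 : ∀ k, 0 ≤ c k)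
    (hc : ∀ k, c k ≤ 2 ^ k / k.factorial) :
    Summable fun z : ℕ × ℕ × ℕ => (c z.1 * descCoeff z.1 z.2.1 z.2.2) •
      pairInt z.1 (b z.2.1 z.2.2) (h (z.2.1 + z.1)) (g (z.2.2 + z.1)) := by
  refine Summable.of_norm_bounded (summable_norm_pairL hb hh hg hc0 hc) fun z => ?_
  rw [norm_smul, norm_smul]
  gcongr
  exact norm_pairInt_le _ _ _

end PairingSeries

/-! ### Products and Wick products of smooth random variables -/

section Products

variable {Ω : Type*} [MeasurableSpace Ω] {P : Measure Ω} [IsProbabilityMeasure P]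
  {T : ℝ} {B : ℝ → Ω → ℝ} (hT : 0 < T) (hB : IsBrownianOn P T B)

/-- The factor 2^{p+q} is not needed here; it gives the product the same bound as the Wick product.
-/
theorem norm_prodB_le (p q : ℕ) :
    ‖prodB hT hB p q‖ ≤ 2 ^ (p + q) * (√p.factorial * √q.factorial) := by
  refine ContinuousLinearMap.opNorm_le_bound₂ _ (by positivity) fun f g => ?_
  rw [prodB_apply]
  refine (norm_mulL_le P _ _).trans ?_
  have h1 := norm_itoL_le hT hB f
  have h2 := norm_itoL_le hT hB g
  have h3 : (1 : ℝ) ≤ 2 ^ (p + q) := one_le_pow₀ (by norm_num)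
  calc ‖itoL hT hB p f‖ * ‖itoL hT hB q g‖
      ≤ (√p.factorial * ‖f‖) * (√q.factorial * ‖g‖) := by gcongr
    _ = 1 * (√p.factorial * √q.factorial) * ‖f‖ * ‖g‖ := by ring
    _ ≤ _ := by gcongr

theorem norm_wickB_le (p q : ℕ) :
    ‖wickB hT hB p q‖ ≤ 2 ^ (p + q) * (√p.factorial * √q.factorial) := by
  refine ContinuousLinearMap.opNorm_le_bound₂ _ (by positivity) fun f g => ?_
  rw [wickB_apply]
  refine (norm_itoL_le hT hB _).trans ?_
  rw [mul_assoc _ ‖f‖]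
  exact mul_le_mul (sqrt_factorial_add_le p q) (norm_tensorL_le f g) (norm_nonneg _)
    (by positivity)

/-- The integral does not change under permutations of the variables, so symmetrizing the tensor
product has no effect. -/
theorem multIto_symmTensor {p q : ℕ} (f : Kern T p) (g : Kern T q) :
    multIto P T B (p + q) (toL2 (cubeMeasure T (p + q)) (symmTensor f g)) =
      wickB hT hB p q f g := by
  rw [← itoL_apply hT hB, toL2_symmTensor, map_smul, map_sum]
  simp_rw [itoL_permK]
  rw [Finset.sum_const, Finset.card_univ, Fintype.card_perm, Fintype.card_fin,
    ← Nat.cast_smul_eq_nsmul ℝ, smul_smul, one_div, inv_mul_cancel₀ (by positivity), one_smul,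
    wickB_apply]

theorem wick_eq {X Y : Lp ℝ 2 P} (hs : Summable fun z : ℕ × ℕ =>
    wickB hT hB z.1 z.2 (chaosKernel P T B X z.1) (chaosKernel P T B Y z.2)) :
    HasSum (fun z : ℕ × ℕ =>
      wickB hT hB z.1 z.2 (chaosKernel P T B X z.1) (chaosKernel P T B Y z.2))
      (wick P T B X Y) := by
  have h1 := hasSum_antidiagonal hs.hasSum
  rw [wick]
  simp_rw [multIto_symmTensor hT hB]
  rw [h1.tsum_eq]
  exact hs.hasSum

end Products

/-! ### Termwise integration and summation over all chaoses -/

section Main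

variable {Ω : Type*} [MeasurableSpace Ω] {P : Measure Ω} [IsProbabilityMeasure P]
  {T : ℝ} {B : ℝ → Ω → ℝ} (hT : 0 < T) (hB : IsBrownianOn P T B)

theorem hasSum_mulL {x y : ℕ → Lp ℝ 2 P} {X Y : Lp ℝ 2 P} (hX : HasSum x X) (hY : HasSum y Y)
    (hs : Summable fun z : ℕ × ℕ => mulL P (x z.1) (y z.2)) :
    HasSum (fun z : ℕ × ℕ => mulL P (x z.1) (y z.2)) (mulL P X Y) :=
  hasSum_bilin (mulL P) hX hY hs

theorem hasSum_prodB {h g : (n : ℕ) → Kern T n} {X Y : Lp ℝ 2 P}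
    (hX : HasSum (fun n => itoL hT hB n (h n)) X) (hY : HasSum (fun n => itoL hT hB n (g n)) Y)
    (hs : Summable fun z : ℕ × ℕ => prodB hT hB z.1 z.2 (h z.1) (g z.2)) :
    HasSum (fun z : ℕ × ℕ => prodB hT hB z.1 z.2 (h z.1) (g z.2)) (mulL P X Y) := by
  obtain ⟨x, hx⟩ : ∃ x : ℕ → Lp ℝ 2 P, ∀ n, itoL hT hB n (h n) = x n := ⟨_, fun _ => rfl⟩
  obtain ⟨y, hy⟩ : ∃ y : ℕ → Lp ℝ 2 P, ∀ n, itoL hT hB n (g n) = y n := ⟨_, fun _ => rfl⟩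
  simp only [prodB_apply, hx, hy] at *
  exact hasSum_mulL hX hY hs

theorem hasSum_integral_mulL1 {X Y : Lp ℝ 2 P} (hX : X ∈ GSmooth P T B)
    (hY : Y ∈ GSmooth P T B) (k : ℕ) :
    Integrable (fun t => mulL1 P (hidaD P T B k X t) (hidaD P T B k Y t)) (cubeMeasure T k) ∧
      HasSum (fun z : ℕ × ℕ => descCoeff k z.1 z.2 • pairInt k (prodB hT hB z.1 z.2)
        (chaosKernel P T B X (z.1 + k)) (chaosKernel P T B Y (z.2 + k)))
        (∫ t, mulL1 P (hidaD P T B k X t) (hidaD P T B k Y t) ∂(cubeMeasure T k)) := by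
  refine hasSum_integral_pairing (norm_prodB_le hT hB) ((mem_GSmooth_iff hT hB).1 hX).2
    ((mem_GSmooth_iff hT hB).1 hY).2 k ?_
  filter_upwards [ae_hidaD hT hB hX k, ae_hidaD hT hB hY k] with t e1 e2 hs
  rw [mulL1_eq]
  exact hasSum_prodB hT hB e1.2.2 e2.2.2 hs

theorem hasSum_integral_wick {X Y : Lp ℝ 2 P} (hX : X ∈ GSmooth P T B)
    (hY : Y ∈ GSmooth P T B) (k : ℕ) :
    Integrable (fun t => wick P T B (hidaD P T B k X t) (hidaD P T B k Y t)) (cubeMeasure T k) ∧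
      HasSum (fun z : ℕ × ℕ => descCoeff k z.1 z.2 • pairInt k (wickB hT hB z.1 z.2)
        (chaosKernel P T B X (z.1 + k)) (chaosKernel P T B Y (z.2 + k)))
        (∫ t, wick P T B (hidaD P T B k X t) (hidaD P T B k Y t) ∂(cubeMeasure T k)) := by
  refine hasSum_integral_pairing (norm_wickB_le hT hB) ((mem_GSmooth_iff hT hB).1 hX).2
    ((mem_GSmooth_iff hT hB).1 hY).2 k ?_
  filter_upwards [ae_hidaD hT hB hX k, ae_hidaD hT hB hY k] with t e1 e2 hs
  -- The Wick product is defined through the chaos kernels of its factors, which for the derivatives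
  -- are the scaled slices.
  rw [← e1.2.1, ← e2.2.1] at hs ⊢
  exact wick_eq hT hB hs

/-- The chaos-wise identity, summed over all pairs of chaoses. -/
theorem inclL_tsum_eq {h g : (n : ℕ) → Kern T n} (hh : ∀ n, IsSymmKern (h n))
    (hg : ∀ n, IsSymmKern (g n)) {s : Lp ℝ 1 P} {s' : Lp ℝ 2 P}
    (h1 : HasSum (fun z : ℕ × ℕ × ℕ => (1 / (z.1.factorial : ℝ) * descCoeff z.1 z.2.1 z.2.2) •
      pairInt z.1 (prodB hT hB z.2.1 z.2.2) (h (z.2.1 + z.1)) (g (z.2.2 + z.1))) s)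
    (h2 : HasSum (fun z : ℕ × ℕ × ℕ => (2 ^ z.1 / (z.1.factorial : ℝ) *
      descCoeff z.1 z.2.1 z.2.2) •
      pairInt z.1 (wickB hT hB z.2.1 z.2.2) (h (z.2.1 + z.1)) (g (z.2.2 + z.1))) s') :
    inclL P s' = s := by
  -- Grouped by the degrees of the original kernels, both triple series become series of the finite
  -- sums compared in `sum_prodB_eq`.
  have e1 := hasSum_shift h1
  have e2 := (inclL P).hasSum (hasSum_shift h2)
  refine e2.unique ?_
  convert e1 using 2 with x
  obtain ⟨a, b⟩ := x
  have key := sum_prodB_eq hT hB (hh a) (hg b)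
  have hk : ∀ k ∈ Finset.range (min a b + 1), a - k + k = a ∧ b - k + k = b := by
    intro k hk
    have := Finset.mem_range.1 hk
    omega
  rw [Finset.sum_congr rfl fun k h' => by
      rw [castK_family (hk k h').1.symm h, castK_family (hk k h').2.symm g],
    Finset.sum_congr (s₁ := Finset.range (min a b + 1)) (g := fun k => (2 ^ k / (k.factorial : ℝ) *
      (a.descFactorial k * b.descFactorial k)) • pairInt k (wickB hT hB (a - k) (b - k))
        (h (a - k + k)) (g (b - k + k))) rfl fun k h' => by
      rw [castK_family (hk k h').1.symm h, castK_family (hk k h').2.symm g]] at key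
  have hd : ∀ k ∈ Finset.range (min a b + 1), descCoeff k (a - k) (b - k) =
      a.descFactorial k * b.descFactorial k := by
    intro k h'
    rw [descCoeff, (hk k h').1, (hk k h').2]
  simp only
  rw [Finset.sum_congr rfl fun k h' => by rw [hd k h'],
    Finset.sum_congr (s₁ := Finset.range (min a b + 1)) (f := fun k =>
      (1 / (k.factorial : ℝ) * descCoeff k (a - k) (b - k)) •
        pairInt k (prodB hT hB (a - k) (b - k)) (h (a - k + k)) (g (b - k + k))) rfl
      fun k h' => by rw [hd k h']]
  exact key.symm

end Main

end

theorem proposition5p1 {Ω : Type*} [MeasurableSpace Ω] (P : Measure Ω) [IsProbabilityMeasure P]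
    (T : ℝ) (hT : 0 < T) (B : ℝ → Ω → ℝ) (hB : IsBrownianOn P T B)
    (X Y : Lp ℝ 2 P) (hX : X ∈ GSmooth P T B) (hY : Y ∈ GSmooth P T B) :
    -- the anti-Wick product is well defined
    (∀ n, Integrable (fun t => mulL1 P (hidaD P T B n X t) (hidaD P T B n Y t))
      (cubeMeasure T n)) ∧
    HasSum (fun n : ℕ => (1 / (n.factorial : ℝ)) •
      ∫ t, mulL1 P (hidaD P T B n X t) (hidaD P T B n Y t) ∂(cubeMeasure T n))
      (antiWick P T B X Y) ∧
    -- the integrals of Wick products are well defined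
    (∀ n, ∀ᵐ t ∂(cubeMeasure T n),
      hidaD P T B n X t ∈ GSmooth P T B ∧ hidaD P T B n Y t ∈ GSmooth P T B) ∧
    (∀ n, Integrable (fun t => wick P T B (hidaD P T B n X t) (hidaD P T B n Y t))
      (cubeMeasure T n)) ∧
    -- the formula
    ∃ S : Lp ℝ 2 P,
      HasSum (fun n : ℕ => (2 ^ n / (n.factorial : ℝ)) •
        ∫ t, wick P T B (hidaD P T B n X t) (hidaD P T B n Y t) ∂(cubeMeasure T n)) S ∧
      S =ᵐ[P] antiWick P T B X Y := by
  obtain ⟨hXe, hXr⟩ := (mem_GSmooth_iff hT hB).1 hX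
  obtain ⟨hYe, hYr⟩ := (mem_GSmooth_iff hT hB).1 hY
  have s1 := (summable_pairInt (norm_prodB_le hT hB) hXr hYr (c := fun k => 1 / k.factorial)
    (fun k => by positivity) fun k => by
      gcongr
      exact one_le_pow₀ (by norm_num)).hasSum
  have s2 := (summable_pairInt (norm_wickB_le hT hB) hXr hYr (c := fun k => 2 ^ k / k.factorial)
    (fun k => by positivity) fun k => le_rfl).hasSum
  -- Summing the triple series first over the degrees at fixed order gives the integral of that
  -- order, for products here and for Wick products below.
  have a1 : HasSum (fun n : ℕ => (1 / (n.factorial : ℝ)) •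
      ∫ t, mulL1 P (hidaD P T B n X t) (hidaD P T B n Y t) ∂(cubeMeasure T n)) _ :=
    s1.prod_fiberwise fun k => by
      simpa only [smul_smul] using
        (hasSum_integral_mulL1 hT hB hX hY k).2.const_smul (1 / (k.factorial : ℝ))
  have a2 : HasSum (fun n : ℕ => (2 ^ n / (n.factorial : ℝ)) •
      ∫ t, wick P T B (hidaD P T B n X t) (hidaD P T B n Y t) ∂(cubeMeasure T n)) _ :=
    s2.prod_fiberwise fun k => by
      simpa only [smul_smul] using
        (hasSum_integral_wick hT hB hX hY k).2.const_smul (2 ^ k / (k.factorial : ℝ))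
  have h1 := inclL_tsum_eq hT hB hXe.1 hYe.1 s1 s2
  refine ⟨fun n => (hasSum_integral_mulL1 hT hB hX hY n).1, a1.summable.hasSum, fun n => ?_,
    fun n => (hasSum_integral_wick hT hB hX hY n).1, _, a2, ?_⟩
  · filter_upwards [ae_hidaD hT hB hX n, ae_hidaD hT hB hY n] with t e1 e2 using ⟨e1.1, e2.1⟩
  -- The two sums agree in L¹(Ω), where the inclusion of L² does not change the representative up to
  -- null sets.
  · have h2 : antiWick P T B X Y = _ := a1.tsum_eq
    rw [h2, ← h1]
    exact (coeFn_inclL P _).symm
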